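/- Let $d\in\{2,3\}$, $k\ge 2$, $N\in\mathbb N$, let $j\ge k+2N-1$, and let $\rho,\kappa,\alpha_0>0$. Let $\Omega\subset\mathbb R^d$ be a domain and $\mathcal T_h$ a finite partition of $\Omega$ into convex polygons ($d=2$) or convex polyhedra ($d=3$) that meet facet to facet. Write $h_T$, $h_e$ for the diameters of an element $T$ and of an edge/face $e$, and assume that $\mathcal T_h$ is shape regular: every element $T$ has at most $N$ edges/faces (hence $j>k$), $|T|\ge\rho h_T^d$, every edge/face $e$ of $T$ satisfies $|e|\ge\rho h_e^{d-1}$ and $h_e\ge\kappa h_T$, and the interior angle $\pi-\alpha$ between any two neighbouring edges/faces of $T$ satisfies $\alpha_0\le\alpha\le\pi-\alpha_0$. (Neighbouring means sharing a vertex if $d=2$, an edge if $d=3$.) Fix a unit normal $n_e$ on every edge/face $e$, and let $n$ denote the outward unit normal on $\partial T$. Let $V_h$ be the space of all $v=\{v_0,v_b,v_nn_e\}$ with $v_0|_T\in P_k(T)$ for every element $T$ and $v_b|_e\in P_k(e)$, $v_n|_e\in P_{k-1}(e)$ for every edge/face $e$ ($v_b$ and $v_n$ are single valued on $e$). The weak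 Laplacian $\Delta_wv$ of $v\in V_h$ is, on every $T$, the unique polynomial in $P_j(T)$ with $$(\Delta_wv,\varphi)_T=(v_0,\Delta\varphi)_T-\langle v_b,\nabla\varphi\cdot n\rangle_{\partial T}+\langle v_nn_e\cdot n,\varphi\rangle_{\partial T}\qquad\forall\varphi\in P_j(T).$$ Put $|||v|||^2=\sum_{T\in\mathcal T_h}\|\Delta_wv\|_T^2$ and $$\|v\|_{2,h}^2=\sum_{T\in\mathcal T_h}\Big(\|\Delta v_0\|_T^2+h_T^{-3}\|v_0-v_b\|_{\partial T}^2+h_T^{-1}\|(\nabla v_0-v_nn_e)\cdot n\|_{\partial T}^2\Big).$$ Then there are constants $C_1,C_2>0$, depending only on $d,k,N,j,\rho,\kappa,\alpha_0$ (and not on $\Omega$, the partition, the mesh size or the choice of the normals $n_e$), such that $$C_1\|v\|_{2,h}\le|||v|||\le C_2\|v\|_{2,h}\qquad\text{for all } v\in V_h.$$ -/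

import Mathlib

open MeasureTheory

noncomputable section

namespace WeakGalerkin

/-- The Euclidean space `ℝᵈ`. -/
abbrev Space (d : ℕ) : Type := EuclideanSpace ℝ (Fin d)

/-- Real polynomials in `d` variables of total degree at most `k`. -/
abbrev Poly (d k : ℕ) : Type := ↥(MvPolynomial.restrictTotalDegree (Fin d) ℝ k)

/-- The value of a polynomial at a point. -/
def ev {d : ℕ} (p : MvPolynomial (Fin d) ℝ) (x : Space d) : ℝ :=
  MvPolynomial.eval (fun i => x i) p

/-- The gradient of a polynomial at a point. -/
def grad {d : ℕ} (p : MvPolynomial (Fin d) ℝ) (x : Space d) : Space d :=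
  WithLp.toLp 2 fun i => ev (MvPolynomial.pderiv i p) x

/-- The Laplacian of a polynomial. -/
def lap {d : ℕ} (p : MvPolynomial (Fin d) ℝ) : MvPolynomial (Fin d) ℝ :=
  ∑ i, MvPolynomial.pderiv i (MvPolynomial.pderiv i p)

/-- A (full-dimensional, compact) convex polytope in `ℝᵈ`, given by its facets: the outward unit
normal and the offset of each of them. No inequality is redundant and none is listed twice, so
that the indices are in bijection with the facets. -/
structure ConvexPolytope (d : ℕ) where
  /-- number of facets -/
  numFacets : ℕ
  /-- outward unit normals -/
  normal : Fin numFacets → Space d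
  /-- offsets of the supporting hyperplanes -/
  offset : Fin numFacets → ℝ
  norm_normal : ∀ i, ‖normal i‖ = 1
  normal_injective : Function.Injective normal
  isBounded : Bornology.IsBounded {x : Space d | ∀ i, inner ℝ (normal i) x ≤ offset i}
  nonempty_interior : (interior {x : Space d | ∀ i, inner ℝ (normal i) x ≤ offset i}).Nonempty
  facet_pos : ∀ i, 0 < μHE[d - 1]
    ({x : Space d | ∀ i, inner ℝ (normal i) x ≤ offset i} ∩ {x | inner ℝ (normal i) x = offset i})

namespace ConvexPolytope

variable {d : ℕ} (T : ConvexPolytope d)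

/-- The polytope as a set. -/
def carrier : Set (Space d) := {x | ∀ i, inner ℝ (T.normal i) x ≤ T.offset i}

/-- The `i`-th facet (edge for `d = 2`, flat face for `d = 3`). -/
def facet (i : Fin T.numFacets) : Set (Space d) :=
  T.carrier ∩ {x | inner ℝ (T.normal i) x = T.offset i}

/-- The size `h_T`. -/
def size : ℝ := Metric.diam T.carrier

/-- Two facets are neighbours if they meet in a set of dimension `d - 2`
(a common vertex for `d = 2`, a common edge for `d = 3`). -/
def Neighbours (i i' : Fin T.numFacets) : Prop :=
  i ≠ i' ∧ (T.facet i ∩ T.facet i').Nonempty ∧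
    Module.finrank ℝ (vectorSpan ℝ (T.facet i ∩ T.facet i')) = d - 2

/-- The integral over `T`. -/
def integral (f : Space d → ℝ) : ℝ := ∫ x in T.carrier, f x

/-- The integral over the facet `i` with respect to surface measure. -/
def facetIntegral (i : Fin T.numFacets) (f : Space d → ℝ) : ℝ :=
  ∫ x in T.facet i, f x ∂μHE[d - 1]

/-- Shape regularity with parameters: at most `n` facets, `ρ h_T ^ d ≤ |T|`,
`ρ h_e ^ (d - 1) ≤ |e|` and `κ h_T ≤ h_e` for every facet `e`, and the angle
`π - α` between two neighbouring facets satisfies `α₀ ≤ α ≤ π - α₀`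
(`α` is the angle between the outward normals). -/
structure ShapeRegular (n : ℕ) (ρ κ α₀ : ℝ) : Prop where
  numFacets_le : T.numFacets ≤ n
  volume_ge : ρ * T.size ^ d ≤ (volume T.carrier).toReal
  facet_volume_ge : ∀ i,
    ρ * Metric.diam (T.facet i) ^ (d - 1) ≤ (μHE[d - 1] (T.facet i)).toReal
  facet_diam_ge : ∀ i, κ * T.size ≤ Metric.diam (T.facet i)
  angle_ge : ∀ i i', T.Neighbours i i' →
    α₀ ≤ InnerProductGeometry.angle (T.normal i) (T.normal i')
  angle_le : ∀ i i', T.Neighbours i i' →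
    InnerProductGeometry.angle (T.normal i) (T.normal i') ≤ Real.pi - α₀

end ConvexPolytope

/-- A partition of the domain `Ω` into convex polytopes, meeting facet to facet, together with
a choice of a unit normal direction on every facet. -/
structure Mesh (d : ℕ) (Ω : Set (Space d)) where
  /-- number of cells -/
  numCells : ℕ
  /-- the cells -/
  cell : Fin numCells → ConvexPolytope d
  closure_eq : closure Ω = ⋃ T, (cell T).carrier
  disjoint_interior : ∀ T T', T ≠ T' →
    Disjoint (interior (cell T).carrier) (interior (cell T').carrier)
  /-- two facets of cells either coincide or do not overlap -/
  facet_to_facet : ∀ T i T' i', (cell T).facet i ≠ (cell T').facet i' →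
    μHE[d - 1] ((cell T).facet i ∩ (cell T').facet i') = 0
  /-- the unit normal directions `n_e` -/
  normalDir : {e : Set (Space d) // ∃ T i, e = (cell T).facet i} → Space d
  norm_normalDir : ∀ e, ‖normalDir e‖ = 1
  normalDir_orthogonal : ∀ e, ∀ x ∈ e.1, ∀ y ∈ e.1, inner ℝ (normalDir e) (x - y) = 0

namespace Mesh

variable {d : ℕ} {Ω : Set (Space d)} (M : Mesh d Ω)

/-- The set of all edges / flat faces of the mesh. -/
abbrev Facets : Type := {e : Set (Space d) // ∃ T i, e = (M.cell T).facet i}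

/-- The facet `i` of the cell `T`, as a facet of the mesh. -/
def facetOf (T : Fin M.numCells) (i : Fin (M.cell T).numFacets) : M.Facets :=
  ⟨(M.cell T).facet i, T, i, rfl⟩

/-- Shape regularity of all cells. -/
def ShapeRegular (n : ℕ) (ρ κ α₀ : ℝ) : Prop := ∀ T, (M.cell T).ShapeRegular n ρ κ α₀

/-- The weak Galerkin space `V_h`: `v₀` is a polynomial of degree `≤ k` on each cell, and
`v_b`, `v_n` are, on each facet, (restrictions to the facet of) polynomials of degree
`≤ k` and `≤ k - 1`. The facet components enter all definitions below only through their values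
on the facet, and are single valued: shared by the two cells that contain the facet. -/
structure WGSpace (k : ℕ) where
  /-- the interior component -/
  v0 : Fin M.numCells → Poly d k
  /-- the boundary value -/
  vb : M.Facets → Poly d k
  /-- the component of the normal derivative along `normalDir` -/
  vn : M.Facets → Poly d (k - 1)

variable {M} {k : ℕ} (v : M.WGSpace k)

/-- The right-hand side of the definition of the weak Laplacian on the cell `T`:
`(v₀, Δφ)_T - ⟨v_b, ∇φ · n⟩_∂T + ⟨v_n n_e · n, φ⟩_∂T`. -/
def WGSpace.weakLapRHS (T : Fin M.numCells) (φ : MvPolynomial (Fin d) ℝ) : ℝ :=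
  (M.cell T).integral (fun x => ev (v.v0 T).1 x * ev (lap φ) x)
  - ∑ i, (M.cell T).facetIntegral i (fun x =>
      ev (v.vb (M.facetOf T i)).1 x * inner ℝ (grad φ x) ((M.cell T).normal i))
  + ∑ i, (M.cell T).facetIntegral i (fun x =>
      inner ℝ (ev (v.vn (M.facetOf T i)).1 x • M.normalDir (M.facetOf T i))
        ((M.cell T).normal i) * ev φ x)

/-- `w ∈ P_j(T)` satisfies the defining equation of the weak Laplacian of `v` on `T`. -/
def WGSpace.IsWeakLap (j : ℕ) (T : Fin M.numCells) (w : Poly d j) : Prop :=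
  ∀ φ : Poly d j,
    (M.cell T).integral (fun x => ev w.1 x * ev φ.1 x) = v.weakLapRHS T φ.1

end Mesh

/-! ### Existence and uniqueness of the weak Laplacian -/

theorem continuous_ev {d : ℕ} (p : MvPolynomial (Fin d) ℝ) : Continuous (ev p) := by
  unfold ev
  exact (MvPolynomial.continuous_eval p).comp (by fun_prop)

theorem continuous_grad {d : ℕ} (p : MvPolynomial (Fin d) ℝ) : Continuous (grad p) := by
  unfold grad
  have h : Continuous fun x : Space d => fun i => ev (MvPolynomial.pderiv i p) x :=
    continuous_pi fun i => continuous_ev _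
  exact (PiLp.continuous_toLp 2 _).comp h

namespace ConvexPolytope

variable {d : ℕ} (T : ConvexPolytope d)

theorem isClosed_carrier : IsClosed T.carrier := by
  have : T.carrier = ⋂ i, {x | inner ℝ (T.normal i) x ≤ T.offset i} := by
    ext x; simp [carrier]
  rw [this]
  exact isClosed_iInter fun i => isClosed_le (by fun_prop) continuous_const

theorem isCompact_carrier : IsCompact T.carrier :=
  Metric.isCompact_of_isClosed_isBounded T.isClosed_carrier T.isBounded

theorem isCompact_facet (i : Fin T.numFacets) : IsCompact (T.facet i) :=
  T.isCompact_carrier.inter_right (isClosed_eq (by fun_prop) continuous_const)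

theorem facet_lt_top (i : Fin T.numFacets) : μHE[d - 1] (T.facet i) < ⊤ := by
  set n := T.normal i with hn
  have hn1 : ‖n‖ = 1 := T.norm_normal i
  have hn0 : n ≠ 0 := by
    intro h; rw [h, norm_zero] at hn1; exact zero_ne_one hn1
  let K : Submodule ℝ (Space d) := (ℝ ∙ n)ᗮ
  have hd : Module.finrank ℝ K = d - 1 := by
    have h1 := Submodule.finrank_add_finrank_orthogonal (ℝ ∙ n)
    rw [finrank_span_singleton hn0, finrank_euclideanSpace_fin] at h1
    change 1 + Module.finrank ℝ K = d at h1
    omega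
  let f : K → Space d := fun y => T.offset i • n + (y : Space d)
  have hf : Isometry f := (isometry_add_left _).comp isometry_subtype_coe
  have himg : T.facet i ⊆ f '' (f ⁻¹' T.facet i) := by
    intro x hx
    have hxi : inner ℝ n x = T.offset i := hx.2
    have hmem : x - T.offset i • n ∈ K := by
      rw [Submodule.mem_orthogonal_singleton_iff_inner_right, inner_sub_right, inner_smul_right,
        real_inner_self_eq_norm_sq, hn1, hxi]
      ring
    have hfx : f ⟨x - T.offset i • n, hmem⟩ = x := by simp [f]
    exact ⟨⟨_, hmem⟩, by rw [Set.mem_preimage, hfx]; exact hx, hfx⟩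
  have hb : Bornology.IsBounded (f ⁻¹' T.facet i) := by
    have h1 := hf.antilipschitz.isBounded_preimage (T.isCompact_facet i).isBounded
    exact h1
  refine (measure_mono himg).trans_lt ?_
  rw [hf.euclideanHausdorffMeasure_image, ← hd]
  exact hb.measure_lt_top

theorem integrableOn {f : Space d → ℝ} (hf : Continuous f) : IntegrableOn f T.carrier :=
  hf.continuousOn.integrableOn_compact T.isCompact_carrier

theorem integrableOn_facet (i : Fin T.numFacets) {f : Space d → ℝ} (hf : Continuous f) :
    IntegrableOn f (T.facet i) μHE[d - 1] :=
  hf.continuousOn.integrableOn_of_subset_isCompact (T.isCompact_facet i)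
    (T.isCompact_facet i).measurableSet subset_rfl (T.facet_lt_top i).ne

theorem eq_zero_of_integral_sq (p : MvPolynomial (Fin d) ℝ)
    (h : T.integral (fun x => ev p x * ev p x) = 0) : p = 0 := by
  have hc : Continuous fun x => ev p x * ev p x := (continuous_ev p).mul (continuous_ev p)
  have h1 : (fun x => ev p x * ev p x) =ᵐ[volume.restrict T.carrier] 0 :=
    (integral_eq_zero_iff_of_nonneg (fun x => mul_self_nonneg _) (T.integrableOn hc)).1 h
  have h2 : (fun x => ev p x * ev p x) =ᵐ[volume.restrict (interior T.carrier)] 0 :=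
    ae_restrict_of_ae_restrict_of_subset interior_subset h1
  have h3 : Set.EqOn (fun x => ev p x * ev p x) 0 (interior T.carrier) :=
    Measure.eqOn_open_of_ae_eq h2 isOpen_interior hc.continuousOn continuousOn_const
  obtain ⟨x, hx⟩ : (interior T.carrier).Nonempty := T.nonempty_interior
  let U : Set (Fin d → ℝ) := (fun y => WithLp.toLp 2 y) ⁻¹' interior T.carrier
  have hU : IsOpen U := isOpen_interior.preimage (PiLp.continuous_toLp 2 _)
  have hxU : (fun i => x i) ∈ U := hx
  obtain ⟨r, hr, hball⟩ := Metric.isOpen_iff.1 hU _ hxU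
  refine MvPolynomial.funext_set (fun i => Metric.ball (x i) r) (fun i => ?_) (fun y hy => ?_)
  · rw [Real.ball_eq_Ioo]
    exact Set.Ioo_infinite (by linarith)
  · have hyU : y ∈ U := by
      apply hball
      rw [ball_pi _ hr]
      exact hy
    have := h3 hyU
    simpa [ev] using this

end ConvexPolytope

namespace Mesh

variable {d : ℕ} {Ω : Set (Space d)} {M : Mesh d Ω} {k : ℕ} (v : M.WGSpace k)

theorem WGSpace.weakLapRHS_add (T : Fin M.numCells) (φ ψ : MvPolynomial (Fin d) ℝ) :
    v.weakLapRHS T (φ + ψ) = v.weakLapRHS T φ + v.weakLapRHS T ψ := by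
  have e1 : ∀ x, ev (φ + ψ) x = ev φ x + ev ψ x := fun x => by simp [ev]
  have e2 : ∀ x, ev (lap (φ + ψ)) x = ev (lap φ) x + ev (lap ψ) x := fun x => by
    simp [ev, lap, Finset.sum_add_distrib]
  have e3 : ∀ x, grad (φ + ψ) x = grad φ x + grad ψ x := fun x => by
    ext i; simp [grad, ev]
  have c := fun p : MvPolynomial (Fin d) ℝ => continuous_ev p
  have g := fun p : MvPolynomial (Fin d) ℝ => continuous_grad p
  have key1 := integral_add ((M.cell T).integrableOn ((c (v.v0 T).1).mul (c (lap φ))))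
    ((M.cell T).integrableOn ((c (v.v0 T).1).mul (c (lap ψ))))
  have key2 := fun i => integral_add
    ((M.cell T).integrableOn_facet i ((c (v.vb (M.facetOf T i)).1).mul
      ((g φ).inner (continuous_const (y := (M.cell T).normal i)))))
    ((M.cell T).integrableOn_facet i ((c (v.vb (M.facetOf T i)).1).mul
      ((g ψ).inner (continuous_const (y := (M.cell T).normal i)))))
  have key3 := fun i => integral_add
    ((M.cell T).integrableOn_facet i ((((c (v.vn (M.facetOf T i)).1).smul
      (continuous_const (y := M.normalDir (M.facetOf T i)))).inner (𝕜 := ℝ)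
      (continuous_const (y := (M.cell T).normal i))).mul (c φ)))
    ((M.cell T).integrableOn_facet i ((((c (v.vn (M.facetOf T i)).1).smul
      (continuous_const (y := M.normalDir (M.facetOf T i)))).inner (𝕜 := ℝ)
      (continuous_const (y := (M.cell T).normal i))).mul (c ψ)))
  unfold WGSpace.weakLapRHS ConvexPolytope.integral ConvexPolytope.facetIntegral
  simp only [e1, e2, e3, mul_add, inner_add_left]
  simp only [Pi.mul_apply, Pi.smul_apply'] at key1 key2 key3
  rw [key1, Finset.sum_congr rfl fun i _ => key2 i, Finset.sum_congr rfl fun i _ => key3 i,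
    Finset.sum_add_distrib, Finset.sum_add_distrib]
  ring

theorem WGSpace.weakLapRHS_smul (T : Fin M.numCells) (a : ℝ) (φ : MvPolynomial (Fin d) ℝ) :
    v.weakLapRHS T (a • φ) = a * v.weakLapRHS T φ := by
  have e1 : ∀ x, ev (a • φ) x = a * ev φ x := fun x => by simp [ev, MvPolynomial.smul_eval]
  have e2 : ∀ x, ev (lap (a • φ)) x = a * ev (lap φ) x := fun x => by
    simp [ev, lap, MvPolynomial.smul_eval, Finset.mul_sum]
  have e3 : ∀ x, grad (a • φ) x = a • grad φ x := fun x => by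
    ext i; simp [grad, ev, MvPolynomial.smul_eval]
  unfold WGSpace.weakLapRHS ConvexPolytope.integral ConvexPolytope.facetIntegral
  simp only [e1, e2, e3, mul_left_comm _ a, real_inner_smul_left _ _ a, integral_const_mul,
    ← Finset.mul_sum]
  ring

theorem WGSpace.existsUnique_isWeakLap (j : ℕ) (T : Fin M.numCells) :
    ∃! w : Poly d j, v.IsWeakLap j T w := by
  have c := fun p : MvPolynomial (Fin d) ℝ => continuous_ev p
  have ea : ∀ (p q : MvPolynomial (Fin d) ℝ) x, ev (p + q) x = ev p x + ev q x :=
    fun p q x => by simp [ev]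
  have es : ∀ (a : ℝ) (p : MvPolynomial (Fin d) ℝ) x, ev (a • p) x = a * ev p x :=
    fun a p x => by simp [ev, MvPolynomial.smul_eval]
  let B : Poly d j →ₗ[ℝ] Module.Dual ℝ (Poly d j) := LinearMap.mk₂ ℝ
    (fun p q => (M.cell T).integral (fun x => ev p.1 x * ev q.1 x))
    (fun p p' q => by
      simp only [ConvexPolytope.integral, Submodule.coe_add, ea, add_mul]
      exact integral_add ((M.cell T).integrableOn ((c _).mul (c _)))
        ((M.cell T).integrableOn ((c _).mul (c _))))
    (fun a p q => by
      simp only [ConvexPolytope.integral, Submodule.coe_smul, es, mul_assoc,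
        integral_const_mul, smul_eq_mul])
    (fun p q q' => by
      simp only [ConvexPolytope.integral, Submodule.coe_add, ea, mul_add]
      exact integral_add ((M.cell T).integrableOn ((c _).mul (c _)))
        ((M.cell T).integrableOn ((c _).mul (c _))))
    (fun a p q => by
      simp only [ConvexPolytope.integral, Submodule.coe_smul, es, mul_left_comm _ a,
        integral_const_mul, smul_eq_mul])
  have hinj : Function.Injective B := by
    rw [← LinearMap.ker_eq_bot, LinearMap.ker_eq_bot']
    intro p hp
    have : B p p = 0 := by rw [hp]; rfl
    exact Subtype.ext ((M.cell T).eq_zero_of_integral_sq p.1 this)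
  have hsurj : Function.Surjective B :=
    (LinearMap.injective_iff_surjective_of_finrank_eq_finrank
      (Subspace.dual_finrank_eq (K := ℝ) (V := Poly d j)).symm).1 hinj
  let F : Module.Dual ℝ (Poly d j) :=
    { toFun := fun φ => v.weakLapRHS T φ.1
      map_add' := fun φ ψ => v.weakLapRHS_add T φ.1 ψ.1
      map_smul' := fun a φ => v.weakLapRHS_smul T a φ.1 }
  obtain ⟨w, hw⟩ := hsurj F
  refine ⟨w, fun φ => LinearMap.congr_fun hw φ, fun w' hw' => hinj ?_⟩
  rw [hw]
  exact LinearMap.ext hw'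

/-- The weak Laplacian `Δ_w v` on the cell `T`: the unique `w ∈ P_j(T)` with
`(w, φ)_T = (v₀, Δφ)_T - ⟨v_b, ∇φ · n⟩_∂T + ⟨v_n n_e · n, φ⟩_∂T` for all `φ ∈ P_j(T)`. -/
def WGSpace.weakLap (j : ℕ) (T : Fin M.numCells) : Poly d j :=
  (v.existsUnique_isWeakLap j T).choose

theorem WGSpace.weakLap_spec (j : ℕ) (T : Fin M.numCells) :
    v.IsWeakLap j T (v.weakLap j T) :=
  (v.existsUnique_isWeakLap j T).choose_spec.1

/-- The energy norm `|||v|||`, `|||v|||² = (Δ_w v, Δ_w v)_{𝒯_h}`. -/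
def WGSpace.tripleNorm (j : ℕ) : ℝ :=
  Real.sqrt (∑ T, (M.cell T).integral (fun x => (ev (v.weakLap j T).1 x) ^ 2))

/-- The discrete `H²` norm `‖v‖_{2,h}`. -/
def WGSpace.norm2h : ℝ :=
  Real.sqrt (∑ T,
    ((M.cell T).integral (fun x => (ev (lap (v.v0 T).1) x) ^ 2)
    + (M.cell T).size ^ (-3 : ℤ) * ∑ i, (M.cell T).facetIntegral i (fun x =>
        (ev (v.v0 T).1 x - ev (v.vb (M.facetOf T i)).1 x) ^ 2)
    + (M.cell T).size ^ (-1 : ℤ) * ∑ i, (M.cell T).facetIntegral i (fun x =>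
        (inner ℝ (grad (v.v0 T).1 x
            - ev (v.vn (M.facetOf T i)).1 x • M.normalDir (M.facetOf T i))
          ((M.cell T).normal i)) ^ 2)))

end Mesh

end WeakGalerkin

end

open MeasureTheory

noncomputable section

namespace WeakGalerkin

/-! ### Polynomials on the unit ball -/

/-! The norms are compared cell by cell. On a cell `T` of size `h`, Green's second identity
(`integral_mul_lap`) turns the definition of the weak Laplacian `w` into (w, φ) = (Δv₀, φ) + ∑ᵢ ⟨aᵢ,
∇φ·n⟩ - ∑ᵢ ⟨gᵢ, φ⟩, where aᵢ = v₀ - v_b and gᵢ = (∇v₀ - v_n n_e)·n are the jumps on the facet i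
(`WeakIdentity`). Taking φ = w, the bound of |||v||| by ‖v‖ follows from Cauchy-Schwarz, a trace
inequality and an inverse inequality (`Bounds.weakLap_le`).

For the converse, three kinds of test functions isolate the three terms. Let λ_l be the signed
distance to the hyperplane of the facet l, B the product of all λ_l, Bᵢ the product over l ≠ i, and
E the extension of a polynomial from a facet, constant in the normal direction. φ = B² Δv₀ has no
boundary terms (`Bounds.interior_le`). φ = λᵢ Bᵢ² E aᵢ leaves only -⟨Bᵢ² aᵢ, aᵢ⟩ on the boundary
(`Bounds.value_jump_le`). φ = Bᵢ² E gᵢ leaves ⟨Bᵢ² gᵢ, gᵢ⟩ and a term with the jump aᵢ, which is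
already controlled (`Bounds.derivative_jump_le`). The second has degree at most 2N - 1 + k; this is
where the condition on j comes from.

The constants must be uniform over polytopes that are not affine images of one reference cell.
Compactness of the unit sphere of P_m shows that a polynomial can be small, relative to its size on
the unit ball, only on a set of small measure (`exists_sublevel_small`). So on every subset of a
ball that fills a fixed proportion of it, a weighted L² norm controls the maximum over the ball, as
soon as each factor of the weight is of order h somewhere in the ball
(`Chart.exists_weighted_lower`). For B this is immediate. For Bᵢ on the facet i one needs a point of
the facet at distance at least δh from all other hyperplanes (`exists_separation`). The angle
condition concerns neighbouring facets only, so nearly coplanar facets that do not meet have to be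
ruled out; this rests on centroids (`Chart.exists_centroid`) and on the fact that neighbours alone
cut a facet out of its hyperplane (`mem_carrier_of_neighbours`). -/

theorem volume_setOf_eval_eq_zero : ∀ {d : ℕ} {p : MvPolynomial (Fin d) ℝ}, p ≠ 0 →
    volume {x : Fin d → ℝ | MvPolynomial.eval x p = 0} = 0
  | 0, p, hp => by
    have : {x : Fin 0 → ℝ | MvPolynomial.eval x p = 0} = ∅ := by
      refine Set.eq_empty_of_forall_notMem fun x h => hp ?_
      rw [Set.mem_ofPred_eq, MvPolynomial.eq_C_of_isEmpty p] at h
      rw [MvPolynomial.eq_C_of_isEmpty p]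
      simpa using h
    rw [this, measure_empty]
  | d + 1, p, hp => by
    set P := MvPolynomial.finSuccEquiv ℝ d p with hP
    have hP0 : P ≠ 0 := by simpa [hP] using hp
    obtain ⟨m, hm⟩ : ∃ m, P.coeff m ≠ 0 := by
      by_contra! h
      exact hP0 (Polynomial.ext fun m => by simpa using h m)
    have hmeas : MeasurableSet {x : Fin (d + 1) → ℝ | MvPolynomial.eval x p = 0} :=
      (isClosed_eq (MvPolynomial.continuous_eval p) continuous_const).measurableSet
    have e := volume_preserving_piFinSuccAbove (fun _ : Fin (d + 1) => ℝ) 0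
    rw [← e.symm.measure_preimage_equiv, Measure.volume_eq_prod,
      Measure.prod_apply_symm ((MeasurableEquiv.measurable _) hmeas)]
    -- Fubini in the first variable: off the zero set of one nonzero coefficient of `P`, which is
    -- null by induction, the slice polynomial is nonzero and has finitely many roots.
    have hae : ∀ᵐ y : Fin d → ℝ, MvPolynomial.eval y (P.coeff m) ≠ 0 := by
      rw [ae_iff]
      simpa using volume_setOf_eval_eq_zero hm
    rw [lintegral_eq_zero_iff']
    · filter_upwards [hae] with y hy
      refine Set.Finite.measure_zero ?_ _
      have hne : Polynomial.map (MvPolynomial.eval y) P ≠ 0 := by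
        intro h
        apply hy
        have := congrArg (fun q => q.coeff m) h
        simpa using this
      refine (Polynomial.finite_setOfPred_isRoot hne).subset fun t ht => ?_
      have h1 : MvPolynomial.eval (Fin.cons t y : Fin (d + 1) → ℝ) p = 0 := by
        have h2 := ht
        simpa [MeasurableEquiv.piFinSuccAbove, Fin.insertNth_zero', Fin.consEquiv] using h2
      rwa [MvPolynomial.eval_eq_eval_mv_eval'] at h1
    · exact (measurable_measure_prodMk_right
        ((MeasurableEquiv.measurable _) hmeas)).aemeasurable

theorem volume_setOf_ev_eq_zero {d : ℕ} {p : MvPolynomial (Fin d) ℝ} (hp : p ≠ 0) :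
    volume {x : Space d | ev p x = 0} = 0 := by
  rw [← (PiLp.volume_preserving_toLp (Fin d)).measure_preimage
    (isClosed_eq (continuous_ev p) continuous_const).measurableSet.nullMeasurableSet]
  exact volume_setOf_eval_eq_zero hp

/-- Restriction of polynomials to the closed unit ball. -/
def restrictBall (d m : ℕ) : Poly d m →ₗ[ℝ] C(Metric.closedBall (0 : Space d) 1, ℝ) where
  toFun q := ⟨fun x => ev q.1 x, (continuous_ev q.1).comp continuous_subtype_val⟩
  map_add' p q := by ext x; simp [ev]
  map_smul' a q := by ext x; simp [ev, MvPolynomial.smul_eval]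

@[simp] theorem restrictBall_apply {d m : ℕ} (q : Poly d m) (x) :
    restrictBall d m q x = ev q.1 x := rfl

/-- Makes the supremum norm on the ball a norm on `Poly d m`. In finite dimension its spheres are
compact and linear maps are bounded; all uniform constants come from this. -/
theorem restrictBall_injective (d m : ℕ) : Function.Injective (restrictBall d m) := by
  rw [← LinearMap.ker_eq_bot, LinearMap.ker_eq_bot']
  intro q hq
  by_contra hne
  have h0 : q.1 ≠ 0 := fun h => hne (Subtype.ext h)
  have h1 := volume_setOf_ev_eq_zero h0
  have h2 : Metric.closedBall (0 : Space d) 1 ⊆ {x | ev q.1 x = 0} := fun x hx =>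
    congrArg (fun f : C(Metric.closedBall (0 : Space d) 1, ℝ) => f ⟨x, hx⟩) hq
  have h3 : 0 < volume (Metric.closedBall (0 : Space d) 1) :=
    Metric.measure_closedBall_pos _ _ one_pos
  exact h3.ne' (measure_mono_null h2 h1)

theorem norm_restrictBall_le {d m : ℕ} {q : Poly d m} {M : ℝ}
    (h : ∀ x ∈ Metric.closedBall (0 : Space d) 1, |ev q.1 x| ≤ M) :
    ‖restrictBall d m q‖ ≤ M := by
  have hM : 0 ≤ M := (abs_nonneg _).trans (h 0 (by simp))
  exact (ContinuousMap.norm_le _ hM).2 fun x => h x x.2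

theorem exists_bound_of_finiteDimensional {V W : Type*} [NormedAddCommGroup V] [NormedSpace ℝ V]
    [FiniteDimensional ℝ V] [NormedAddCommGroup W] [NormedSpace ℝ W] (f : V →ₗ[ℝ] W) :
    ∃ C : ℝ, 0 < C ∧ ∀ v, ‖f v‖ ≤ C * ‖v‖ := by
  refine ⟨‖LinearMap.toContinuousLinearMap f‖ + 1, by positivity, fun v => ?_⟩
  refine ((LinearMap.toContinuousLinearMap f).le_opNorm v).trans ?_
  gcongr
  linarith

/-- All linear maps on polynomials of bounded degree are bounded in the supremum norm. -/
theorem exists_bound_linearMap {d m : ℕ} {W : Type*} [NormedAddCommGroup W] [NormedSpace ℝ W]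
    (D : Poly d m →ₗ[ℝ] W) : ∃ C : ℝ, 0 < C ∧ ∀ (q : Poly d m) (M : ℝ),
      (∀ x ∈ Metric.closedBall (0 : Space d) 1, |ev q.1 x| ≤ M) → ‖D q‖ ≤ C * M := by
  let e := LinearEquiv.ofInjective (restrictBall d m) (restrictBall_injective d m)
  obtain ⟨C, hC, hF⟩ := exists_bound_of_finiteDimensional
    (V := LinearMap.range (restrictBall d m)) (D.comp e.symm.toLinearMap)
  refine ⟨C, hC, fun q M h => ?_⟩
  have h1 := hF (e q)
  simp only [LinearMap.comp_apply, LinearEquiv.coe_coe, LinearEquiv.symm_apply_apply] at h1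
  have h2 : ‖e q‖ ≤ M := norm_restrictBall_le h
  exact h1.trans (mul_le_mul_of_nonneg_left h2 hC.le)

/-- A Markov inequality with an unspecified constant: taking gradients is a linear map on a
finite-dimensional space. -/
theorem exists_grad_bound (d m : ℕ) : ∃ C : ℝ, 0 < C ∧ ∀ (q : MvPolynomial (Fin d) ℝ) (M : ℝ),
    q.totalDegree ≤ m → (∀ x ∈ Metric.closedBall (0 : Space d) 1, |ev q x| ≤ M) →
      ∀ x ∈ Metric.closedBall (0 : Space d) 1, ‖grad q x‖ ≤ C * M := by
  let D : Poly d m →ₗ[ℝ] C(Metric.closedBall (0 : Space d) 1, Space d) :=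
    { toFun := fun q => ⟨fun x => grad q.1 x, (continuous_grad q.1).comp continuous_subtype_val⟩
      map_add' := fun p q => by ext x; simp [grad, ev]
      map_smul' := fun a q => by ext x; simp [grad, ev, MvPolynomial.smul_eval] }
  obtain ⟨C, hC, h⟩ := exists_bound_linearMap D
  refine ⟨C, hC, fun q M hq hM x hx => ?_⟩
  have hmem : q ∈ MvPolynomial.restrictTotalDegree (Fin d) ℝ m :=
    (MvPolynomial.mem_restrictTotalDegree _ _ _).2 hq
  exact ((D ⟨q, hmem⟩).norm_coe_le_norm ⟨x, hx⟩).trans (h ⟨q, hmem⟩ M hM)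

/-- For one polynomial the sublevel sets shrink to its zero set, which is null. The threshold found
this way works for all nearby polynomials, and compactness of the unit sphere makes it uniform. -/
theorem exists_sublevel_small_of_norm_one (d m : ℕ) {η : ℝ} (hη : 0 < η) :
    ∃ ε : ℝ, 0 < ε ∧ ∀ q : Poly d m, ‖restrictBall d m q‖ = 1 →
      volume {x ∈ Metric.closedBall (0 : Space d) 1 | |ev q.1 x| < ε} ≤ ENNReal.ofReal η := by
  let V := LinearMap.range (restrictBall d m)
  have hcomp : IsCompact (((↑) : V → C(Metric.closedBall (0 : Space d) 1, ℝ)) ''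
      Metric.sphere (0 : V) 1) := (isCompact_sphere _ _).image continuous_subtype_val
  suffices H : ∃ ε : ℝ, 0 < ε ∧ ∀ f ∈ ((↑) : V → C(Metric.closedBall (0 : Space d) 1, ℝ)) ''
      Metric.sphere (0 : V) 1, ∀ q : Poly d m, restrictBall d m q = f →
      volume {x ∈ Metric.closedBall (0 : Space d) 1 | |ev q.1 x| < ε} ≤ ENNReal.ofReal η by
    obtain ⟨ε, hε, h⟩ := H
    refine ⟨ε, hε, fun q hq => h _ ⟨⟨restrictBall d m q, q, rfl⟩, ?_, rfl⟩ q rfl⟩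
    simpa using hq
  refine hcomp.induction_on ⟨1, one_pos, by simp⟩ ?_ ?_ ?_
  · rintro s t hst ⟨ε, hε, h⟩
    exact ⟨ε, hε, fun f hf => h f (hst hf)⟩
  · rintro s t ⟨ε, hε, h⟩ ⟨ε', hε', h'⟩
    refine ⟨min ε ε', lt_min hε hε', fun f hf q hq => ?_⟩
    rcases hf with hf | hf
    · refine le_trans (measure_mono ?_) (h f hf q hq)
      exact fun x hx => ⟨hx.1, hx.2.trans_le (min_le_left _ _)⟩
    · refine le_trans (measure_mono ?_) (h' f hf q hq)
      exact fun x hx => ⟨hx.1, hx.2.trans_le (min_le_right _ _)⟩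
  · rintro _ ⟨⟨f, q, rfl⟩, hf, rfl⟩
    have hq0 : q.1 ≠ 0 := by
      intro h0
      have : q = 0 := Subtype.ext h0
      subst this
      simp at hf
    have hlim := tendsto_measure_iInter_atTop (μ := volume)
      (s := fun n : ℕ => {x ∈ Metric.closedBall (0 : Space d) 1 | |ev q.1 x| ≤ 1 / (n + 1 : ℝ)})
      (fun n => ((Metric.isClosed_closedBall).inter (isClosed_le
        (continuous_ev q.1).abs continuous_const)).measurableSet.nullMeasurableSet)
      (fun i j hij x hx => ⟨hx.1, hx.2.trans (Nat.one_div_le_one_div hij)⟩)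
      ⟨0, ((measure_mono fun x hx => hx.1).trans_lt
        (measure_closedBall_lt_top (x := (0 : Space d)) (r := 1))).ne⟩
    have hnull : volume (⋂ n : ℕ, {x ∈ Metric.closedBall (0 : Space d) 1 |
        |ev q.1 x| ≤ 1 / (n + 1 : ℝ)}) = 0 := by
      refine measure_mono_null (fun x hx => ?_) (volume_setOf_ev_eq_zero hq0)
      rw [Set.mem_iInter] at hx
      have : |ev q.1 x| ≤ 0 :=
        ge_of_tendsto' tendsto_one_div_add_atTop_nhds_zero_nat fun n => (hx n).2
      simpa using this
    rw [hnull] at hlim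
    obtain ⟨n, hn⟩ := (hlim.eventually_lt_const (ENNReal.ofReal_pos.2 hη)).exists
    have hr : (0 : ℝ) < 1 / (n + 1 : ℝ) := Nat.one_div_pos_of_nat
    -- Half of the threshold is spent on the distance between the two polynomials; the other half is
    -- the `ε` of the neighbourhood.
    refine ⟨Metric.ball (restrictBall d m q) (1 / (n + 1 : ℝ) / 2),
      mem_nhdsWithin_of_mem_nhds (Metric.ball_mem_nhds _ (half_pos hr)),
      1 / (n + 1 : ℝ) / 2, half_pos hr, fun f hf q' hq' => ?_⟩
    subst hq'
    refine le_trans (measure_mono ?_) hn.le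
    intro x hx
    refine ⟨hx.1, ?_⟩
    have h1 := ContinuousMap.dist_apply_le_dist (f := restrictBall d m q')
      (g := restrictBall d m q) ⟨x, hx.1⟩
    have h2 : dist (restrictBall d m q') (restrictBall d m q) < 1 / (n + 1 : ℝ) / 2 := hf
    simp only [restrictBall_apply, Real.dist_eq] at h1
    have h3 := abs_sub_abs_le_abs_sub (ev q.1 x) (ev q'.1 x)
    rw [abs_sub_comm] at h3
    have h4 := hx.2
    linarith

/-- A polynomial of bounded degree can be small, relative to its size, only on a small part of the
unit ball. -/
theorem exists_sublevel_small (d m : ℕ) {η : ℝ} (hη : 0 < η) :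
    ∃ ε : ℝ, 0 < ε ∧ ∀ q : MvPolynomial (Fin d) ℝ, q.totalDegree ≤ m →
      ∀ y ∈ Metric.closedBall (0 : Space d) 1,
      volume {x ∈ Metric.closedBall (0 : Space d) 1 | |ev q x| < ε * |ev q y|}
        ≤ ENNReal.ofReal η := by
  obtain ⟨ε, hε, h⟩ := exists_sublevel_small_of_norm_one d m hη
  refine ⟨ε, hε, fun q hq y hy => ?_⟩
  let q' : Poly d m := ⟨q, (MvPolynomial.mem_restrictTotalDegree _ _ _).2 hq⟩
  by_cases h0 : ‖restrictBall d m q'‖ = 0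
  · have hy0 : |ev q y| ≤ 0 := h0 ▸ (restrictBall d m q').norm_coe_le_norm ⟨y, hy⟩
    have : {x ∈ Metric.closedBall (0 : Space d) 1 | |ev q x| < ε * |ev q y|} = ∅ := by
      refine Set.eq_empty_of_forall_notMem fun x hx => ?_
      have h1 := hx.2
      have h2 := abs_nonneg (ev q x)
      nlinarith
    rw [this, measure_empty]
    exact zero_le
  · have hpos : 0 < ‖restrictBall d m q'‖ := lt_of_le_of_ne (norm_nonneg _) (Ne.symm h0)
    refine le_trans (measure_mono ?_) (h (‖restrictBall d m q'‖⁻¹ • q') ?_)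
    · intro x hx
      refine ⟨hx.1, ?_⟩
      have h1 : |ev q y| ≤ ‖restrictBall d m q'‖ :=
        (restrictBall d m q').norm_coe_le_norm ⟨y, hy⟩
      have h2 : ev (‖restrictBall d m q'‖⁻¹ • q').1 x = ‖restrictBall d m q'‖⁻¹ * ev q x := by
        simp [ev, q', MvPolynomial.smul_eval]
      rw [h2, abs_mul, abs_of_pos (inv_pos.2 hpos), inv_mul_lt_iff₀ hpos, mul_comm]
      exact hx.2.trans_le (by gcongr)
    · rw [map_smul, norm_smul, norm_inv, norm_norm, inv_mul_cancel₀ h0]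

/-! ### Affine substitutions -/

/-- The composition of a polynomial with the affine map `y ↦ x₀ + f y`. -/
def pullback {d' d : ℕ} (x₀ : Space d) (f : Space d' →ₗ[ℝ] Space d)
    (q : MvPolynomial (Fin d) ℝ) : MvPolynomial (Fin d') ℝ :=
  MvPolynomial.bind₁ (fun i => MvPolynomial.C (x₀ i) +
    ∑ j, MvPolynomial.C (f (EuclideanSpace.single j 1) i) * MvPolynomial.X j) q

theorem ev_pullback {d' d : ℕ} (x₀ : Space d) (f : Space d' →ₗ[ℝ] Space d)
    (q : MvPolynomial (Fin d) ℝ) (y : Space d') : ev (pullback x₀ f q) y = ev q (x₀ + f y) := by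
  unfold ev pullback
  rw [MvPolynomial.eval, MvPolynomial.eval₂Hom_bind₁]
  congr 2
  funext i
  have hy : y = ∑ j, y j • EuclideanSpace.single j (1 : ℝ) := by
    have := (EuclideanSpace.basisFun (Fin d') ℝ).sum_repr y
    simpa using this.symm
  conv_rhs => rw [hy]
  simp [map_sum, mul_comm]

theorem totalDegree_bind₁_le {d' d : ℕ} {F : Fin d → MvPolynomial (Fin d') ℝ}
    (hF : ∀ i, (F i).totalDegree ≤ 1) (q : MvPolynomial (Fin d) ℝ) :
    (MvPolynomial.bind₁ F q).totalDegree ≤ q.totalDegree := by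
  conv_lhs => rw [q.as_sum, map_sum]
  refine MvPolynomial.totalDegree_finsetSum_le fun s hs => ?_
  rw [MvPolynomial.bind₁_monomial]
  refine (MvPolynomial.totalDegree_mul _ _).trans ?_
  rw [MvPolynomial.totalDegree_C, zero_add]
  refine (MvPolynomial.totalDegree_finsetProd _ _).trans ?_
  refine le_trans (Finset.sum_le_sum fun i _ => ?_) (MvPolynomial.le_totalDegree hs)
  refine (MvPolynomial.totalDegree_pow _ _).trans ?_
  have := hF i
  nlinarith

theorem totalDegree_pullback_le {d' d : ℕ} (x₀ : Space d) (f : Space d' →ₗ[ℝ] Space d)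
    (q : MvPolynomial (Fin d) ℝ) : (pullback x₀ f q).totalDegree ≤ q.totalDegree := by
  refine totalDegree_bind₁_le (fun i => ?_) q
  refine (MvPolynomial.totalDegree_add _ _).trans (max_le (by simp) ?_)
  refine MvPolynomial.totalDegree_finsetSum_le fun j _ => ?_
  refine (MvPolynomial.totalDegree_mul _ _).trans ?_
  simp

end WeakGalerkin

namespace WeakGalerkin

/-! ### Derivatives -/

theorem hasFDerivAt_ev {d : ℕ} (p : MvPolynomial (Fin d) ℝ) (x : Space d) :
    HasFDerivAt (ev p) (innerSL ℝ (grad p x)) x := by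
  induction p using MvPolynomial.induction_on with
  | C a =>
    have h1 : ev (MvPolynomial.C a : MvPolynomial (Fin d) ℝ) = fun _ => a := by
      funext y; simp [ev]
    have h2 : grad (MvPolynomial.C a : MvPolynomial (Fin d) ℝ) x = 0 := by
      ext i; simp [grad, ev]
    rw [h1, h2, map_zero]
    exact hasFDerivAt_const a x
  | add p q hp hq =>
    have h1 : ev (p + q) = fun y => ev p y + ev q y := by funext y; simp [ev]
    have h2 : grad (p + q) x = grad p x + grad q x := by ext i; simp [grad, ev]
    rw [h1, h2, map_add]
    exact hp.add hq
  | mul_X p i hp =>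
    have h1 : ev (p * MvPolynomial.X i) = fun y => ev p y * y i := by funext y; simp [ev]
    have h3 : HasFDerivAt (fun y : Space d => y i) (innerSL ℝ (EuclideanSpace.single i 1)) x := by
      refine (EuclideanSpace.proj (𝕜 := ℝ) i).hasFDerivAt.congr_fderiv ?_
      ext v
      simp [EuclideanSpace.inner_single_left]
    rw [h1]
    refine (hp.mul h3).congr_fderiv ?_
    ext v
    have h2 : grad (p * MvPolynomial.X i) x =
        ev p x • EuclideanSpace.single i 1 + x i • grad p x := by
      ext l
      by_cases hl : l = i
      · subst hl
        simp [grad, ev]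
      · simp [grad, ev, MvPolynomial.pderiv_X, Pi.single_apply, hl, Ne.symm hl]
    rw [h2]
    simp

theorem inner_grad_pullback {d' d : ℕ} (x₀ : Space d) (f : Space d' →ₗ[ℝ] Space d)
    (q : MvPolynomial (Fin d) ℝ) (y v : Space d') :
    inner ℝ (grad (pullback x₀ f q) y) v = inner ℝ (grad q (x₀ + f y)) (f v) := by
  have h1 := hasFDerivAt_ev (pullback x₀ f q) y
  have h2 : HasFDerivAt (fun z => x₀ + f z) (LinearMap.toContinuousLinearMap f) y :=
    (LinearMap.toContinuousLinearMap f).hasFDerivAt.const_add x₀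
  have h3 := (hasFDerivAt_ev q (x₀ + f y)).comp y h2
  have h4 : ev (pullback x₀ f q) = ev q ∘ fun z => x₀ + f z :=
    funext fun z => ev_pullback x₀ f q z
  rw [h4] at h1
  exact congrArg (fun F => F v) (h1.unique h3)

/-! ### Surface measure of parametrized affine subspaces -/

section Parametrization

variable {d' d : ℕ} {f : Space d' →ₗ[ℝ] Space d}

theorem measurableEmbedding_affine (x₀ : Space d) (hf : Function.Injective f) :
    MeasurableEmbedding fun y => x₀ + f y :=
  ((Homeomorph.addLeft x₀).isClosedEmbedding.comp
    (LinearMap.isClosedEmbedding_of_injective (LinearMap.ker_eq_bot.2 hf))).measurableEmbedding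

/-- The area formula for an affine parametrization. It is used with scaled isometries, to reduce
cells and facets to the unit ball, and with graphs over a coordinate hyperplane, in the divergence
theorem. -/
theorem map_affine_volume (x₀ : Space d) (hf : Function.Injective f) :
    (ENNReal.ofReal f.normDet • (volume : Measure (Space d'))).map (fun y => x₀ + f y) =
      (μHE[d'] : Measure (Space d)).restrict (Set.range fun y => x₀ + f y) := by
  have hA := measurableEmbedding_affine x₀ hf
  ext s hs
  rw [hA.map_apply, Measure.restrict_apply hs, ← Set.image_preimage_eq_inter_range,
    show (fun y => x₀ + f y) = (fun x => x₀ + x) ∘ f from rfl, Set.image_comp,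
    (isometry_add_left x₀).euclideanHausdorffMeasure_image]
  have := f.euclideanHausdorffMeasure_image_eq_normDet_mul_volume
    ((fun x => x₀ + x) ∘ f ⁻¹' s)
  rw [finrank_euclideanSpace_fin] at this
  rw [this]
  rfl

theorem euclideanHausdorffMeasure_eq_normDet_mul (x₀ : Space d) (hf : Function.Injective f)
    {E : Set (Space d)} (hE : E ⊆ Set.range fun y => x₀ + f y) :
    μHE[d'] E = ENNReal.ofReal f.normDet * volume ((fun y => x₀ + f y) ⁻¹' E) := by
  have h1 := (measurableEmbedding_affine x₀ hf).map_apply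
    (ENNReal.ofReal f.normDet • (volume : Measure (Space d'))) E
  rw [map_affine_volume x₀ hf, Measure.restrict_eq_self _ hE] at h1
  exact h1

theorem setIntegral_eq_normDet_mul (x₀ : Space d) (hf : Function.Injective f)
    {E : Set (Space d)} (hE : E ⊆ Set.range fun y => x₀ + f y) (hm : MeasurableSet E)
    (g : Space d → ℝ) :
    ∫ x in E, g x ∂μHE[d'] = f.normDet * ∫ y in (fun y => x₀ + f y) ⁻¹' E, g (x₀ + f y) := by
  have h1 := (measurableEmbedding_affine x₀ hf).setIntegral_map
    (μ := ENNReal.ofReal f.normDet • (volume : Measure (Space d'))) g E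
  rw [map_affine_volume x₀ hf, Measure.restrict_restrict hm,
    Set.inter_eq_left.2 hE, Measure.restrict_smul, integral_smul_measure,
    ENNReal.toReal_ofReal (LinearMap.normDet_nonneg f)] at h1
  exact h1

end Parametrization

/-! ### Scaled isometric charts -/

/-- The map `y ↦ base + scale • dir y`, where `dir` is a linear isometry. -/
structure Chart (d' d : ℕ) where
  /-- the image of the origin -/
  base : Space d
  /-- the linear isometry -/
  dir : Space d' →ₗᵢ[ℝ] Space d
  /-- the scaling factor -/
  scale : ℝ
  scale_pos : 0 < scale

namespace Chart

variable {d' d : ℕ} (c : Chart d' d)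

/-- The linear part. -/
def lin : Space d' →ₗ[ℝ] Space d := c.scale • c.dir.toLinearMap

/-- The chart as a map. -/
def map (y : Space d') : Space d := c.base + c.lin y

/-- The image of the closed unit ball. -/
def disc : Set (Space d) := c.map '' Metric.closedBall 0 1

theorem lin_injective : Function.Injective c.lin := fun x y h => by
  have h1 : c.scale • c.dir x = c.scale • c.dir y := h
  exact c.dir.injective (smul_right_injective _ c.scale_pos.ne' h1)

theorem map_injective : Function.Injective c.map := fun _ _ h =>
  c.lin_injective (add_left_cancel h)

theorem normDet_lin : c.lin.normDet = c.scale ^ d' := by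
  rw [lin, LinearMap.normDet_smul, LinearIsometry.normDet_eq_one, finrank_euclideanSpace_fin,
    Real.norm_eq_abs, abs_of_pos c.scale_pos, mul_one]

theorem disc_subset_range : c.disc ⊆ Set.range c.map := Set.image_subset_range _ _

theorem ev_pullback_lin (q : MvPolynomial (Fin d) ℝ) (y : Space d') :
    ev (pullback c.base c.lin q) y = ev q (c.map y) := ev_pullback _ _ _ _

theorem measure_eq {E : Set (Space d)} (hE : E ⊆ Set.range c.map) :
    (μHE[d'] E).toReal = c.scale ^ d' * (volume (c.map ⁻¹' E)).toReal := by
  rw [euclideanHausdorffMeasure_eq_normDet_mul c.base c.lin_injective hE, ENNReal.toReal_mul,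
    ENNReal.toReal_ofReal (LinearMap.normDet_nonneg _), normDet_lin]
  rfl

theorem preimage_subset {E : Set (Space d)} (hE : E ⊆ c.disc) :
    c.map ⁻¹' E ⊆ Metric.closedBall 0 1 := fun y hy => by
  obtain ⟨z, hz, hzy⟩ := hE hy
  rwa [← c.map_injective hzy]

theorem measure_lt_top {E : Set (Space d)} (hE : E ⊆ c.disc) : μHE[d'] E < ⊤ := by
  rw [euclideanHausdorffMeasure_eq_normDet_mul c.base c.lin_injective
    (hE.trans c.disc_subset_range)]
  exact ENNReal.mul_lt_top ENNReal.ofReal_lt_top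
    ((measure_mono (c.preimage_subset hE)).trans_lt measure_closedBall_lt_top)

theorem measure_le {E : Set (Space d)} (hE : E ⊆ c.disc) :
    (μHE[d'] E).toReal ≤
      c.scale ^ d' * (volume (Metric.closedBall (0 : Space d') 1)).toReal := by
  rw [c.measure_eq (hE.trans c.disc_subset_range)]
  have := c.scale_pos
  gcongr
  · exact measure_closedBall_lt_top.ne
  · exact c.preimage_subset hE

/-- The set where all members of a finite family of polynomials are comparable to their values at
given points is large. -/
theorem exists_good_subset (d' m N : ℕ) {θ : ℝ} (hθ : 0 < θ) :
    ∃ ε : ℝ, 0 < ε ∧ ∀ (d : ℕ) (c : Chart d' d) (E : Set (Space d)), E ⊆ c.disc →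
      MeasurableSet E → θ * c.scale ^ d' ≤ (μHE[d'] E).toReal →
      ∀ (ι : Type) (S : Finset ι) (p : ι → MvPolynomial (Fin d) ℝ) (y : ι → Space d'),
      S.card ≤ N → (∀ l ∈ S, (p l).totalDegree ≤ m) → (∀ l ∈ S, y l ∈ Metric.closedBall 0 1) →
      ∃ E' ⊆ E, MeasurableSet E' ∧ θ / 2 * c.scale ^ d' ≤ (μHE[d'] E').toReal ∧
        ∀ x ∈ E', ∀ l ∈ S, ε * |ev (p l) (c.map (y l))| ≤ |ev (p l) x| := by
  -- At most `N` exceptional sets of this measure are removed, which costs at most `θ / 2` in the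
  -- coordinates of the chart.
  have hη : 0 < θ / (2 * (N + 1)) := by positivity
  obtain ⟨ε, hε, hsub⟩ := exists_sublevel_small d' m hη
  refine ⟨ε, hε, fun d c E hE hm hθE ι S p y hS hp hy => ?_⟩
  have hpow : 0 < c.scale ^ d' := pow_pos c.scale_pos _
  let G : Set (Space d) := ⋂ l ∈ S, {x | ε * |ev (p l) (c.map (y l))| ≤ |ev (p l) x|}
  have hG : MeasurableSet G := Finset.measurableSet_biInter S fun l _ =>
    (isClosed_le continuous_const (continuous_ev (p l)).abs).measurableSet
  refine ⟨E ∩ G, Set.inter_subset_left, hm.inter hG, ?_, fun x hx l hl => ?_⟩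
  · have hE1 : E ⊆ Set.range c.map := hE.trans c.disc_subset_range
    rw [c.measure_eq (Set.inter_subset_left.trans hE1)]
    rw [c.measure_eq hE1] at hθE
    let bad : ι → Set (Space d') := fun l => {x ∈ Metric.closedBall (0 : Space d') 1 |
      |ev (pullback c.base c.lin (p l)) x| < ε * |ev (pullback c.base c.lin (p l)) (y l)|}
    have hbad : ∀ l ∈ S, volume (bad l) ≤ ENNReal.ofReal (θ / (2 * (N + 1))) := fun l hl =>
      hsub _ ((totalDegree_pullback_le _ _ _).trans (hp l hl)) _ (hy l hl)
    have hcover : c.map ⁻¹' E ⊆ c.map ⁻¹' (E ∩ G) ∪ ⋃ l ∈ S, bad l := by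
      intro z hz
      by_cases hzG : c.map z ∈ G
      · exact Or.inl ⟨hz, hzG⟩
      · right
        simp only [G, Set.mem_iInter, not_forall] at hzG
        obtain ⟨l, hl, hlz⟩ := hzG
        refine Set.mem_biUnion (x := l) hl ⟨c.preimage_subset hE hz, ?_⟩
        rw [ev_pullback_lin, ev_pullback_lin]
        exact not_le.1 hlz
    have hfin : volume (c.map ⁻¹' (E ∩ G)) ≠ ⊤ := ((measure_mono (c.preimage_subset
      (Set.inter_subset_left.trans hE))).trans_lt measure_closedBall_lt_top).ne
    have hle : volume (c.map ⁻¹' E) ≤ volume (c.map ⁻¹' (E ∩ G)) + ENNReal.ofReal (θ / 2) := by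
      refine (measure_mono hcover).trans ((measure_union_le _ _).trans ?_)
      gcongr
      refine (measure_biUnion_finset_le S bad).trans ((Finset.sum_le_sum hbad).trans ?_)
      rw [Finset.sum_const, ← ENNReal.ofReal_nsmul]
      refine ENNReal.ofReal_le_ofReal ?_
      rw [nsmul_eq_mul, mul_div_assoc', div_le_div_iff₀ (by positivity) (by positivity)]
      have : (S.card : ℝ) ≤ N := by exact_mod_cast hS
      nlinarith
    have hle' := ENNReal.toReal_mono (ENNReal.add_ne_top.2 ⟨hfin, ENNReal.ofReal_ne_top⟩) hle
    rw [ENNReal.toReal_add hfin ENNReal.ofReal_ne_top, ENNReal.toReal_ofReal (by positivity)]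
      at hle'
    have h1 : θ ≤ (volume (c.map ⁻¹' E)).toReal := by
      rw [mul_comm] at hθE
      exact le_of_mul_le_mul_left hθE hpow
    rw [mul_comm (θ / 2)]
    exact mul_le_mul_of_nonneg_left (by linarith) hpow.le
  · exact Set.mem_iInter₂.1 hx.2 l hl

theorem continuous_integrableOn {E : Set (Space d)} (hE : IsCompact E)
    (hfin : μHE[d'] E < ⊤) {g : Space d → ℝ} (hg : Continuous g) :
    IntegrableOn g E μHE[d'] :=
  hg.continuousOn.integrableOn_of_subset_isCompact hE hE.measurableSet subset_rfl hfin.ne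

theorem mul_measure_le_setIntegral {E E' : Set (Space d)} (hE : IsCompact E)
    (hfin : μHE[d'] E < ⊤) (hE' : E' ⊆ E) (hm : MeasurableSet E') {g : Space d → ℝ}
    (hg : Continuous g) (h0 : ∀ x, 0 ≤ g x) {a : ℝ} (ha : ∀ x ∈ E', a ≤ g x) :
    a * (μHE[d'] E').toReal ≤ ∫ x in E, g x ∂μHE[d'] := by
  have hi := continuous_integrableOn hE hfin hg
  calc a * (μHE[d'] E').toReal = ∫ _ in E', a ∂μHE[d'] := by
        rw [setIntegral_const, smul_eq_mul, mul_comm]; rfl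
    _ ≤ ∫ x in E', g x ∂μHE[d'] := by
        refine setIntegral_mono_on ?_ (hi.mono_set hE') hm ha
        exact integrableOn_const ((measure_mono hE').trans_lt hfin).ne
    _ ≤ ∫ x in E, g x ∂μHE[d'] :=
        setIntegral_mono_set hi (Filter.Eventually.of_forall h0) hE'.eventuallyLE

/-- Lower bound for weighted integrals of squares of polynomials. -/
theorem exists_weighted_lower (d' m N : ℕ) {θ : ℝ} (hθ : 0 < θ) :
    ∃ a : ℝ, 0 < a ∧ ∀ (d : ℕ) (c : Chart d' d) (E : Set (Space d)), E ⊆ c.disc →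
      IsCompact E → θ * c.scale ^ d' ≤ (μHE[d'] E).toReal →
      ∀ (r : ℕ) (S : Finset (Fin r)) (p : Fin r → MvPolynomial (Fin d) ℝ) (β : ℝ),
      0 ≤ β → S.card ≤ N → (∀ l ∈ S, (p l).totalDegree ≤ 1) →
      (∀ l ∈ S, ∃ x ∈ c.disc, β ≤ |ev (p l) x|) →
      ∀ q : MvPolynomial (Fin d) ℝ, q.totalDegree ≤ m → ∀ x ∈ c.disc,
        a * c.scale ^ d' * (β ^ S.card) ^ 2 * ev q x ^ 2 ≤
          ∫ z in E, ((∏ l ∈ S, ev (p l) z) * ev q z) ^ 2 ∂μHE[d'] := by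
  -- The family consists of `q` (index `none`, compared with its value at `x`) and the factors `p l`
  -- (compared with a point where they reach `β`). Degree `m + 1` leaves room for the affine factors
  -- when `m = 0`.
  obtain ⟨ε, hε, hgood⟩ := exists_good_subset d' (m + 1) (N + 1) hθ
  -- Powers of a number at most 1 decrease, so the exponent `N + 1` serves for every `S`.
  have hε1 : 0 < min ε 1 := lt_min hε one_pos
  refine ⟨θ / 2 * ((min ε 1) ^ (N + 1)) ^ 2, by positivity,
    fun d c E hE hc hθE r S p β hβ hS hp hy q hq x hx => ?_⟩
  choose! y hy1 hy2 using hy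
  obtain ⟨x', hx', rfl⟩ := hx
  have hch : ∀ l, ∃ z, l ∈ S → z ∈ Metric.closedBall (0 : Space d') 1 ∧ c.map z = y l := fun l => by
    by_cases hl : l ∈ S
    · obtain ⟨z, hz⟩ := hy1 l hl
      exact ⟨z, fun _ => hz⟩
    · exact ⟨0, fun h => absurd h hl⟩
  choose z hz using hch
  have hcard : (insert none (S.image some) : Finset (Option (Fin r))).card ≤ N + 1 := by
    refine (Finset.card_insert_le _ _).trans ?_
    have := Finset.card_image_le (s := S) (f := some)
    omega
  obtain ⟨E', hE'E, hE'm, hE'μ, hE'⟩ := hgood d c E hE hc.measurableSet hθE (Option (Fin r))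
    (insert none (S.image some)) (fun o => o.elim q p) (fun o => o.elim x' z) hcard
    (by
      intro l hl
      cases l with
      | none => exact hq.trans (Nat.le_succ m)
      | some l => exact (hp l (by simpa using hl)).trans (by omega))
    (by
      intro l hl
      cases l with
      | none => exact hx'
      | some l => exact (hz l (by simpa using hl)).1)
  have hlow : ∀ w ∈ E', ((min ε 1) ^ (N + 1)) ^ 2 * (β ^ S.card) ^ 2 * ev q (c.map x') ^ 2 ≤
      ((∏ l ∈ S, ev (p l) w) * ev q w) ^ 2 := by
    intro w hw
    have hq1 : min ε 1 * |ev q (c.map x')| ≤ |ev q w| := by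
      refine le_trans ?_ (hE' w hw none (by simp))
      exact mul_le_mul_of_nonneg_right (min_le_left _ _) (abs_nonneg _)
    have hp1 : (min ε 1) ^ S.card * β ^ S.card ≤ |∏ l ∈ S, ev (p l) w| := by
      rw [Finset.abs_prod, ← mul_pow, ← Finset.prod_const]
      refine Finset.prod_le_prod (fun l _ => by positivity) fun l hl => ?_
      refine le_trans ?_ (hE' w hw (some l) (by simpa using hl))
      refine mul_le_mul (min_le_left _ _) ?_ hβ hε.le
      show β ≤ |ev (p l) (c.map (z l))|
      rw [(hz l hl).2]
      exact hy2 l hl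
    have hpw : (min ε 1) ^ (N + 1) ≤ (min ε 1) ^ S.card * min ε 1 := by
      rw [← pow_succ]
      exact pow_le_pow_of_le_one hε1.le (min_le_right _ _) (by omega)
    rw [← mul_pow, ← sq_abs (ev q (c.map x')), ← mul_pow,
      ← sq_abs ((∏ l ∈ S, ev (p l) w) * ev q w), abs_mul]
    refine pow_le_pow_left₀ (by positivity) ?_ 2
    calc (min ε 1) ^ (N + 1) * β ^ S.card * |ev q (c.map x')|
        ≤ (min ε 1) ^ S.card * min ε 1 * β ^ S.card * |ev q (c.map x')| := by gcongr
      _ = ((min ε 1) ^ S.card * β ^ S.card) * (min ε 1 * |ev q (c.map x')|) := by ring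
      _ ≤ _ := mul_le_mul hp1 hq1 (by positivity) (abs_nonneg _)
  have hcont : Continuous fun w => ((∏ l ∈ S, ev (p l) w) * ev q w) ^ 2 :=
    ((continuous_finsetProd S fun l _ => continuous_ev (p l)).mul (continuous_ev q)).pow 2
  refine le_trans ?_ (mul_measure_le_setIntegral hc (c.measure_lt_top hE) hE'E hE'm hcont
    (fun w => sq_nonneg _) hlow)
  calc _ = ((min ε 1) ^ (N + 1)) ^ 2 * (β ^ S.card) ^ 2 * ev q (c.map x') ^ 2
        * (θ / 2 * c.scale ^ d') := by ring
    _ ≤ _ := by gcongr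

/-- Lower bound for the integral of the absolute value of a polynomial. -/
theorem exists_abs_lower (d' m : ℕ) {θ : ℝ} (hθ : 0 < θ) :
    ∃ a : ℝ, 0 < a ∧ ∀ (d : ℕ) (c : Chart d' d) (E : Set (Space d)), E ⊆ c.disc →
      IsCompact E → θ * c.scale ^ d' ≤ (μHE[d'] E).toReal →
      ∀ q : MvPolynomial (Fin d) ℝ, q.totalDegree ≤ m → ∀ x ∈ c.disc,
        a * c.scale ^ d' * |ev q x| ≤ ∫ z in E, |ev q z| ∂μHE[d'] := by
  obtain ⟨ε, hε, hgood⟩ := exists_good_subset d' m 1 hθ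
  refine ⟨θ / 2 * ε, by positivity, fun d c E hE hc hθE q hq x hx => ?_⟩
  obtain ⟨x', hx', rfl⟩ := hx
  obtain ⟨E', hE'E, hE'm, hE'μ, hE'⟩ := hgood d c E hE hc.measurableSet hθE Unit
    {()} (fun _ => q) (fun _ => x') (by simp) (fun _ _ => hq) (fun _ _ => hx')
  refine le_trans ?_ (mul_measure_le_setIntegral hc (c.measure_lt_top hE) hE'E hE'm
    (continuous_ev q).abs (fun w => abs_nonneg _) (fun w hw => hE' w hw () (by simp)))
  calc _ = ε * |ev q (c.map x')| * (θ / 2 * c.scale ^ d') := by ring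
    _ ≤ _ := by gcongr

/-- Inverse estimate for the gradient. -/
theorem exists_grad_bound (d m : ℕ) : ∃ C : ℝ, 0 < C ∧ ∀ (c : Chart d d)
    (q : MvPolynomial (Fin d) ℝ) (M : ℝ), q.totalDegree ≤ m → (∀ x ∈ c.disc, |ev q x| ≤ M) →
      ∀ x ∈ c.disc, ‖grad q x‖ ≤ C * M / c.scale := by
  obtain ⟨C, hC, h⟩ := WeakGalerkin.exists_grad_bound d m
  refine ⟨C, hC, fun c q M hq hM x hx => ?_⟩
  obtain ⟨y, hy, rfl⟩ := hx
  have h1 := h (pullback c.base c.lin q) M ((totalDegree_pullback_le _ _ _).trans hq)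
    (fun z hz => by
      rw [ev_pullback_lin]
      exact hM _ ⟨z, hz, rfl⟩) y hy
  set g := grad q (c.map y) with hg
  -- An isometry between spaces of equal dimension is onto, so the gradient may be paired with
  -- itself through the chart.
  obtain ⟨u, hu⟩ : ∃ u, c.dir u = g :=
    (LinearMap.injective_iff_surjective (f := c.dir.toLinearMap)).1 c.dir.injective g
  have h2 := inner_grad_pullback c.base c.lin q y u
  have h3 : c.lin u = c.scale • g := by rw [← hu]; rfl
  have h4 : ‖u‖ = ‖g‖ := by rw [← hu, c.dir.norm_map]
  rw [h3, inner_smul_right] at h2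
  change inner ℝ _ u = c.scale * inner ℝ g g at h2
  rw [real_inner_self_eq_norm_sq] at h2
  have h5 := real_inner_le_norm (grad (pullback c.base c.lin q) y) u
  rw [h2, h4] at h5
  rw [le_div_iff₀ c.scale_pos]
  rcases (norm_nonneg g).eq_or_lt with h0 | h0
  · rw [← h0, zero_mul]
    exact (norm_nonneg _).trans h1
  · refine le_trans ?_ h1
    nlinarith

end Chart

end WeakGalerkin

namespace WeakGalerkin

/-! ### The divergence theorem on convex polytopes -/

/-- The fundamental theorem of calculus on an interval given by finitely many inequalities. -/
theorem setIntegral_deriv_of_inequalities {m : ℕ} (n c : Fin m → ℝ) {F F' : ℝ → ℝ}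
    (hF : ∀ t, HasDerivAt F (F' t) t) (hF' : Continuous F')
    (hb : Bornology.IsBounded {t : ℝ | ∀ i, n i * t ≤ c i})
    (hdist : ∀ i l, i ≠ l → n i ≠ 0 → n l ≠ 0 → c i / n i ≠ c l / n l) :
    ∫ t in {t : ℝ | ∀ i, n i * t ≤ c i}, F' t =
      ∑ i, n i / |n i| * {t : ℝ | ∀ i, n i * t ≤ c i}.indicator F (c i / n i) := by
  set S := {t : ℝ | ∀ i, n i * t ≤ c i} with hS
  rcases S.eq_empty_or_nonempty with h0 | ⟨t₀, ht₀⟩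
  · simp [h0]
  have ht₀' : ∀ i, n i * t₀ ≤ c i := ht₀
  obtain ⟨R, hR⟩ := hb.subset_closedBall 0
  -- Without a constraint of positive slope the set would be unbounded to the right; `hneg` is the
  -- mirror image.
  have hpos : (Finset.univ.filter fun i => 0 < n i).Nonempty := by
    by_contra hne
    rw [Finset.not_nonempty_iff_eq_empty, Finset.filter_eq_empty_iff] at hne
    have : t₀ + (|t₀| + |R| + 1) ∈ S := fun i => by
      have h1 := hne (Finset.mem_univ i)
      have h2 := ht₀' i
      have h3 := abs_nonneg t₀
      have h4 := abs_nonneg R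
      nlinarith
    have h5 := hR this
    rw [Metric.mem_closedBall, Real.dist_eq, sub_zero] at h5
    have h6 := le_abs_self (t₀ + (|t₀| + |R| + 1))
    have h7 := neg_abs_le t₀
    have h8 := le_abs_self R
    linarith
  have hneg : (Finset.univ.filter fun i => n i < 0).Nonempty := by
    by_contra hne
    rw [Finset.not_nonempty_iff_eq_empty, Finset.filter_eq_empty_iff] at hne
    have : t₀ - (|t₀| + |R| + 1) ∈ S := fun i => by
      have h1 := hne (Finset.mem_univ i)
      have h2 := ht₀' i
      have h3 := abs_nonneg t₀
      have h4 := abs_nonneg R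
      nlinarith
    have h5 := hR this
    rw [Metric.mem_closedBall, Real.dist_eq, sub_zero] at h5
    have h6 := neg_abs_le (t₀ - (|t₀| + |R| + 1))
    have h7 := le_abs_self t₀
    have h8 := le_abs_self R
    linarith
  obtain ⟨p, hp, hpmin⟩ := Finset.exists_min_image _ (fun i => c i / n i) hpos
  obtain ⟨q, hq, hqmax⟩ := Finset.exists_max_image _ (fun i => c i / n i) hneg
  simp only [Finset.mem_filter, Finset.mem_univ, true_and] at hp hq hpmin hqmax
  have hmem : ∀ t, t ∈ S ↔ c q / n q ≤ t ∧ t ≤ c p / n p := by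
    intro t
    constructor
    · intro ht
      have ht' : ∀ i, n i * t ≤ c i := ht
      refine ⟨?_, ?_⟩
      · rw [div_le_iff_of_neg hq, mul_comm]
        exact ht' q
      · rw [le_div_iff₀ hp, mul_comm]
        exact ht' p
    · rintro ⟨h1, h2⟩ i
      rcases lt_trichotomy (n i) 0 with h | h | h
      · have := (hqmax i h).trans h1
        rwa [div_le_iff_of_neg h, mul_comm] at this
      · have := ht₀' i
        rw [h, zero_mul] at this ⊢
        exact this
      · have := h2.trans (hpmin i h)
        rwa [le_div_iff₀ h, mul_comm] at this
  have hle : c q / n q ≤ c p / n p := ((hmem t₀).1 ht₀).1.trans ((hmem t₀).1 ht₀).2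
  have hSI : S = Set.Icc (c q / n q) (c p / n p) := Set.ext hmem
  have hlhs : ∫ t in S, F' t = F (c p / n p) - F (c q / n q) := by
    rw [hSI, integral_Icc_eq_integral_Ioc, ← intervalIntegral.integral_of_le hle]
    exact intervalIntegral.integral_eq_sub_of_hasDerivAt (fun t _ => hF t)
      (hF'.intervalIntegrable _ _)
  -- Only the constraints `p` and `q` that define the two endpoints contribute. By `hdist` no other
  -- constraint with nonzero slope is active there, and for `n i = 0` the factor `n i / |n i|` is `0
  -- / 0 = 0`.
  have hterm : ∀ i, n i / |n i| * S.indicator F (c i / n i) =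
      (if i = p then F (c p / n p) else 0) - (if i = q then F (c q / n q) else 0) := by
    intro i
    have hpq : p ≠ q := fun h => by rw [h] at hp; exact lt_asymm hp hq
    have hpS : c p / n p ∈ S := (hmem _).2 ⟨hle, le_rfl⟩
    have hqS : c q / n q ∈ S := (hmem _).2 ⟨le_rfl, hle⟩
    rcases lt_trichotomy (n i) 0 with h | h | h
    · have hip : i ≠ p := fun h' => by rw [h'] at h; exact lt_asymm h hp
      rw [abs_of_neg h, div_neg, div_self h.ne, if_neg hip]
      by_cases hiq : i = q
      · rw [if_pos hiq, hiq, Set.indicator_of_mem hqS]; ring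
      · rw [if_neg hiq, Set.indicator_of_notMem]
        · ring
        · intro hi
          exact hdist i q hiq h.ne hq.ne (le_antisymm (hqmax i h) ((hmem _).1 hi).1)
    · have hip : i ≠ p := fun h' => by rw [h'] at h; exact hp.ne' h
      have hiq : i ≠ q := fun h' => by rw [h'] at h; exact hq.ne h
      rw [if_neg hip, if_neg hiq, h]; simp
    · have hiq : i ≠ q := fun h' => by rw [h'] at h; exact lt_asymm h hq
      rw [abs_of_pos h, div_self h.ne', if_neg hiq]
      by_cases hip : i = p
      · rw [if_pos hip, hip, Set.indicator_of_mem hpS]; ring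
      · rw [if_neg hip, Set.indicator_of_notMem]
        · ring
        · intro hi
          exact hdist i p hip h.ne' hp.ne' (le_antisymm ((hmem _).1 hi).2 (hpmin i h))
  rw [hlhs, Finset.sum_congr rfl fun i _ => hterm i, Finset.sum_sub_distrib]
  simp

/-! ### Slicing along a coordinate direction -/

section Vertical

variable {d : ℕ} (a : Fin (d + 1))

/-- The embedding of `ℝᵈ` as the hyperplane where the coordinate `a` vanishes. -/
def lift : Space d →ₗ[ℝ] Space (d + 1) where
  toFun y := WithLp.toLp 2 (Fin.insertNth a 0 (fun j => y j))
  map_add' x y := by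
    ext i
    refine Fin.succAboveCases a ?_ (fun j => ?_) i <;> simp
  map_smul' r y := by
    ext i
    refine Fin.succAboveCases a ?_ (fun j => ?_) i <;> simp

@[simp] theorem lift_apply_self (y : Space d) : lift a y a = 0 := by simp [lift]

@[simp] theorem lift_apply_succAbove (y : Space d) (j : Fin d) :
    lift a y (a.succAbove j) = y j := by simp [lift]

/-- Splitting off the coordinate `a`. -/
def split : ℝ × Space d ≃ᵐ Space (d + 1) :=
  ((MeasurableEquiv.refl ℝ).prodCongr (MeasurableEquiv.toLp 2 (Fin d → ℝ)).symm).trans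
    ((MeasurableEquiv.piFinSuccAbove (fun _ : Fin (d + 1) => ℝ) a).symm.trans
      (MeasurableEquiv.toLp 2 (Fin (d + 1) → ℝ)))

theorem split_apply (t : ℝ) (y : Space d) :
    split a (t, y) = lift a y + t • EuclideanSpace.single a 1 := by
  have h : split a (t, y) = WithLp.toLp 2 (Fin.insertNth a t (fun j => y j)) := rfl
  rw [h]
  ext i
  refine Fin.succAboveCases a ?_ (fun j => ?_) i <;> simp

theorem measurePreserving_split : MeasurePreserving (split a) := by
  have h1 : MeasurePreserving ((MeasurableEquiv.refl ℝ).prodCongr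
      (MeasurableEquiv.toLp 2 (Fin d → ℝ)).symm) (volume : Measure (ℝ × Space d)) volume :=
    (MeasurePreserving.id volume).prod (PiLp.volume_preserving_ofLp (Fin d))
  have h2 := (volume_preserving_piFinSuccAbove (fun _ : Fin (d + 1) => ℝ) a).symm
  exact (PiLp.volume_preserving_toLp (Fin (d + 1))).comp (h2.comp h1)

/-- The linear part of the parametrization of a hyperplane with normal `n` as a graph over the
hyperplane where the coordinate `a` vanishes. -/
def graphLin (n : Space (d + 1)) : Space d →ₗ[ℝ] Space (d + 1) :=
  lift a - ((1 / n a) • (innerSL ℝ n).toLinearMap.comp (lift a)).smulRight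
    (EuclideanSpace.single a 1)

theorem graphLin_apply (n : Space (d + 1)) (y : Space d) :
    graphLin a n y = lift a y - (inner ℝ n (lift a y) / n a) • EuclideanSpace.single a 1 := by
  simp [graphLin, div_eq_inv_mul]

theorem graphLin_injective (n : Space (d + 1)) : Function.Injective (graphLin a n) := by
  intro x y h
  ext j
  have h1 := congrArg (fun z : Space (d + 1) => z (a.succAbove j)) h
  simpa [graphLin_apply] using h1

/-- The Gram matrix of the graph map is 1 + u uᵀ, with u the remaining coordinates of `n` divided by
`n a`. Its determinant is 1 + |u|², which equals `(n a)⁻²` because `n` is a unit vector. -/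
theorem normDet_graphLin {n : Space (d + 1)} (hn : ‖n‖ = 1) (ha : n a ≠ 0) :
    (graphLin a n).normDet = |n a|⁻¹ := by
  have h1 := LinearMap.normDet_sq_eq_det_gram (graphLin a n) (EuclideanSpace.basisFun (Fin d) ℝ)
  have hin : ∀ j, inner ℝ n (lift a (EuclideanSpace.single j 1)) = n (a.succAbove j) := by
    intro j
    rw [PiLp.inner_apply, Fin.sum_univ_succAbove _ a]
    simp
  have hG : Matrix.gram ℝ (fun j => graphLin a n (EuclideanSpace.basisFun (Fin d) ℝ j)) =
      1 + Matrix.replicateCol Unit (fun j => n (a.succAbove j) / n a) *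
        Matrix.replicateRow Unit (fun j => n (a.succAbove j) / n a) := by
    ext j l
    rw [Matrix.gram_apply, PiLp.inner_apply, Fin.sum_univ_succAbove _ a]
    simp [graphLin_apply, hin, Matrix.mul_apply, Matrix.one_apply]
    ring
  have hsum : ∑ j, n (a.succAbove j) ^ 2 = 1 - n a ^ 2 := by
    have := EuclideanSpace.real_norm_sq_eq n
    rw [hn, Fin.sum_univ_succAbove _ a] at this
    linarith
  rw [hG, Matrix.det_one_add_replicateCol_mul_replicateRow] at h1
  have h2 : (graphLin a n).normDet ^ 2 = (|n a|⁻¹) ^ 2 := by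
    rw [inv_pow, sq_abs]
    have h3 : (fun j => n (a.succAbove j) / n a) ⬝ᵥ (fun j => n (a.succAbove j) / n a) =
        (1 - n a ^ 2) / n a ^ 2 := by
      rw [← hsum, Finset.sum_div]
      simp only [dotProduct]
      exact Finset.sum_congr rfl fun j _ => by ring
    rw [h3] at h1
    have h4 : (graphLin a n).normDet ^ 2 = 1 + (1 - n a ^ 2) / n a ^ 2 := h1
    rw [h4]
    field_simp
    ring
  exact (pow_left_inj₀ (LinearMap.normDet_nonneg _) (by positivity) two_ne_zero).1 h2

/-- Integration over a set, first along the coordinate `a`. -/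
theorem setIntegral_eq_integral_lift {K : Set (Space (d + 1))} (hK : IsCompact K)
    {g : Space (d + 1) → ℝ} (hg : Continuous g) :
    ∫ x in K, g x = ∫ y : Space d, ∫ t in {t : ℝ | lift a y + t • EuclideanSpace.single a 1 ∈ K},
      g (lift a y + t • EuclideanSpace.single a 1) := by
  have hmp := measurePreserving_split a
  have hemb := (split a).measurableEmbedding
  have hm : MeasurableSet (split a ⁻¹' K) := (split a).measurable hK.measurableSet
  rw [← hmp.setIntegral_preimage_emb hemb, ← integral_indicator hm, Measure.volume_eq_prod,
    integral_prod_symm]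
  · refine integral_congr_ae (Filter.Eventually.of_forall fun y => ?_)
    have hs : {t : ℝ | lift a y + t • EuclideanSpace.single a 1 ∈ K} =
        (fun t => (t, y)) ⁻¹' (split a ⁻¹' K) := by
      ext t
      simp [split_apply]
    have hms : MeasurableSet {t : ℝ | lift a y + t • EuclideanSpace.single a 1 ∈ K} := by
      rw [hs]
      exact measurable_prodMk_right hm
    simp only
    rw [← integral_indicator hms]
    congr 1
    funext t
    rw [hs]
    simp only [Set.indicator, split_apply]
    rfl
  · rw [← Measure.volume_eq_prod, integrable_indicator_iff hm]
    exact (hmp.integrableOn_comp_preimage hemb).2 (hg.continuousOn.integrableOn_compact hK)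

/-- The zero set of a nontrivial affine function is a null set. -/
theorem volume_setOf_affine_eq_zero {L : Space d →ₗ[ℝ] ℝ} {r : ℝ} (h : L ≠ 0 ∨ r ≠ 0) :
    volume {y : Space d | L y = r} = 0 := by
  by_cases hL : L = 0
  · have hr : r ≠ 0 := h.resolve_left (not_not.2 hL)
    have : {y : Space d | L y = r} = ∅ := Set.eq_empty_of_forall_notMem fun y hy => by
      have hy' : L y = r := hy
      rw [hL] at hy'
      exact hr hy'.symm
    rw [this, measure_empty]
  · obtain ⟨v, hv⟩ : ∃ v, L v ≠ 0 := by
      by_contra! h0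
      exact hL (LinearMap.ext h0)
    let y₀ : Space d := (r / L v) • v
    have hy₀ : L y₀ = r := by simp [y₀, hv]
    have hker : volume (LinearMap.ker L : Set (Space d)) = 0 :=
      Measure.addHaar_submodule volume _ fun ht => hL (LinearMap.ker_eq_top.1 ht)
    have : {y : Space d | L y = r} = (fun y => -y₀ + y) ⁻¹' (LinearMap.ker L : Set (Space d)) := by
      ext y
      change L y = r ↔ L (-y₀ + y) = 0
      rw [map_add, map_neg, hy₀]
      constructor <;> intro h <;> linarith
    rw [this, measure_preimage_add]
    exact hker

end Vertical

namespace ConvexPolytope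

variable {d : ℕ}

theorem facet_subset_range (T : ConvexPolytope (d + 1)) (a : Fin (d + 1))
    (i : Fin T.numFacets) (ha : T.normal i a ≠ 0) :
    T.facet i ⊆ Set.range fun y => (T.offset i / T.normal i a) • EuclideanSpace.single a (1 : ℝ) +
      graphLin a (T.normal i) y := by
  intro x hx
  have hx2 : inner ℝ (T.normal i) x = T.offset i := hx.2
  let y : Space d := WithLp.toLp 2 fun j => x (a.succAbove j)
  have hxy : x = lift a y + x a • EuclideanSpace.single a 1 := by
    ext l
    refine Fin.succAboveCases a ?_ (fun j => ?_) l <;> simp [y]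
  refine ⟨y, ?_⟩
  have h1 : inner ℝ (T.normal i) (lift a y) + x a * T.normal i a = T.offset i := by
    rw [← hx2]
    conv_rhs => rw [hxy]
    rw [inner_add_right, inner_smul_right, EuclideanSpace.inner_single_right]
    simp
  simp only [graphLin_apply]
  conv_rhs => rw [hxy]
  rw [← h1]
  have : (inner ℝ (T.normal i) (lift a y) + x a * T.normal i a) / T.normal i a =
      inner ℝ (T.normal i) (lift a y) / T.normal i a + x a := by
    field_simp
  rw [this]
  module

/-- The two hyperplanes of distinct facets are distinct. -/
theorem hyperplane_ne (T : ConvexPolytope d) {i l : Fin T.numFacets} (h : i ≠ l) (r : ℝ)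
    (h1 : T.normal i = r • T.normal l) (h2 : T.offset i = r * T.offset l) : False := by
  have hr : |r| = 1 := by
    have := congrArg norm h1
    rw [norm_smul, T.norm_normal, T.norm_normal, mul_one, Real.norm_eq_abs] at this
    exact this.symm
  rcases (abs_eq zero_le_one).1 hr with hr | hr
  · rw [hr, one_smul] at h1
    exact h (T.normal_injective h1)
  -- Opposite normals with opposite offsets would squeeze the polytope into a hyperplane, but it has
  -- interior points.
  · obtain ⟨x, hx⟩ : (interior T.carrier).Nonempty := T.nonempty_interior
    rw [hr, neg_one_smul] at h1
    rw [hr, neg_one_mul] at h2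
    obtain ⟨ε, hε, hball⟩ := Metric.isOpen_iff.1 isOpen_interior x hx
    have hmem : x + (ε / 2) • T.normal l ∈ T.carrier := by
      refine interior_subset (hball ?_)
      rw [Metric.mem_ball, dist_eq_norm, add_sub_cancel_left, norm_smul, T.norm_normal,
        Real.norm_eq_abs, abs_of_pos (half_pos hε), mul_one]
      linarith
    have h3 := hmem l
    have h4 := (interior_subset hx : x ∈ T.carrier) i
    rw [inner_add_right, inner_smul_right, real_inner_self_eq_norm_sq, T.norm_normal] at h3
    rw [h1, h2, inner_neg_left] at h4
    linarith

/-- The divergence theorem for `f e_a`. -/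
theorem integral_pderiv (T : ConvexPolytope (d + 1)) (a : Fin (d + 1))
    (f : MvPolynomial (Fin (d + 1)) ℝ) :
    T.integral (ev (MvPolynomial.pderiv a f)) =
      ∑ i, T.normal i a * T.facetIntegral i (ev f) := by
  let e : Space (d + 1) := EuclideanSpace.single a 1
  let τ : Fin T.numFacets → Space d → ℝ := fun i y =>
    (T.offset i - inner ℝ (T.normal i) (lift a y)) / T.normal i a
  have hin : ∀ i (t : ℝ) y, inner ℝ (T.normal i) (lift a y + t • e) =
      inner ℝ (T.normal i) (lift a y) + T.normal i a * t := by
    intro i t y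
    rw [inner_add_right, inner_smul_right, EuclideanSpace.inner_single_right]
    simp [mul_comm]
  have hS : ∀ y, {t : ℝ | lift a y + t • e ∈ T.carrier} =
      {t : ℝ | ∀ i, T.normal i a * t ≤ T.offset i - inner ℝ (T.normal i) (lift a y)} := by
    intro y
    ext t
    refine forall_congr' fun i => ?_
    rw [hin]
    constructor <;> intro h <;> linarith
  have hgraph : ∀ i, T.normal i a ≠ 0 → ∀ y, (T.offset i / T.normal i a) • e +
      graphLin a (T.normal i) y = lift a y + τ i y • e := by
    intro i hi y
    rw [graphLin_apply]
    simp only [τ, sub_div]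
    module
  have hsingle : ‖e‖ = 1 := by simp [e]
  have hbdd : ∀ y, Bornology.IsBounded {t : ℝ | lift a y + t • e ∈ T.carrier} := by
    intro y
    obtain ⟨R, hR⟩ := T.isCompact_carrier.isBounded.subset_closedBall (lift a y)
    refine (Metric.isBounded_closedBall (x := (0 : ℝ)) (r := R)).subset fun t ht => ?_
    have h1 := hR ht
    rw [Metric.mem_closedBall, dist_eq_norm, add_sub_cancel_left, norm_smul, hsingle,
      mul_one] at h1
    simpa using h1
  -- Almost every line in direction `e` meets the facet hyperplanes in distinct points: the heights
  -- of two of them agree only on the zero set of a nontrivial affine function.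
  have hae : ∀ᵐ y : Space d, ∀ i l, i ≠ l → T.normal i a ≠ 0 → T.normal l a ≠ 0 →
      τ i y ≠ τ l y := by
    rw [ae_all_iff]; intro i
    rw [ae_all_iff]; intro l
    by_cases hil : i = l
    · exact Filter.Eventually.of_forall fun y h => absurd hil h
    by_cases hi : T.normal i a = 0
    · exact Filter.Eventually.of_forall fun y _ h => absurd hi h
    by_cases hl : T.normal l a = 0
    · exact Filter.Eventually.of_forall fun y _ _ h => absurd hl h
    let L : Space d →ₗ[ℝ] ℝ := ((innerSL ℝ ((T.normal i a)⁻¹ • T.normal i -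
      (T.normal l a)⁻¹ • T.normal l)).toLinearMap).comp (lift a)
    have hL : ∀ y, L y = inner ℝ (T.normal i) (lift a y) / T.normal i a -
        inner ℝ (T.normal l) (lift a y) / T.normal l a := by
      intro y
      simp [L, div_eq_inv_mul]
    have hnull := volume_setOf_affine_eq_zero (L := L)
      (r := T.offset i / T.normal i a - T.offset l / T.normal l a) (by
        -- If the heights agreed identically, both hyperplanes would have proportional equations,
        -- against `hyperplane_ne`.
        by_contra! hcon
        obtain ⟨hc1, hc2⟩ := hcon
        have hn : (T.normal i a)⁻¹ • T.normal i = (T.normal l a)⁻¹ • T.normal l := by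
          ext b
          refine Fin.succAboveCases a ?_ (fun j => ?_) b
          · simp [hi, hl]
          · have := congrArg (fun L : Space d →ₗ[ℝ] ℝ => L (EuclideanSpace.single j 1)) hc1
            simp only [L, LinearMap.comp_apply, LinearMap.zero_apply] at this
            change inner ℝ ((T.normal i a)⁻¹ • T.normal i - (T.normal l a)⁻¹ • T.normal l)
              (lift a (EuclideanSpace.single j 1)) = 0 at this
            rw [PiLp.inner_apply, Fin.sum_univ_succAbove _ a] at this
            simp at this
            simp
            linarith
        refine T.hyperplane_ne hil (T.normal i a / T.normal l a) ?_ ?_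
        · rw [div_eq_mul_inv, mul_smul, ← hn, smul_smul, mul_inv_cancel₀ hi, one_smul]
        · have := sub_eq_zero.1 hc2
          field_simp at this ⊢
          linarith)
    filter_upwards [compl_mem_ae_iff.2 hnull] with y hy _ _ _ heq
    apply hy
    simp only [τ, sub_div] at heq
    rw [Set.mem_ofPred_eq, hL]
    linarith
  have hderiv : ∀ y (t : ℝ), HasDerivAt (fun t => ev f (lift a y + t • e))
      (ev (MvPolynomial.pderiv a f) (lift a y + t • e)) t := by
    intro y t
    have h1 : HasDerivAt (fun t : ℝ => lift a y + t • e) e t := by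
      simpa using ((hasDerivAt_id t).smul_const e).const_add (lift a y)
    have h2 := (hasFDerivAt_ev f (lift a y + t • e)).comp_hasDerivAt t h1
    have h3 : innerSL ℝ (grad f (lift a y + t • e)) e =
        ev (MvPolynomial.pderiv a f) (lift a y + t • e) := by
      change inner ℝ _ e = _
      rw [EuclideanSpace.inner_single_right]
      simp [grad]
    rw [h3] at h2
    exact h2
  have hcontline : ∀ y, Continuous fun t : ℝ => lift a y + t • e := fun y => by fun_prop
  have hinner : ∀ᵐ y : Space d, ∫ t in {t : ℝ | lift a y + t • e ∈ T.carrier},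
      ev (MvPolynomial.pderiv a f) (lift a y + t • e) =
      ∑ i, T.normal i a / |T.normal i a| *
        {t : ℝ | lift a y + t • e ∈ T.carrier}.indicator
          (fun t => ev f (lift a y + t • e)) (τ i y) := by
    filter_upwards [hae] with y hy
    have hb := hbdd y
    rw [hS y] at hb ⊢
    exact setIntegral_deriv_of_inequalities (fun i => T.normal i a)
      (fun i => T.offset i - inner ℝ (T.normal i) (lift a y)) (hderiv y)
      ((continuous_ev _).comp (hcontline y)) hb hy
  -- A facet with `T.normal i a ≠ 0` is a graph over the slicing hyperplane. Its area factor is the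
  -- inverse of `|T.normal i a|`, which turns the sign `n / |n|` of the one-dimensional formula into
  -- the weight `T.normal i a`. The other facets have weight zero on both sides.
  have hfacet : ∀ i, T.normal i a ≠ 0 →
      Integrable (fun y => {t : ℝ | lift a y + t • e ∈ T.carrier}.indicator
          (fun t => ev f (lift a y + t • e)) (τ i y)) ∧
      T.facetIntegral i (ev f) = |T.normal i a|⁻¹ *
        ∫ y, {t : ℝ | lift a y + t • e ∈ T.carrier}.indicator
          (fun t => ev f (lift a y + t • e)) (τ i y) := by
    intro i hi
    have hinj := graphLin_injective a (T.normal i)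
    have hemb := measurableEmbedding_affine ((T.offset i / T.normal i a) • e) hinj
    have hset : ∀ y, (T.offset i / T.normal i a) • e + graphLin a (T.normal i) y ∈ T.facet i ↔
        lift a y + τ i y • e ∈ T.carrier := by
      intro y
      rw [hgraph i hi]
      refine ⟨fun h => h.1, fun h => ⟨h, ?_⟩⟩
      rw [Set.mem_ofPred_eq, hin]
      simp only [τ]
      field_simp
      ring
    have hind : (fun y => {t : ℝ | lift a y + t • e ∈ T.carrier}.indicator
          (fun t => ev f (lift a y + t • e)) (τ i y)) =
        ((fun y => (T.offset i / T.normal i a) • e + graphLin a (T.normal i) y) ⁻¹'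
          T.facet i).indicator
          fun y => ev f ((T.offset i / T.normal i a) • e + graphLin a (T.normal i) y) := by
      funext y
      by_cases hy : τ i y ∈ {t : ℝ | lift a y + t • e ∈ T.carrier}
      · have hy' : y ∈ (fun y => (T.offset i / T.normal i a) • e +
            graphLin a (T.normal i) y) ⁻¹' T.facet i := (hset y).2 hy
        rw [Set.indicator_of_mem hy, Set.indicator_of_mem hy', hgraph i hi]
      · have hy' : y ∉ (fun y => (T.offset i / T.normal i a) • e +
            graphLin a (T.normal i) y) ⁻¹' T.facet i := fun h => hy ((hset y).1 h)
        rw [Set.indicator_of_notMem hy, Set.indicator_of_notMem hy']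
    have hmeas : MeasurableSet ((fun y => (T.offset i / T.normal i a) • e +
        graphLin a (T.normal i) y) ⁻¹' T.facet i) :=
      hemb.measurable (T.isCompact_facet i).measurableSet
    have hclosed : Topology.IsClosedEmbedding (fun y => (T.offset i / T.normal i a) • e +
        graphLin a (T.normal i) y) :=
      (Homeomorph.addLeft _).isClosedEmbedding.comp
        (LinearMap.isClosedEmbedding_of_injective (LinearMap.ker_eq_bot.2 hinj))
    rw [hind]
    refine ⟨?_, ?_⟩
    · rw [integrable_indicator_iff hmeas]
      exact ((continuous_ev f).comp hclosed.continuous).continuousOn.integrableOn_compact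
        (hclosed.isCompact_preimage (T.isCompact_facet i))
    · rw [integral_indicator hmeas, ← normDet_graphLin a (T.norm_normal i) hi]
      exact setIntegral_eq_normDet_mul _ hinj (T.facet_subset_range a i hi)
        (T.isCompact_facet i).measurableSet _
  rw [integral, setIntegral_eq_integral_lift a T.isCompact_carrier (continuous_ev _),
    integral_congr_ae hinner, integral_finsetSum]
  · refine Finset.sum_congr rfl fun i _ => ?_
    rw [integral_const_mul]
    by_cases hi : T.normal i a = 0
    · simp [hi]
    · rw [(hfacet i hi).2]
      ring
  · intro i _
    by_cases hi : T.normal i a = 0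
    · simp [hi]
    · exact (hfacet i hi).1.const_mul _

end ConvexPolytope

end WeakGalerkin

namespace WeakGalerkin

/-! ### Geometry of polytopes -/

namespace ConvexPolytope

variable {d : ℕ} (T : ConvexPolytope d)

/-- The distance to the hyperplane of a facet, positive in the interior. -/
def slack (i : Fin T.numFacets) (x : Space d) : ℝ := T.offset i - inner ℝ (T.normal i) x

theorem mem_carrier_iff {x : Space d} : x ∈ T.carrier ↔ ∀ i, 0 ≤ T.slack i x :=
  forall_congr' fun _ => sub_nonneg.symm

theorem mem_facet_iff {i : Fin T.numFacets} {x : Space d} :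
    x ∈ T.facet i ↔ x ∈ T.carrier ∧ T.slack i x = 0 := by
  refine and_congr_right fun _ => ?_
  rw [slack, sub_eq_zero, eq_comm]
  rfl

theorem slack_add (i : Fin T.numFacets) (x v : Space d) :
    T.slack i (x + v) = T.slack i x - inner ℝ (T.normal i) v := by
  rw [slack, slack, inner_add_right]; ring

theorem slack_add_smul_sub (i : Fin T.numFacets) (x y : Space d) (t : ℝ) :
    T.slack i (x + t • (y - x)) = (1 - t) * T.slack i x + t * T.slack i y := by
  rw [slack, slack, slack, inner_add_right, inner_smul_right, inner_sub_right]; ring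

theorem slack_sub_le (i : Fin T.numFacets) (x y : Space d) :
    T.slack i x - T.slack i y ≤ ‖x - y‖ := by
  have h1 : T.slack i x - T.slack i y = inner ℝ (T.normal i) (y - x) := by
    rw [slack, slack, inner_sub_right]; ring
  rw [h1, norm_sub_rev]
  refine (real_inner_le_norm _ _).trans ?_
  rw [T.norm_normal, one_mul]

theorem norm_sub_le_size {x y : Space d} (hx : x ∈ T.carrier) (hy : y ∈ T.carrier) :
    ‖x - y‖ ≤ T.size := by
  rw [← dist_eq_norm]
  exact Metric.dist_le_diam_of_mem T.isCompact_carrier.isBounded hx hy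

theorem facet_nonempty (i : Fin T.numFacets) : (T.facet i).Nonempty := by
  by_contra h
  rw [Set.not_nonempty_iff_eq_empty] at h
  have h1 : 0 < μHE[d - 1] (T.facet i) := T.facet_pos i
  rw [h, measure_empty] at h1
  exact lt_irrefl _ h1

theorem size_pos (hd : 1 ≤ d) : 0 < T.size := by
  obtain ⟨x, hx⟩ : (interior T.carrier).Nonempty := T.nonempty_interior
  obtain ⟨ε, hε, hball⟩ := Metric.isOpen_iff.1 isOpen_interior x hx
  let e : Space d := EuclideanSpace.single ⟨0, hd⟩ (ε / 2)
  have he : ‖e‖ = ε / 2 := by simp [e, abs_of_pos hε]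
  have h1 : x + e ∈ T.carrier := by
    refine interior_subset (hball ?_)
    rw [Metric.mem_ball, dist_eq_norm, add_sub_cancel_left, he]
    linarith
  have h2 := T.norm_sub_le_size h1 (interior_subset hx)
  rw [add_sub_cancel_left, he] at h2
  linarith

theorem slack_le_size {i : Fin T.numFacets} {x : Space d} (hx : x ∈ T.carrier) :
    T.slack i x ≤ T.size := by
  obtain ⟨y, hy⟩ := T.facet_nonempty i
  have h1 := T.slack_sub_le i x y
  rw [(T.mem_facet_iff.1 hy).2, sub_zero] at h1
  exact h1.trans (T.norm_sub_le_size hx hy.1)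

/-- The chart of a ball of radius `size`. -/
def cellChart (hd : 1 ≤ d) (x₀ : Space d) : Chart d d where
  base := x₀
  dir := LinearIsometry.id
  scale := T.size
  scale_pos := T.size_pos hd

theorem mem_cellChart_disc {hd : 1 ≤ d} {x₀ x : Space d} :
    x ∈ (T.cellChart hd x₀).disc ↔ ‖x - x₀‖ ≤ T.size := by
  have hs := T.size_pos hd
  constructor
  · rintro ⟨y, hy, rfl⟩
    rw [mem_closedBall_zero_iff] at hy
    change ‖x₀ + T.size • y - x₀‖ ≤ _
    rw [add_sub_cancel_left, norm_smul, Real.norm_eq_abs, abs_of_pos hs]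
    nlinarith
  · intro h
    refine ⟨T.size⁻¹ • (x - x₀), ?_, ?_⟩
    · rw [mem_closedBall_zero_iff, norm_smul, norm_inv, Real.norm_eq_abs, abs_of_pos hs,
        inv_mul_le_iff₀ hs, mul_one]
      exact h
    · change x₀ + T.size • T.size⁻¹ • (x - x₀) = x
      rw [smul_smul, mul_inv_cancel₀ hs.ne', one_smul]
      abel

theorem carrier_subset_disc {hd : 1 ≤ d} {x₀ : Space d} (h : x₀ ∈ T.carrier) :
    T.carrier ⊆ (T.cellChart hd x₀).disc := fun _ hx =>
  T.mem_cellChart_disc.2 (T.norm_sub_le_size hx h)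

theorem exists_isometry_range_orthogonal {n : Space d} (hn : ‖n‖ = 1) :
    ∃ ι : Space (d - 1) →ₗᵢ[ℝ] Space d, ∀ x, inner ℝ n x = 0 ↔ ∃ y, ι y = x := by
  have hn0 : n ≠ 0 := by
    intro h; rw [h, norm_zero] at hn; exact zero_ne_one hn
  let K : Submodule ℝ (Space d) := (ℝ ∙ n)ᗮ
  have hd : Module.finrank ℝ K = d - 1 := by
    have h1 := Submodule.finrank_add_finrank_orthogonal (ℝ ∙ n)
    rw [finrank_span_singleton hn0, finrank_euclideanSpace_fin] at h1
    change 1 + Module.finrank ℝ K = d at h1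
    omega
  let b : OrthonormalBasis (Fin (d - 1)) ℝ K := (stdOrthonormalBasis ℝ K).reindex (finCongr hd)
  refine ⟨K.subtypeₗᵢ.comp b.repr.symm.toLinearIsometry, fun x => ?_⟩
  rw [← Submodule.mem_orthogonal_singleton_iff_inner_right]
  constructor
  · intro hx
    exact ⟨b.repr ⟨x, hx⟩, by simp⟩
  · rintro ⟨y, rfl⟩
    exact (b.repr.symm y).2

theorem exists_facetChart (hd : 1 ≤ d) {i : Fin T.numFacets} {x₀ : Space d}
    (hx₀ : T.slack i x₀ = 0) : ∃ c : Chart (d - 1) d, c.base = x₀ ∧ c.scale = T.size ∧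
      ∀ x, x ∈ c.disc ↔ T.slack i x = 0 ∧ ‖x - x₀‖ ≤ T.size := by
  have hs := T.size_pos hd
  obtain ⟨ι, hι⟩ := exists_isometry_range_orthogonal (T.norm_normal i)
  refine ⟨⟨x₀, ι, T.size, hs⟩, rfl, rfl, fun x => ?_⟩
  constructor
  · rintro ⟨y, hy, rfl⟩
    rw [mem_closedBall_zero_iff] at hy
    change T.slack i (x₀ + T.size • ι y) = 0 ∧ ‖x₀ + T.size • ι y - x₀‖ ≤ T.size
    refine ⟨?_, ?_⟩
    · rw [slack_add, hx₀, inner_smul_right, (hι _).2 ⟨y, rfl⟩]; ring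
    · rw [add_sub_cancel_left, norm_smul, Real.norm_eq_abs, abs_of_pos hs, ι.norm_map]
      nlinarith
  · rintro ⟨h1, h2⟩
    obtain ⟨y, hy⟩ := (hι (T.size⁻¹ • (x - x₀))).1 (by
      have h3 := T.slack_add i x₀ (x - x₀)
      rw [add_sub_cancel, h1, hx₀] at h3
      rw [inner_smul_right, show inner ℝ (T.normal i) (x - x₀) = 0 by linarith, mul_zero])
    refine ⟨y, ?_, ?_⟩
    · rw [mem_closedBall_zero_iff, ← ι.norm_map, hy, norm_smul, norm_inv, Real.norm_eq_abs,
        abs_of_pos hs, inv_mul_le_iff₀ hs, mul_one]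
      exact h2
    · change x₀ + T.size • ι y = x
      rw [hy, smul_smul, mul_inv_cancel₀ hs.ne', one_smul]
      abel

end ConvexPolytope

/-! ### Centroids of cells and facets -/

/-- The centroid of a set stays away, quantitatively, from the boundary of every half space
containing the set. -/
theorem Chart.exists_centroid (d' : ℕ) {θ : ℝ} (hθ : 0 < θ) :
    ∃ b : ℝ, 0 < b ∧ ∀ (d : ℕ) (c : Chart d' d) (E : Set (Space d)), E ⊆ c.disc →
      IsCompact E → θ * c.scale ^ d' ≤ (μHE[d'] E).toReal →
      ∃ z : Space d, ∀ (n : Space d) (o : ℝ), (∀ x ∈ E, inner ℝ n x ≤ o) →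
        ∀ x ∈ c.disc, b * |o - inner ℝ n x| ≤ o - inner ℝ n z := by
  obtain ⟨a, ha, hlow⟩ := Chart.exists_abs_lower d' 1 hθ
  set V := (volume (Metric.closedBall (0 : Space d') 1)).toReal with hV
  have hVpos : 0 < V := ENNReal.toReal_pos
    (Metric.measure_closedBall_pos _ _ one_pos).ne' measure_closedBall_lt_top.ne
  refine ⟨a / V, by positivity, fun d c E hE hc hθE => ?_⟩
  have hsc : 0 < c.scale ^ d' := pow_pos c.scale_pos _
  set μ := (μHE[d'] E).toReal with hμ
  have hμpos : 0 < μ := (mul_pos hθ hsc).trans_le hθE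
  have hμle : μ ≤ c.scale ^ d' * V := c.measure_le hE
  have hfin := c.measure_lt_top hE
  -- The distance of the centroid to a bounding hyperplane is the mean over `E` of a nonnegative
  -- affine function. `exists_abs_lower` bounds this mean below by a multiple of the absolute value
  -- of the function at any point of the disc, even outside `E`.
  refine ⟨μ⁻¹ • ∫ x in E, x ∂μHE[d'], fun n o hno x hx => ?_⟩
  have hid : IntegrableOn (fun x : Space d => x) E μHE[d'] :=
    continuousOn_id.integrableOn_of_subset_isCompact hc hc.measurableSet subset_rfl hfin.ne
  have hin : ∫ x in E, inner ℝ n x ∂μHE[d'] = inner ℝ n (∫ x in E, x ∂μHE[d']) :=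
    (innerSL ℝ n).integral_comp_comm hid
  have hint : ∫ x in E, (o - inner ℝ n x) ∂μHE[d'] =
      μ * (o - inner ℝ n (μ⁻¹ • ∫ x in E, x ∂μHE[d'])) := by
    have i1 : IntegrableOn (fun _ : Space d => o) E μHE[d'] := integrableOn_const hfin.ne
    have i2 : IntegrableOn (fun x : Space d => (inner ℝ n x : ℝ)) E μHE[d'] :=
      Chart.continuous_integrableOn hc hfin (by fun_prop)
    rw [integral_sub i1 i2, hin, setIntegral_const, inner_smul_right]
    simp only [measureReal_def, smul_eq_mul, ← hμ]
    field_simp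
  let p : MvPolynomial (Fin d) ℝ :=
    MvPolynomial.C o - ∑ j, MvPolynomial.C (n j) * MvPolynomial.X j
  have hp : ∀ x, ev p x = o - inner ℝ n x := by
    intro x
    simp [p, ev, PiLp.inner_apply, mul_comm]
  have hpd : p.totalDegree ≤ 1 := by
    refine (MvPolynomial.totalDegree_sub _ _).trans (max_le (by simp) ?_)
    refine MvPolynomial.totalDegree_finsetSum_le fun j _ => ?_
    refine (MvPolynomial.totalDegree_mul _ _).trans ?_
    simp
  have h1 := hlow d c E hE hc hθE p hpd x hx
  have h2 : ∫ z in E, |ev p z| ∂μHE[d'] = ∫ x in E, (o - inner ℝ n x) ∂μHE[d'] := by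
    refine setIntegral_congr_fun hc.measurableSet fun z hz => ?_
    simp only [hp]
    exact abs_of_nonneg (sub_nonneg.2 (hno z hz))
  rw [h2, hint, hp] at h1
  set r := o - inner ℝ n (μ⁻¹ • ∫ x in E, x ∂μHE[d']) with hr
  have hr0 : 0 ≤ r := by
    by_contra hneg
    have : 0 ≤ a * c.scale ^ d' * |o - inner ℝ n x| := by positivity
    nlinarith
  have h3 : a * c.scale ^ d' * |o - inner ℝ n x| ≤ c.scale ^ d' * V * r :=
    h1.trans (mul_le_mul_of_nonneg_right hμle hr0)
  rw [div_mul_eq_mul_div, div_le_iff₀ hVpos]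
  have h4 : c.scale ^ d' * (a * |o - inner ℝ n x|) ≤ c.scale ^ d' * (r * V) := by linarith
  exact le_of_mul_le_mul_left h4 hsc

namespace ConvexPolytope

variable {d : ℕ}

theorem ShapeRegular.facet_measure_ge {T : ConvexPolytope d} {n : ℕ} {ρ κ α₀ : ℝ}
    (hT : T.ShapeRegular n ρ κ α₀) (hd : 1 ≤ d) (hρ : 0 < ρ) (hκ : 0 < κ) (i : Fin T.numFacets) :
    ρ * κ ^ (d - 1) * T.size ^ (d - 1) ≤ (μHE[d - 1] (T.facet i)).toReal := by
  refine le_trans ?_ (hT.facet_volume_ge i)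
  rw [mul_assoc, ← mul_pow]
  have := T.size_pos hd
  have := hT.facet_diam_ge i
  gcongr

theorem ShapeRegular.cell_measure_ge {T : ConvexPolytope d} {n : ℕ} {ρ κ α₀ : ℝ}
    (hT : T.ShapeRegular n ρ κ α₀) :
    ρ * T.size ^ d ≤ (μHE[d] T.carrier).toReal := by
  rw [EuclideanSpace.euclideanHausdorffMeasure_eq_volume]
  exact hT.volume_ge

/-- The centroid of the cell: each slack is of order `T.size` somewhere in the ball around the cell,
hence also at the centroid. -/
theorem exists_cell_centroid (hd : 1 ≤ d) {ρ : ℝ} (hρ : 0 < ρ) :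
    ∃ b : ℝ, 0 < b ∧ ∀ (T : ConvexPolytope d) (n : ℕ) (κ α₀ : ℝ), T.ShapeRegular n ρ κ α₀ →
      ∃ z ∈ T.carrier, ∀ i, b * T.size ≤ T.slack i z := by
  obtain ⟨b, hb, h⟩ := Chart.exists_centroid d hρ
  refine ⟨b, hb, fun T n κ α₀ hT => ?_⟩
  have hs := T.size_pos hd
  obtain ⟨x₀, hx₀⟩ : T.carrier.Nonempty := T.nonempty_interior.mono interior_subset
  obtain ⟨z, hz⟩ := h d (T.cellChart hd x₀) T.carrier (T.carrier_subset_disc hx₀)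
    T.isCompact_carrier hT.cell_measure_ge
  have hz' : ∀ i, b * T.size ≤ T.slack i z := by
    intro i
    -- The test point need not lie in the cell; a step of length `T.size` inwards from `x₀` raises
    -- the slack by `T.size`.
    have h1 := hz (T.normal i) (T.offset i) (fun x hx => hx i) (x₀ - T.size • T.normal i)
      (T.mem_cellChart_disc.2 (by
        rw [sub_sub_cancel_left, norm_neg, norm_smul, T.norm_normal, mul_one, Real.norm_eq_abs,
          abs_of_pos hs]))
    have h2 : T.offset i - inner ℝ (T.normal i) (x₀ - T.size • T.normal i) =
        T.slack i x₀ + T.size := by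
      rw [inner_sub_right, inner_smul_right, real_inner_self_eq_norm_sq, T.norm_normal, slack]
      ring
    rw [h2] at h1
    refine le_trans ?_ h1
    have h3 := T.mem_carrier_iff.1 hx₀ i
    have h4 := le_abs_self (T.slack i x₀ + T.size)
    exact mul_le_mul_of_nonneg_left (by linarith) hb.le
  exact ⟨z, T.mem_carrier_iff.2 fun i => (mul_pos hb hs).le.trans (hz' i), hz'⟩

/-- The component of `v` orthogonal to the unit vector `u`. -/
def tangential (u v : Space d) : Space d := v - (inner ℝ u v : ℝ) • u

theorem inner_tangential {u v : Space d} (hu : ‖u‖ = 1) : inner ℝ u (tangential u v) = 0 := by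
  rw [tangential, inner_sub_right, inner_smul_right, real_inner_self_eq_norm_sq, hu]; ring

theorem inner_tangential_right {u v : Space d} (hu : ‖u‖ = 1) :
    inner ℝ v (tangential u v) = ‖tangential u v‖ ^ 2 := by
  have h : v = tangential u v + (inner ℝ u v : ℝ) • u := by simp [tangential]
  conv_lhs => rw [h]
  rw [inner_add_left, inner_smul_left]
  have h2 : tangential u (tangential u v + (inner ℝ u v : ℝ) • u) = tangential u v := by rw [← h]
  rw [h2, inner_tangential hu, real_inner_self_eq_norm_sq]
  simp

theorem norm_tangential_sq {u v : Space d} (hu : ‖u‖ = 1) (hv : ‖v‖ = 1) :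
    ‖tangential u v‖ ^ 2 = 1 - inner ℝ u v ^ 2 := by
  rw [tangential, norm_sub_sq_real, norm_smul, hu, hv, inner_smul_right, real_inner_comm,
    Real.norm_eq_abs, mul_one, sq_abs]
  ring

/-- Inside the hyperplane of the facet `i` the slack of `l` has slope `‖tangential (T.normal i)
(T.normal l)‖`, so it reaches `T.size` times this slope at some point of the disc around the facet.
The estimate degenerates when the two hyperplanes are nearly parallel, which is why
`exists_separation` is needed. -/
theorem exists_facet_centroid (hd : 1 ≤ d) {ρ κ : ℝ} (hρ : 0 < ρ) (hκ : 0 < κ) :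
    ∃ b : ℝ, 0 < b ∧ ∀ (T : ConvexPolytope d) (n : ℕ) (α₀ : ℝ), T.ShapeRegular n ρ κ α₀ →
      ∀ i, ∃ z ∈ T.facet i, ∀ l,
        b * T.size * ‖tangential (T.normal i) (T.normal l)‖ ≤ T.slack l z := by
  have hθ : 0 < ρ * κ ^ (d - 1) := by positivity
  obtain ⟨b, hb, h⟩ := Chart.exists_centroid (d - 1) hθ
  refine ⟨b, hb, fun T n α₀ hT i => ?_⟩
  have hs := T.size_pos hd
  obtain ⟨x₀, hx₀⟩ := T.facet_nonempty i
  have hx₀' := (T.mem_facet_iff.1 hx₀)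
  obtain ⟨c, hc0, hc1, hc2⟩ := T.exists_facetChart hd hx₀'.2
  have hsub : T.facet i ⊆ c.disc := fun x hx =>
    (hc2 x).2 ⟨(T.mem_facet_iff.1 hx).2, T.norm_sub_le_size hx.1 hx₀.1⟩
  obtain ⟨z, hz⟩ := h d c (T.facet i) hsub (T.isCompact_facet i)
    (hc1 ▸ hT.facet_measure_ge hd hρ hκ i)
  have hz' : ∀ l, b * T.size * ‖tangential (T.normal i) (T.normal l)‖ ≤ T.slack l z := by
    intro l
    have key := hz (T.normal l) (T.offset l) (fun x hx => hx.1 l)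
    set τ := tangential (T.normal i) (T.normal l) with hτ
    rcases (norm_nonneg τ).eq_or_lt with h0 | h0
    · rw [← h0, mul_zero]
      exact (mul_nonneg hb.le (abs_nonneg _)).trans (key x₀ (hsub hx₀))
    · have hmem : x₀ + (-(T.size / ‖τ‖)) • τ ∈ c.disc := by
        rw [hc2, slack_add, hx₀'.2, inner_smul_right, inner_tangential (T.norm_normal i),
          add_sub_cancel_left, norm_smul, Real.norm_eq_abs, abs_neg, abs_of_pos (by positivity),
          div_mul_cancel₀ _ h0.ne']
        simp
      have h1 := key _ hmem
      have h2 : T.offset l - inner ℝ (T.normal l) (x₀ + (-(T.size / ‖τ‖)) • τ) =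
          T.slack l x₀ + T.size * ‖τ‖ := by
        rw [inner_add_right, inner_smul_right, inner_tangential_right (T.norm_normal i), slack]
        field_simp
        ring
      rw [h2] at h1
      refine le_trans ?_ h1
      have h3 := T.mem_carrier_iff.1 hx₀.1 l
      have h4 := le_abs_self (T.slack l x₀ + T.size * ‖τ‖)
      rw [mul_assoc]
      exact mul_le_mul_of_nonneg_left (by linarith) hb.le
  refine ⟨z, T.mem_facet_iff.2 ⟨T.mem_carrier_iff.2 fun l =>
    le_trans (by positivity) (hz' l), ?_⟩, hz'⟩
  -- The half space on the other side also contains the facet, so the centroid lies in its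
  -- hyperplane.
  have h1 := hz (-T.normal i) (-T.offset i) (fun x hx => by
    rw [inner_neg_left, hx.2]) x₀ (hsub hx₀)
  have h2 : 0 ≤ -T.offset i - inner ℝ (-T.normal i) z :=
    (mul_nonneg hb.le (abs_nonneg _)).trans h1
  have h3 : 0 ≤ T.slack i z := le_trans (by positivity) (hz' i)
  rw [inner_neg_left] at h2
  rw [slack] at h3 ⊢
  linarith

end ConvexPolytope

end WeakGalerkin

namespace WeakGalerkin

namespace ConvexPolytope

variable {d : ℕ} (T : ConvexPolytope d)

/-! ### Separation of facets -/

/-- Two hyperplanes with parallel normals that bound a polytope have opposite normals. -/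
theorem slack_add_slack_pos {i l : Fin T.numFacets} (h : i ≠ l)
    (hp : tangential (T.normal i) (T.normal l) = 0) (x : Space d) :
    0 < T.slack i x + T.slack l x := by
  have h1 : T.normal l = (inner ℝ (T.normal i) (T.normal l) : ℝ) • T.normal i :=
    sub_eq_zero.1 hp
  set r : ℝ := inner ℝ (T.normal i) (T.normal l) with hr
  have hr1 : |r| = 1 := by
    have := congrArg norm h1
    rw [norm_smul, T.norm_normal, T.norm_normal, mul_one, Real.norm_eq_abs] at this
    exact this.symm
  rcases (abs_eq zero_le_one).1 hr1 with hr2 | hr2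
  · rw [hr2, one_smul] at h1
    exact absurd (T.normal_injective h1.symm) h
  · rw [hr2, neg_one_smul] at h1
    have hconst : ∀ y, T.slack i y + T.slack l y = T.offset i + T.offset l := by
      intro y
      rw [slack, slack, h1, inner_neg_left]; ring
    obtain ⟨y, hy⟩ : (interior T.carrier).Nonempty := T.nonempty_interior
    have hy' := T.mem_carrier_iff.1 (interior_subset hy)
    have h2 : 0 ≤ T.slack i y + T.slack l y := add_nonneg (hy' i) (hy' l)
    rw [hconst] at h2 ⊢
    refine lt_of_le_of_ne h2 fun h0 => ?_
    exact T.hyperplane_ne h (-1) (by rw [h1]; simp) (by linarith)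

/-- The vectors orthogonal to two normals. -/
theorem finrank_vectorSpan_facet_inter_le {i l : Fin T.numFacets}
    (hp : tangential (T.normal i) (T.normal l) ≠ 0) :
    Module.finrank ℝ (vectorSpan ℝ (T.facet i ∩ T.facet l)) ≤ d - 2 := by
  have hli : LinearIndependent ℝ ![T.normal i, T.normal l] := by
    have hi0 : T.normal i ≠ 0 := by
      intro h0
      have := T.norm_normal i
      rw [h0, norm_zero] at this
      exact zero_ne_one this
    rw [LinearIndependent.pair_iff' hi0]
    intro a ha
    apply hp
    rw [tangential, ← ha, inner_smul_right, real_inner_self_eq_norm_sq, T.norm_normal]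
    simp
  let S : Submodule ℝ (Space d) := Submodule.span ℝ (Set.range ![T.normal i, T.normal l])
  have hS : Module.finrank ℝ S = 2 := by
    rw [finrank_span_eq_card hli]; simp
  have hle : vectorSpan ℝ (T.facet i ∩ T.facet l) ≤ Sᗮ := by
    rw [vectorSpan_def, Submodule.span_le]
    rintro _ ⟨x, hx, y, hy, rfl⟩
    have hx1 := (T.mem_facet_iff.1 hx.1).2
    have hx2 := (T.mem_facet_iff.1 hx.2).2
    have hy1 := (T.mem_facet_iff.1 hy.1).2
    have hy2 := (T.mem_facet_iff.1 hy.2).2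
    simp only [slack] at hx1 hx2 hy1 hy2
    rw [SetLike.mem_coe, Submodule.mem_orthogonal]
    intro u hu
    induction hu using Submodule.span_induction with
    | mem u hu =>
      obtain ⟨j, rfl⟩ := hu
      change inner ℝ _ (x - y) = 0
      rw [inner_sub_right]
      fin_cases j
      · simp; linarith
      · simp; linarith
    | zero => simp
    | add u v _ _ hu hv => rw [inner_add_left, hu, hv, add_zero]
    | smul a u _ hu => rw [inner_smul_left, hu, mul_zero]
  have h1 := Submodule.finrank_add_finrank_orthogonal S
  rw [hS, finrank_euclideanSpace_fin] at h1
  have h2 := Submodule.finrank_mono hle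
  change 2 + Module.finrank ℝ Sᗮ = d at h1
  omega

/-- A facet is cut out of its hyperplane by the neighbouring facets. -/
theorem mem_carrier_of_neighbours (hd : 2 ≤ d) {i : Fin T.numFacets} {c x : Space d}
    (hc : T.slack i c = 0) (hcpos : ∀ l, l ≠ i → 0 < T.slack l c) (hx : T.slack i x = 0)
    (hN : ∀ l, T.Neighbours i l → 0 ≤ T.slack l x) : x ∈ T.carrier := by
  classical
  by_contra hxT
  let B : Finset (Fin T.numFacets) := Finset.univ.filter fun l => T.slack l x < 0
  have hB : ∀ l, l ∈ B ↔ T.slack l x < 0 := fun l => by simp [B]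
  have hBne : B.Nonempty := by
    rw [T.mem_carrier_iff] at hxT
    push Not at hxT
    obtain ⟨l, hl⟩ := hxT
    exact ⟨l, (hB l).2 hl⟩
  have hBi : ∀ l ∈ B, l ≠ i := by
    rintro l hl rfl
    exact absurd hx ((hB l).1 hl).ne
  let K : Submodule ℝ (Space d) := (ℝ ∙ T.normal i)ᗮ
  have hn0 : T.normal i ≠ 0 := by
    intro h0
    have := T.norm_normal i
    rw [h0, norm_zero] at this
    exact zero_ne_one this
  have hK : Module.finrank ℝ K = d - 1 := by
    have h1 := Submodule.finrank_add_finrank_orthogonal (ℝ ∙ T.normal i)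
    rw [finrank_span_singleton hn0, finrank_euclideanSpace_fin] at h1
    change 1 + Module.finrank ℝ K = d at h1
    omega
  have hKmem : ∀ v, v ∈ K ↔ inner ℝ (T.normal i) v = 0 := fun v =>
    Submodule.mem_orthogonal_singleton_iff_inner_right
  -- Directions of the span of `x` and the common part of the facets `i` and `l`. A violated `l` is
  -- not a neighbour, so this common part is empty or of dimension below `d - 2`, and `D l` is a
  -- proper part of the `(d - 1)`-dimensional space `K`.
  let D : Fin T.numFacets → Submodule ℝ (Space d) := fun l =>
    if (T.facet i ∩ T.facet l).Nonempty then vectorSpan ℝ (insert x (T.facet i ∩ T.facet l))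
    else ⊥
  have hDpos : ∀ l, (T.facet i ∩ T.facet l).Nonempty →
      D l = vectorSpan ℝ (insert x (T.facet i ∩ T.facet l)) := fun l h => if_pos h
  have hD : ∀ l ∈ B, Module.finrank ℝ (D l) < d - 1 := by
    intro l hl
    by_cases hne : (T.facet i ∩ T.facet l).Nonempty
    · have hp : tangential (T.normal i) (T.normal l) ≠ 0 := by
        intro hp
        obtain ⟨y, hy1, hy2⟩ := hne
        have := T.slack_add_slack_pos (hBi l hl).symm hp y
        rw [(T.mem_facet_iff.1 hy1).2, (T.mem_facet_iff.1 hy2).2] at this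
        simp at this
      have h1 := T.finrank_vectorSpan_facet_inter_le hp
      have h2 : Module.finrank ℝ (vectorSpan ℝ (T.facet i ∩ T.facet l)) ≠ d - 2 := fun h2 =>
        absurd (hN l ⟨(hBi l hl).symm, hne, h2⟩) (not_le.2 ((hB l).1 hl))
      have h3 := finrank_vectorSpan_insert_le_set ℝ (T.facet i ∩ T.facet l) x
      rw [hDpos l hne]
      omega
    · have h0 : D l = ⊥ := if_neg hne
      rw [h0, finrank_bot]
      omega
  obtain ⟨e, heK, heD⟩ : ∃ e ∈ K, ∀ l ∈ B, e ∉ D l := by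
    have hcov := Subspace.biUnion_ne_univ_of_top_notMem (k := ℝ) (E := K)
      (s := B.image fun l => (D l).comap K.subtype) (by
        intro htop
        rw [Finset.mem_image] at htop
        obtain ⟨l, hl, htop⟩ := htop
        have hle : K ≤ D l := fun v hv => by
          have : (⟨v, hv⟩ : K) ∈ (D l).comap K.subtype := by rw [htop]; trivial
          exact this
        have := Submodule.finrank_mono hle
        have := hD l hl
        omega)
    rw [Set.ne_univ_iff_exists_notMem] at hcov
    obtain ⟨e, he⟩ := hcov
    refine ⟨e.1, e.2, fun l hl hel => he ?_⟩
    exact Set.mem_biUnion (x := (D l).comap K.subtype)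
      (Finset.mem_coe.2 (Finset.mem_image_of_mem _ hl)) hel
  obtain ⟨s₀, hs₀, hs⟩ : ∃ s₀ : ℝ, 0 < s₀ ∧ ∀ s ∈ Set.Ioo 0 s₀, ∀ l, l ≠ i →
      0 < T.slack l (c + s • e) := by
    have hev : ∀ᶠ s : ℝ in nhdsWithin 0 (Set.Ioi 0), ∀ l, l ≠ i → 0 < T.slack l (c + s • e) := by
      rw [Filter.eventually_all]
      intro l
      by_cases hl : l = i
      · exact Filter.Eventually.of_forall fun s h => absurd hl h
      have hcont : Continuous fun s : ℝ => T.slack l (c + s • e) := by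
        unfold slack; fun_prop
      have h0 : 0 < T.slack l (c + (0 : ℝ) • e) := by
        rw [zero_smul, add_zero]; exact hcpos l hl
      filter_upwards [nhdsWithin_le_nhds (hcont.tendsto 0 (lt_mem_nhds h0))] with s hs _
      exact hs
    obtain ⟨s₀, hs₀, hs⟩ := mem_nhdsGT_iff_exists_Ioo_subset.1 hev
    exact ⟨s₀, hs₀, hs⟩
  -- Since `e` is outside every `D l` with `l` violated, each such `l` excludes at most one `s`: the
  -- start point of the segment to `x` can be moved into general position.
  obtain ⟨s, hsI, hsD⟩ : ∃ s ∈ Set.Ioo 0 s₀, ∀ l ∈ B, c + s • e - x ∉ D l := by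
    have hbad : (⋃ l ∈ B, {s : ℝ | c + s • e - x ∈ D l}).Finite := by
      refine Set.Finite.biUnion B.finite_toSet fun l hl => Set.Subsingleton.finite ?_
      intro s hs t ht
      by_contra hst
      have h1 : (s - t) • e ∈ D l := by
        have := (D l).sub_mem hs ht
        have h2 : c + s • e - x - (c + t • e - x) = (s - t) • e := by module
        rwa [h2] at this
      exact heD l hl (((D l).smul_mem_iff (sub_ne_zero.2 hst)).1 h1)
    obtain ⟨s, hs1, hs2⟩ := ((Set.Ioo_infinite hs₀).sdiff hbad).nonempty
    refine ⟨s, hs1, fun l hl h => hs2 ?_⟩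
    exact Set.mem_biUnion (x := l) hl h
  set y := c + s • e with hy
  have hyi : T.slack i y = 0 := by
    rw [hy, slack_add, hc, inner_smul_right, (hKmem e).1 heK]; ring
  have hypos := hs s hsI
  -- The first violated constraint met on the way from `y` to `x`. The exit point `p` lies on both
  -- facets `i` and `l`, so `p - x`, hence `y - x`, would lie in `D l`.
  obtain ⟨l, hl, hmin⟩ := Finset.exists_min_image B
    (fun l => T.slack l y / (T.slack l y - T.slack l x)) hBne
  set t := T.slack l y / (T.slack l y - T.slack l x) with ht
  have hly := hypos l (hBi l hl)
  have hlx := (hB l).1 hl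
  have hden : 0 < T.slack l y - T.slack l x := by linarith
  have ht0 : 0 < t := div_pos hly hden
  have ht1 : t < 1 := by rw [ht, div_lt_one hden]; linarith
  set p := y + t • (x - y) with hp
  have hpi : T.slack i p = 0 := by rw [hp, slack_add_smul_sub, hyi, hx]; ring
  have hpl : T.slack l p = 0 := by
    rw [hp, slack_add_smul_sub, ht]
    field_simp
    ring
  have hpT : p ∈ T.carrier := by
    rw [T.mem_carrier_iff]
    intro m
    by_cases hmi : m = i
    · rw [hmi, hpi]
    have hmy := hypos m hmi
    rw [hp, slack_add_smul_sub]
    by_cases hmB : m ∈ B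
    · have hm1 := hmin m hmB
      have hmx := (hB m).1 hmB
      have hden' : 0 < T.slack m y - T.slack m x := by linarith
      rw [le_div_iff₀ hden'] at hm1
      linarith
    · rw [hB, not_lt] at hmB
      have : 0 ≤ 1 - t := by linarith
      positivity
  have hpF : p ∈ T.facet i ∩ T.facet l :=
    ⟨T.mem_facet_iff.2 ⟨hpT, hpi⟩, T.mem_facet_iff.2 ⟨hpT, hpl⟩⟩
  refine hsD l hl ?_
  have h1 : p - x ∈ D l := by
    rw [hDpos l ⟨p, hpF⟩]
    exact vsub_mem_vectorSpan ℝ (Set.mem_insert_of_mem _ hpF) (Set.mem_insert _ _)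
  have h2 : p - x = (1 - t) • (y - x) := by rw [hp]; module
  rw [h2] at h1
  exact ((D l).smul_mem_iff (by linarith)).1 h1

/-- The norm of the tangential part is the sine of the angle between the unit vectors, so `sin α₀`
serves. For `α₀ > π / 2` no angle satisfies both bounds and any constant will do. -/
theorem exists_angle_bound {α₀ : ℝ} (hα₀ : 0 < α₀) : ∃ σ : ℝ, 0 < σ ∧ σ ≤ 1 ∧
    ∀ (d : ℕ) (u v : Space d), ‖u‖ = 1 → ‖v‖ = 1 → α₀ ≤ InnerProductGeometry.angle u v →
      InnerProductGeometry.angle u v ≤ Real.pi - α₀ → σ ≤ ‖tangential u v‖ := by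
  by_cases h : α₀ ≤ Real.pi / 2
  · refine ⟨Real.sin α₀, Real.sin_pos_of_pos_of_lt_pi hα₀ (by linarith [Real.pi_pos]),
      Real.sin_le_one _, fun d u v hu hv h1 h2 => ?_⟩
    have hcos : Real.cos (InnerProductGeometry.angle u v) = inner ℝ u v := by
      rw [InnerProductGeometry.cos_angle, hu, hv]; simp
    have h3 : inner ℝ u v ≤ Real.cos α₀ := by
      rw [← hcos]
      exact Real.cos_le_cos_of_nonneg_of_le_pi hα₀.le (InnerProductGeometry.angle_le_pi _ _) h1
    have h4 : -Real.cos α₀ ≤ inner ℝ u v := by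
      rw [← hcos, ← Real.cos_pi_sub]
      exact Real.cos_le_cos_of_nonneg_of_le_pi (InnerProductGeometry.angle_nonneg _ _)
        (by linarith) h2
    have h5 : (inner ℝ u v : ℝ) ^ 2 ≤ Real.cos α₀ ^ 2 := sq_le_sq' h4 h3
    refine abs_le_of_sq_le_sq' ?_ (norm_nonneg _) |>.2
    rw [norm_tangential_sq hu hv]
    linarith [Real.sin_sq_add_cos_sq α₀]
  · exact ⟨1, one_pos, le_rfl, fun d u v _ _ h1 h2 => by linarith⟩

set_option maxHeartbeats 400000 in
/-- The hyperplane of each facet is quantitatively separated from the other facets. -/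
theorem exists_separation (hd : 2 ≤ d) {ρ κ α₀ : ℝ} (hρ : 0 < ρ) (hκ : 0 < κ) (hα₀ : 0 < α₀) :
    ∃ δ : ℝ, 0 < δ ∧ ∀ (T : ConvexPolytope d) (n : ℕ), T.ShapeRegular n ρ κ α₀ →
      ∀ i, ∃ z ∈ T.facet i, ∀ l, l ≠ i → δ * T.size ≤ T.slack l z := by
  have hd1 : 1 ≤ d := by omega
  obtain ⟨b₀, hb₀, hcell⟩ := exists_cell_centroid hd1 hρ
  obtain ⟨b, hb, hfacet⟩ := exists_facet_centroid hd1 hρ hκ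
  obtain ⟨σ, hσ, hσ1, hangle⟩ := exists_angle_bound hα₀
  set b₁ := min b 1 with hb₁def
  have hb₁ : 0 < b₁ := lt_min hb one_pos
  have hb₁1 : b₁ ≤ 1 := min_le_right _ _
  set β := b₁ * σ with hβdef
  have hβ : 0 < β := mul_pos hb₁ hσ
  have hβ1 : β ≤ 1 := by nlinarith
  -- The first bound excludes normals with nonpositive inner product. The second makes `t₀ = 2 * δ /
  -- (b₁ * β)` at most `β / 10`, which excludes nearly coplanar facets.
  set δ := min (b₀ * b₁ / 4) (b₁ * β ^ 2 / 20) with hδdef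
  have hδ : 0 < δ := by positivity
  have hδ1 : δ ≤ b₀ * b₁ / 4 := min_le_left _ _
  have hδ2 : δ ≤ b₁ * β ^ 2 / 20 := min_le_right _ _
  refine ⟨δ, hδ, fun T n hT i => ?_⟩
  set h := T.size with hh
  have hs : 0 < h := T.size_pos hd1
  obtain ⟨c₀, hc₀, hc₀'⟩ := hcell T n κ α₀ hT
  choose c hcF hcb using hfacet T n α₀ hT
  have hcT : ∀ i, c i ∈ T.carrier := fun i => (hcF i).1
  have hcs : ∀ i, T.slack i (c i) = 0 := fun i => (T.mem_facet_iff.1 (hcF i)).2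
  have hcb' : ∀ i l, b₁ * h * ‖tangential (T.normal i) (T.normal l)‖ ≤ T.slack l (c i) := by
    intro i l
    refine le_trans ?_ (hcb i l)
    have : b₁ ≤ b := min_le_left _ _
    gcongr
  -- Positivity for all pairs, without a rate, for the facet centroid. The quantitative bound `hnb`
  -- is available for neighbours only.
  have hpos : ∀ i l, l ≠ i → 0 < T.slack l (c i) := by
    intro i l hl
    by_cases hp : tangential (T.normal i) (T.normal l) = 0
    · have := T.slack_add_slack_pos hl.symm hp (c i)
      rwa [hcs i, zero_add] at this
    · exact lt_of_lt_of_le (mul_pos (mul_pos hb₁ hs) (norm_pos_iff.2 hp)) (hcb' i l)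
  have hnb : ∀ i m, T.Neighbours i m → β * h ≤ T.slack m (c i) := by
    intro i m hm
    refine le_trans ?_ (hcb' i m)
    have := hangle d _ _ (T.norm_normal i) (T.norm_normal m) (hT.angle_ge i m hm)
      (hT.angle_le i m hm)
    rw [hβdef, mul_right_comm]
    gcongr
  refine ⟨c i, hcF i, fun l hl => ?_⟩
  by_contra! hlt
  set τ := tangential (T.normal i) (T.normal l) with hτ
  set a : ℝ := inner ℝ (T.normal i) (T.normal l) with ha
  set s := ‖τ‖ with hsdef
  have hs0 : 0 ≤ s := norm_nonneg _
  have hsδ : b₁ * s < δ := by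
    have h1 := hcb' i l
    have h2 : h * (b₁ * s) < h * δ := by
      calc h * (b₁ * s) = b₁ * h * s := by ring
        _ ≤ T.slack l (c i) := h1
        _ < δ * h := hlt
        _ = h * δ := by ring
    exact lt_of_mul_lt_mul_left h2 hs.le
  have hnl : T.normal l = a • T.normal i + τ := by simp [hτ, tangential, ha]
  have hform : ∀ x, T.slack l x = T.slack l (c i) + a * T.slack i x - inner ℝ τ (x - c i) := by
    intro x
    have h1 := T.slack_add l (c i) (x - c i)
    have h2 := T.slack_add i (c i) (x - c i)
    rw [add_sub_cancel] at h1 h2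
    rw [h1, h2, hcs i, hnl, inner_add_left, inner_smul_left]
    simp
    ring
  have hτb : ∀ x ∈ T.carrier, |inner ℝ τ (x - c i)| ≤ s * h := fun x hx =>
    (abs_real_inner_le_norm _ _).trans
      (mul_le_mul_of_nonneg_left (T.norm_sub_le_size hx (hcT i)) hs0)
  have hli0 : 0 < T.slack l (c i) := hpos i l hl
  -- By `hsδ` the two normals are almost parallel. If `a ≤ 0`, the cell is a thin slab between the
  -- two hyperplanes, which contradicts the cell centroid.
  rcases le_or_gt a 0 with ha0 | ha0
  · have h1 := hc₀' l
    rw [hform c₀] at h1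
    have h2 := (abs_le.1 (hτb c₀ hc₀)).1
    have h3 : a * T.slack i c₀ ≤ 0 :=
      mul_nonpos_of_nonpos_of_nonneg ha0 (T.mem_carrier_iff.1 hc₀ i)
    have h4 : b₀ * h < (δ + s) * h := by linarith
    have h5 : b₀ < δ + s := lt_of_mul_lt_mul_right h4 hs.le
    have h6 : b₁ * b₀ < b₁ * δ + b₁ * s := by nlinarith
    have h7 : b₁ * δ ≤ δ := by nlinarith
    nlinarith
  · set ε := T.slack i (c l) with hε
    have hε0 : 0 ≤ ε := T.mem_carrier_iff.1 (hcT l) i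
    have ha2 : 1 / 2 ≤ a := by
      have h1 := norm_tangential_sq (T.norm_normal i) (T.norm_normal l)
      have h2 : s ≤ 1 / 2 := by
        have : b₁ * s ≤ b₁ * (1 / 2) := by nlinarith
        exact le_of_mul_le_mul_left this hb₁
      have h3 : s ^ 2 = 1 - a ^ 2 := h1
      nlinarith
    -- Chosen so that `t₀ * β * h` is at least the distance `ε` of `c l` to the hyperplane of `i`.
    set t₀ := 2 * δ / (b₁ * β) with ht₀
    have ht₀pos : 0 < t₀ := by positivity
    have ht₀β : t₀ ≤ β / 10 := by
      rw [ht₀, div_le_iff₀ (by positivity)]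
      nlinarith
    have hεle : ε ≤ t₀ * β * h := by
      have h1 := hform (c l)
      rw [hcs l] at h1
      have h2 := (abs_le.1 (hτb (c l) (hcT l))).2
      have h3 : a * ε ≤ s * h := by linarith
      have h4 : ε ≤ 2 * s * h := by nlinarith
      have h5 : t₀ * β = 2 * δ / b₁ := by rw [ht₀]; field_simp
      have h6 : s ≤ δ / b₁ := by rw [le_div_iff₀ hb₁]; linarith
      have h7 : 2 * s ≤ t₀ * β := by rw [h5, mul_div_assoc]; linarith
      exact h4.trans (mul_le_mul_of_nonneg_right h7 hs.le)
    have hεh : ε ≤ t₀ * h := by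
      refine hεle.trans (mul_le_mul_of_nonneg_right ?_ hs.le)
      exact mul_le_of_le_one_right ht₀pos.le hβ1
    set y := c l + ε • T.normal i with hy
    have hyi : T.slack i y = 0 := by
      rw [hy, slack_add, inner_smul_right, real_inner_self_eq_norm_sq, T.norm_normal, ← hε]
      ring
    have hyn : ‖c i - y‖ ≤ h + ε := by
      have : c i - y = (c i - c l) - ε • T.normal i := by rw [hy]; abel
      rw [this]
      refine (norm_sub_le _ _).trans (add_le_add (T.norm_sub_le_size (hcT i) (hcT l)) ?_)
      rw [norm_smul, T.norm_normal, Real.norm_eq_abs, abs_of_nonneg hε0, mul_one]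
    -- Near the projection `y` of `c l` to the hyperplane of `i`, the segment towards `c i` must lie
    -- in both hyperplanes. The point `z` satisfies the neighbour inequalities of `i`, since `t *
    -- T.slack m (c i) ≥ t₀ * β * h ≥ ε`, so it belongs to the cell.
    have key : ∀ t, t₀ ≤ t → t ≤ 2 * t₀ → T.slack l (y + t • (c i - y)) = 0 := by
      intro t ht1 ht2
      set z := y + t • (c i - y) with hz
      have ht0 : 0 < t := ht₀pos.trans_le ht1
      have htle : t ≤ 1 := by linarith
      have hzi : T.slack i z = 0 := by rw [hz, slack_add_smul_sub, hyi, hcs i]; ring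
      have hzT : z ∈ T.carrier := by
        refine T.mem_carrier_of_neighbours hd (hcs i) (hpos i) hzi fun m hm => ?_
        rw [hz, slack_add_smul_sub]
        have h1 := hnb i m hm
        have h2 : -ε ≤ T.slack m y := by
          rw [hy, slack_add, inner_smul_right]
          have h3 := T.mem_carrier_iff.1 (hcT l) m
          have h4 : inner ℝ (T.normal m) (T.normal i) ≤ 1 := by
            refine (real_inner_le_norm _ _).trans ?_
            rw [T.norm_normal, T.norm_normal, one_mul]
          have h5 := mul_le_mul_of_nonneg_left h4 hε0
          linarith
        have h5 : t₀ * (β * h) ≤ t * T.slack m (c i) := by gcongr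
        have h6 := mul_le_mul_of_nonneg_left h2 (sub_nonneg.2 htle)
        have h7 := mul_nonneg ht0.le hε0
        linarith
      have hzl0 := T.mem_carrier_iff.1 hzT l
      have hzc : ‖z - c l‖ ≤ 5 * t₀ * h := by
        have h1 : z - c l = ε • T.normal i + t • (c i - y) := by rw [hz, hy]; abel
        rw [h1]
        refine (norm_add_le _ _).trans ?_
        rw [norm_smul, norm_smul, T.norm_normal, Real.norm_eq_abs, Real.norm_eq_abs,
          abs_of_nonneg hε0, abs_of_pos ht0, mul_one]
        have h2 : t * ‖c i - y‖ ≤ 2 * t₀ * (h + h) := by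
          refine mul_le_mul ht2 (hyn.trans ?_) (norm_nonneg _) (by positivity)
          have := mul_le_of_le_one_left hs.le (show t₀ ≤ 1 by linarith)
          linarith
        linarith
      have hzl : T.slack l z ≤ 5 * t₀ * h := by
        have h1 := T.slack_sub_le l z (c l)
        rw [hcs l] at h1
        linarith
      -- The projection of `z` to the hyperplane of `l` is within `10 * t₀ * h ≤ β * h` of `c l`, so
      -- the neighbour inequalities of `l` hold. It would be beyond the hyperplane of `i` unless
      -- `T.slack l z = 0`.
      have hwT : z + T.slack l z • T.normal l ∈ T.carrier := by
        refine T.mem_carrier_of_neighbours hd (hcs l) (hpos l) ?_ fun m hm => ?_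
        · rw [slack_add, inner_smul_right, real_inner_self_eq_norm_sq, T.norm_normal]
          ring
        · have h1 := hnb l m hm
          have h2 := T.slack_sub_le m (c l) (z + T.slack l z • T.normal l)
          have h3 : ‖c l - (z + T.slack l z • T.normal l)‖ ≤ 10 * t₀ * h := by
            rw [← sub_sub]
            refine (norm_sub_le _ _).trans ?_
            rw [norm_sub_rev, norm_smul, T.norm_normal, Real.norm_eq_abs, abs_of_nonneg hzl0]
            linarith
          have h4 := mul_le_mul_of_nonneg_right ht₀β hs.le
          linarith
      have h1 := T.mem_carrier_iff.1 hwT i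
      rw [slack_add, hzi, inner_smul_right] at h1
      change 0 ≤ 0 - T.slack l z * a at h1
      have h2 := mul_nonneg hzl0 ha0.le
      exact (mul_eq_zero.1 (show T.slack l z * a = 0 by linarith)).resolve_right ha0.ne'
    -- An affine function with two zeros on a line vanishes on it, so the slack of `l` would be zero
    -- at `c i`, against `hpos`.
    have k1 := key t₀ le_rfl (by linarith)
    have k2 := key (2 * t₀) (by linarith) le_rfl
    rw [slack_add_smul_sub] at k1 k2
    have k3 : T.slack l y = 0 := by linarith
    rw [k3, mul_zero, zero_add] at k1
    exact (mul_pos ht₀pos hli0).ne' k1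

end ConvexPolytope

end WeakGalerkin

namespace WeakGalerkin

/-! ### Algebra of gradients and test functions -/

section Algebra

variable {d : ℕ}

theorem ev_mul (p q : MvPolynomial (Fin d) ℝ) (x : Space d) : ev (p * q) x = ev p x * ev q x := by
  simp [ev]

theorem ev_sub (p q : MvPolynomial (Fin d) ℝ) (x : Space d) : ev (p - q) x = ev p x - ev q x := by
  simp [ev]

theorem ev_prod {ι : Type*} (S : Finset ι) (p : ι → MvPolynomial (Fin d) ℝ) (x : Space d) :
    ev (∏ l ∈ S, p l) x = ∏ l ∈ S, ev (p l) x := by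
  simp [ev, map_prod]

theorem grad_mul (p q : MvPolynomial (Fin d) ℝ) (x : Space d) :
    grad (p * q) x = ev p x • grad q x + ev q x • grad p x := by
  ext i
  simp [grad, ev]

/-- The reason for squaring the bubbles: the test function then loses its value and its normal
derivative on the chosen facets at once. -/
theorem grad_sq_mul_eq_zero {p : MvPolynomial (Fin d) ℝ} (q : MvPolynomial (Fin d) ℝ) {x : Space d}
    (h : ev p x = 0) : grad (p ^ 2 * q) x = 0 := by
  rw [pow_two, mul_assoc, grad_mul, ev_mul, h]
  simp

theorem totalDegree_pderiv_le (p : MvPolynomial (Fin d) ℝ) (i : Fin d) :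
    (MvPolynomial.pderiv i p).totalDegree ≤ p.totalDegree - 1 := by
  conv_lhs => rw [p.as_sum, map_sum]
  refine MvPolynomial.totalDegree_finsetSum_le fun s hs => ?_
  rw [MvPolynomial.pderiv_monomial]
  by_cases h0 : MvPolynomial.coeff s p * (s i : ℝ) = 0
  · rw [h0]; simp
  · have hsi : s i ≠ 0 := fun h => h0 (by rw [h]; simp)
    rw [MvPolynomial.totalDegree_monomial _ h0]
    have h1 : (s - Finsupp.single i 1) + Finsupp.single i 1 = s :=
      tsub_add_cancel_of_le (Finsupp.single_le_iff.2 (Nat.one_le_iff_ne_zero.2 hsi))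
    have h2 := MvPolynomial.le_totalDegree hs
    have h3 : (s.sum fun _ e => e) = ((s - Finsupp.single i 1).sum fun _ e => e) + 1 := by
      conv_lhs => rw [← h1]
      rw [Finsupp.sum_add_index' (fun _ => rfl) (fun _ _ _ => rfl), Finsupp.sum_single_index rfl]
    omega

theorem totalDegree_lap_le (p : MvPolynomial (Fin d) ℝ) :
    (lap p).totalDegree ≤ p.totalDegree - 2 := by
  refine MvPolynomial.totalDegree_finsetSum_le fun i _ => ?_
  have h1 := totalDegree_pderiv_le (MvPolynomial.pderiv i p) i
  have h2 := totalDegree_pderiv_le p i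
  omega

end Algebra

/-! ### Bubble functions and normal extensions -/

namespace ConvexPolytope

variable {d : ℕ} (T : ConvexPolytope d)

/-- The polynomial `slack i`. -/
def slackPoly (i : Fin T.numFacets) : MvPolynomial (Fin d) ℝ :=
  MvPolynomial.C (T.offset i) - ∑ j, MvPolynomial.C (T.normal i j) * MvPolynomial.X j

@[simp] theorem ev_slackPoly (i : Fin T.numFacets) (x : Space d) :
    ev (T.slackPoly i) x = T.slack i x := by
  simp [slackPoly, ev, slack, PiLp.inner_apply, mul_comm]

theorem totalDegree_slackPoly_le (i : Fin T.numFacets) : (T.slackPoly i).totalDegree ≤ 1 := by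
  refine (MvPolynomial.totalDegree_sub _ _).trans (max_le (by simp) ?_)
  refine MvPolynomial.totalDegree_finsetSum_le fun j _ => ?_
  refine (MvPolynomial.totalDegree_mul _ _).trans ?_
  simp

theorem grad_slackPoly (i : Fin T.numFacets) (x : Space d) :
    grad (T.slackPoly i) x = -T.normal i := by
  ext l
  simp [slackPoly, grad, ev, MvPolynomial.pderiv_X, Pi.single_apply]

/-- The product of the slacks of all facets in `S`. -/
def bubble (S : Finset (Fin T.numFacets)) : MvPolynomial (Fin d) ℝ := ∏ l ∈ S, T.slackPoly l

theorem ev_bubble (S : Finset (Fin T.numFacets)) (x : Space d) :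
    ev (T.bubble S) x = ∏ l ∈ S, T.slack l x := by
  simp [bubble, ev_prod]

theorem totalDegree_bubble_le (S : Finset (Fin T.numFacets)) :
    (T.bubble S).totalDegree ≤ S.card := by
  refine (MvPolynomial.totalDegree_finsetProd _ _).trans ?_
  refine (Finset.sum_le_sum fun l _ => T.totalDegree_slackPoly_le l).trans ?_
  simp

theorem totalDegree_bubble_sq_mul_le (S : Finset (Fin T.numFacets)) (q : MvPolynomial (Fin d) ℝ) :
    (T.bubble S ^ 2 * q).totalDegree ≤ 2 * S.card + q.totalDegree := by
  refine (MvPolynomial.totalDegree_mul _ _).trans (Nat.add_le_add_right ?_ _)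
  refine (MvPolynomial.totalDegree_pow _ _).trans ?_
  exact Nat.mul_le_mul_left 2 (T.totalDegree_bubble_le S)

theorem ev_bubble_eq_zero {S : Finset (Fin T.numFacets)} {l : Fin T.numFacets} (hl : l ∈ S)
    {x : Space d} (hx : x ∈ T.facet l) : ev (T.bubble S) x = 0 := by
  rw [ev_bubble]
  exact Finset.prod_eq_zero hl (T.mem_facet_iff.1 hx).2

theorem abs_bubble_le (S : Finset (Fin T.numFacets)) {x : Space d} {r : ℝ}
    (h : ∀ l, |T.slack l x| ≤ r) : |ev (T.bubble S) x| ≤ r ^ S.card := by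
  rw [ev_bubble, Finset.abs_prod, ← Finset.prod_const]
  exact Finset.prod_le_prod (fun l _ => abs_nonneg _) fun l _ => h l

/-- The extension of a polynomial from the hyperplane of a facet, constant in normal direction. -/
def extend (i : Fin T.numFacets) (q : MvPolynomial (Fin d) ℝ) : MvPolynomial (Fin d) ℝ :=
  pullback (T.offset i • T.normal i)
    (LinearMap.id - (innerSL ℝ (T.normal i)).toLinearMap.smulRight (T.normal i)) q

theorem ev_extend (i : Fin T.numFacets) (q : MvPolynomial (Fin d) ℝ) (x : Space d) :
    ev (T.extend i q) x = ev q (x + T.slack i x • T.normal i) := by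
  rw [extend, ev_pullback]
  congr 1
  simp [slack]
  module

theorem ev_extend_of_mem {i : Fin T.numFacets} (q : MvPolynomial (Fin d) ℝ) {x : Space d}
    (hx : x ∈ T.facet i) : ev (T.extend i q) x = ev q x := by
  rw [ev_extend, (T.mem_facet_iff.1 hx).2, zero_smul, add_zero]

theorem totalDegree_extend_le (i : Fin T.numFacets) (q : MvPolynomial (Fin d) ℝ) :
    (T.extend i q).totalDegree ≤ q.totalDegree := totalDegree_pullback_le _ _ _

theorem slack_projection (i : Fin T.numFacets) (x : Space d) :
    T.slack i (x + T.slack i x • T.normal i) = 0 := by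
  rw [slack_add, inner_smul_right, real_inner_self_eq_norm_sq, T.norm_normal]; ring

theorem norm_projection_sub_le {i : Fin T.numFacets} {x x₀ : Space d} (hx₀ : T.slack i x₀ = 0) :
    ‖x + T.slack i x • T.normal i - x₀‖ ≤ ‖x - x₀‖ := by
  have h1 : x + T.slack i x • T.normal i - x₀ =
      (x - x₀) - (inner ℝ (T.normal i) (x - x₀) : ℝ) • T.normal i := by
    have h2 := T.slack_add i x₀ (x - x₀)
    rw [add_sub_cancel, hx₀] at h2
    rw [h2]
    module
  refine abs_le_of_sq_le_sq' ?_ (norm_nonneg _) |>.2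
  rw [h1, norm_sub_sq_real, norm_smul, T.norm_normal, inner_smul_right, real_inner_comm,
    Real.norm_eq_abs, mul_one, sq_abs]
  nlinarith [sq_nonneg (inner ℝ (T.normal i) (x - x₀) : ℝ)]

/-- Controls the bubbles in a whole ball and not only in the cell, as the gradient estimate
requires. -/
theorem abs_slack_le {x x₀ : Space d} (hx₀ : x₀ ∈ T.carrier) (hx : ‖x - x₀‖ ≤ T.size)
    (l : Fin T.numFacets) : |T.slack l x| ≤ 2 * T.size := by
  have h1 := T.slack_sub_le l x x₀
  have h2 := T.slack_sub_le l x₀ x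
  rw [norm_sub_rev] at h2
  have h3 := T.slack_le_size (i := l) hx₀
  have h4 := T.mem_carrier_iff.1 hx₀ l
  have h5 := norm_nonneg (x - x₀)
  rw [abs_le]
  constructor <;> linarith

/-! ### Uniform bounds -/

/-- The inequalities for polynomials of degree at most `m` on a polytope, with a constant `K`. -/
structure Bounds (m n : ℕ) (K : ℝ) : Prop where
  one_le : 1 ≤ K
  size_pos : 0 < T.size
  numFacets_le : T.numFacets ≤ n
  -- The point `x` ranges over a ball that may leave the cell; `grad_le` takes its hypothesis on
  -- such a ball.
  cell_sup : ∀ q : MvPolynomial (Fin d) ℝ, q.totalDegree ≤ m → ∀ x₀ ∈ T.carrier, ∀ x,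
    ‖x - x₀‖ ≤ T.size → T.size ^ d * ev q x ^ 2 ≤ K * T.integral fun z => ev q z ^ 2
  cell_bubble : ∀ q : MvPolynomial (Fin d) ℝ, q.totalDegree ≤ m → ∀ x ∈ T.carrier,
    T.size ^ d * (T.size ^ T.numFacets) ^ 2 * ev q x ^ 2 ≤
      K * T.integral fun z => (ev (T.bubble Finset.univ) z * ev q z) ^ 2
  facet_bubble : ∀ i, ∀ q : MvPolynomial (Fin d) ℝ, q.totalDegree ≤ m → ∀ x₀ ∈ T.facet i, ∀ x,
    T.slack i x = 0 → ‖x - x₀‖ ≤ T.size →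
    T.size ^ (d - 1) * (T.size ^ (Finset.univ.erase i).card) ^ 2 * ev q x ^ 2 ≤
      K * T.facetIntegral i fun z => (ev (T.bubble (Finset.univ.erase i)) z * ev q z) ^ 2
  cell_le : ∀ (f : Space d → ℝ) (M : ℝ), Continuous f → 0 ≤ M → (∀ x ∈ T.carrier, f x ≤ M) →
    T.integral f ≤ K * T.size ^ d * M
  facet_le : ∀ i, ∀ (f : Space d → ℝ) (M : ℝ), Continuous f → 0 ≤ M → (∀ x ∈ T.facet i, f x ≤ M) →
    T.facetIntegral i f ≤ K * T.size ^ (d - 1) * M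
  grad_le : ∀ (q : MvPolynomial (Fin d) ℝ) (M : ℝ), q.totalDegree ≤ m → ∀ x₀ ∈ T.carrier,
    (∀ x, ‖x - x₀‖ ≤ T.size → |ev q x| ≤ M) → ∀ x, ‖x - x₀‖ ≤ T.size →
      T.size * ‖grad q x‖ ≤ K * M

theorem integral_eq (f : Space d → ℝ) :
    T.integral f = ∫ x in T.carrier, f x ∂μHE[d] := by
  rw [EuclideanSpace.euclideanHausdorffMeasure_eq_volume]; rfl

theorem setIntegral_le_of_le {d' : ℕ} {E : Set (Space d)} (hE : IsCompact E)
    (hfin : μHE[d'] E < ⊤) {f : Space d → ℝ} (hf : Continuous f) {M B : ℝ} (hM : 0 ≤ M)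
    (h : ∀ x ∈ E, f x ≤ M) (hB : (μHE[d'] E).toReal ≤ B) :
    ∫ x in E, f x ∂μHE[d'] ≤ B * M := by
  calc ∫ x in E, f x ∂μHE[d'] ≤ ∫ _ in E, M ∂μHE[d'] :=
        setIntegral_mono_on (Chart.continuous_integrableOn hE hfin hf)
          (integrableOn_const hfin.ne) hE.measurableSet h
    _ = (μHE[d'] E).toReal * M := by rw [setIntegral_const, smul_eq_mul]; rfl
    _ ≤ B * M := by gcongr

set_option maxHeartbeats 400000 in
theorem exists_bounds (hd : 2 ≤ d) (m n : ℕ) {ρ κ α₀ : ℝ} (hρ : 0 < ρ) (hκ : 0 < κ)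
    (hα₀ : 0 < α₀) : ∃ K : ℝ, 1 ≤ K ∧ ∀ T : ConvexPolytope d, T.ShapeRegular n ρ κ α₀ →
      T.Bounds m n K := by
  have hd1 : 1 ≤ d := by omega
  obtain ⟨a, ha, hcell⟩ := Chart.exists_weighted_lower d m n hρ
  have hθ : 0 < ρ * κ ^ (d - 1) := by positivity
  obtain ⟨a', ha', hfacet⟩ := Chart.exists_weighted_lower (d - 1) m n hθ
  obtain ⟨δ, hδ, hsep⟩ := exists_separation hd hρ hκ hα₀
  obtain ⟨C, hC, hgrad⟩ := Chart.exists_grad_bound d m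
  set V := (volume (Metric.closedBall (0 : Space d) 1)).toReal with hV
  set V' := (volume (Metric.closedBall (0 : Space (d - 1)) 1)).toReal with hV'
  have hV0 : 0 ≤ V := ENNReal.toReal_nonneg
  have hV'0 : 0 ≤ V' := ENNReal.toReal_nonneg
  -- With `δ₁ ≤ 1`, the exponent `n` covers every actual number of factors.
  set δ₁ := min δ 1 with hδ₁
  have hδ₁0 : 0 < δ₁ := lt_min hδ one_pos
  have hδ₁1 : δ₁ ≤ 1 := min_le_right _ _
  have hk1 : 0 < 1 / a := by positivity
  have hk2 : 0 < 1 / (a' * (δ₁ ^ n) ^ 2) := by positivity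
  set K := 1 + 1 / a + 1 / (a' * (δ₁ ^ n) ^ 2) + V + V' + C with hK
  have hKa : 1 / a ≤ K := by linarith
  have hKa' : 1 / (a' * (δ₁ ^ n) ^ 2) ≤ K := by linarith
  have hKV : V ≤ K := by linarith
  have hKV' : V' ≤ K := by linarith
  have hKC : C ≤ K := by linarith
  have hK1 : 1 ≤ K := by linarith
  refine ⟨K, hK1, fun T hT => ?_⟩
  have hs := T.size_pos hd1
  have hn := hT.numFacets_le
  have hcard : ∀ S : Finset (Fin T.numFacets), S.card ≤ n := fun S =>
    (Finset.card_le_univ S).trans (by simpa using hn)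
  have hcellfin : ∀ x₀ ∈ T.carrier, μHE[d] T.carrier < ⊤ ∧
      (μHE[d] T.carrier).toReal ≤ T.size ^ d * V := fun x₀ hx₀ =>
    ⟨(T.cellChart hd1 x₀).measure_lt_top (T.carrier_subset_disc hx₀),
      (T.cellChart hd1 x₀).measure_le (T.carrier_subset_disc hx₀)⟩
  have hfch : ∀ i, ∀ x₀ ∈ T.facet i, ∃ c : Chart (d - 1) d, c.scale = T.size ∧
      T.facet i ⊆ c.disc ∧ ∀ x, x ∈ c.disc ↔ T.slack i x = 0 ∧ ‖x - x₀‖ ≤ T.size := by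
    intro i x₀ hx₀
    obtain ⟨c, -, hc1, hc2⟩ := T.exists_facetChart hd1 (T.mem_facet_iff.1 hx₀).2
    exact ⟨c, hc1, fun x hx => (hc2 x).2 ⟨(T.mem_facet_iff.1 hx).2,
      T.norm_sub_le_size hx.1 hx₀.1⟩, hc2⟩
  refine ⟨hK1, hs, hn, ?_, ?_, ?_, ?_, ?_, ?_⟩
  · intro q hq x₀ hx₀ x hx
    -- The empty product gives the unweighted integral; with `β = 0` the factor `β ^ 0` is 1.
    have h1 := hcell d (T.cellChart hd1 x₀) T.carrier (T.carrier_subset_disc hx₀)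
      T.isCompact_carrier hT.cell_measure_ge T.numFacets ∅ T.slackPoly 0 le_rfl (by simp)
      (by simp) (by simp) q hq x (T.mem_cellChart_disc.2 hx)
    simp only [Finset.card_empty, pow_zero, one_pow, mul_one, Finset.prod_empty, one_mul] at h1
    rw [← T.integral_eq] at h1
    change a * T.size ^ d * ev q x ^ 2 ≤ _ at h1
    have h0 : 0 ≤ T.integral fun z => ev q z ^ 2 := integral_nonneg fun z => sq_nonneg _
    calc T.size ^ d * ev q x ^ 2 = 1 / a * (a * T.size ^ d * ev q x ^ 2) := by field_simp
      _ ≤ 1 / a * T.integral fun z => ev q z ^ 2 := by gcongr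
      _ ≤ K * T.integral fun z => ev q z ^ 2 := by gcongr
  · intro q hq x hx
    have h1 := hcell d (T.cellChart hd1 x) T.carrier (T.carrier_subset_disc hx)
      T.isCompact_carrier hT.cell_measure_ge T.numFacets Finset.univ T.slackPoly T.size hs.le
      (hcard _) (fun l _ => T.totalDegree_slackPoly_le l)
      -- Each factor of the full bubble reaches `T.size` in the ball around the cell, one step
      -- inwards from `x`; the angles play no role here.
      (fun l _ => ⟨x + (-T.size) • T.normal l, T.mem_cellChart_disc.2 (by
          rw [add_sub_cancel_left, norm_smul, T.norm_normal, mul_one, norm_neg, Real.norm_eq_abs,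
            abs_of_pos hs]), by
        rw [ev_slackPoly, slack_add, inner_smul_right, real_inner_self_eq_norm_sq, T.norm_normal]
        have h3 := T.mem_carrier_iff.1 hx l
        rw [abs_of_nonneg (by linarith)]
        linarith⟩) q hq x (T.carrier_subset_disc hx hx)
    rw [← T.integral_eq, Finset.card_univ, Fintype.card_fin] at h1
    simp only [← ev_prod] at h1
    change a * T.size ^ d * (T.size ^ T.numFacets) ^ 2 * ev q x ^ 2 ≤
      T.integral fun z => (ev (T.bubble Finset.univ) z * ev q z) ^ 2 at h1
    have h0 : 0 ≤ T.integral fun z => (ev (T.bubble Finset.univ) z * ev q z) ^ 2 :=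
      integral_nonneg fun z => sq_nonneg _
    calc T.size ^ d * (T.size ^ T.numFacets) ^ 2 * ev q x ^ 2
        = 1 / a * (a * T.size ^ d * (T.size ^ T.numFacets) ^ 2 * ev q x ^ 2) := by field_simp
      _ ≤ 1 / a * T.integral fun z => (ev (T.bubble Finset.univ) z * ev q z) ^ 2 := by gcongr
      _ ≤ K * T.integral fun z => (ev (T.bubble Finset.univ) z * ev q z) ^ 2 := by gcongr
  · intro i q hq x₀ hx₀ x hxi hx
    obtain ⟨c, hc1, hc2, hc3⟩ := hfch i x₀ hx₀
    -- On a facet the weight is seen only within the hyperplane, where the other slacks are of order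
    -- `T.size` by the separation of facets.
    obtain ⟨z, hz, hzl⟩ := hsep T n hT i
    have h1 := hfacet d c (T.facet i) hc2 (T.isCompact_facet i)
      (hc1 ▸ hT.facet_measure_ge hd1 hρ hκ i) T.numFacets (Finset.univ.erase i) T.slackPoly
      (δ₁ * T.size) (by positivity) (hcard _) (fun l _ => T.totalDegree_slackPoly_le l)
      (fun l hl => ⟨z, hc2 hz, by
        rw [ev_slackPoly]
        refine le_trans ?_ (le_abs_self _)
        refine le_trans ?_ (hzl l (Finset.ne_of_mem_erase hl))
        exact mul_le_mul_of_nonneg_right (min_le_left _ _) hs.le⟩) q hq x ((hc3 x).2 ⟨hxi, hx⟩)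
    simp only [← ev_prod, hc1] at h1
    set r := (Finset.univ.erase i).card with hr
    change a' * T.size ^ (d - 1) * ((δ₁ * T.size) ^ r) ^ 2 * ev q x ^ 2 ≤
      T.facetIntegral i fun z => (ev (T.bubble (Finset.univ.erase i)) z * ev q z) ^ 2 at h1
    set X := T.facetIntegral i fun z => (ev (T.bubble (Finset.univ.erase i)) z * ev q z) ^ 2
      with hX
    have h0 : 0 ≤ X := integral_nonneg fun z => sq_nonneg _
    have hδr : δ₁ ^ n ≤ δ₁ ^ r := pow_le_pow_of_le_one hδ₁0.le hδ₁1 (hcard _)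
    calc T.size ^ (d - 1) * (T.size ^ r) ^ 2 * ev q x ^ 2
        = 1 / (a' * (δ₁ ^ n) ^ 2) *
          (a' * T.size ^ (d - 1) * ((δ₁ ^ n) * T.size ^ r) ^ 2 * ev q x ^ 2) := by
          field_simp
      _ ≤ 1 / (a' * (δ₁ ^ n) ^ 2) *
          (a' * T.size ^ (d - 1) * ((δ₁ ^ r) * T.size ^ r) ^ 2 * ev q x ^ 2) := by gcongr
      _ = 1 / (a' * (δ₁ ^ n) ^ 2) *
          (a' * T.size ^ (d - 1) * ((δ₁ * T.size) ^ r) ^ 2 * ev q x ^ 2) := by rw [mul_pow δ₁]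
      _ ≤ 1 / (a' * (δ₁ ^ n) ^ 2) * X := by gcongr
      _ ≤ K * X := by gcongr
  · intro f M hf hM h
    obtain ⟨x₀, hx₀⟩ : T.carrier.Nonempty := T.nonempty_interior.mono interior_subset
    rw [T.integral_eq]
    refine setIntegral_le_of_le T.isCompact_carrier (hcellfin x₀ hx₀).1 hf hM h
      ((hcellfin x₀ hx₀).2.trans ?_)
    rw [mul_comm]
    gcongr
  · intro i f M hf hM h
    obtain ⟨x₀, hx₀⟩ := T.facet_nonempty i
    obtain ⟨c, hc1, hc2, -⟩ := hfch i x₀ hx₀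
    refine setIntegral_le_of_le (T.isCompact_facet i) (c.measure_lt_top hc2) hf hM h
      ((c.measure_le hc2).trans ?_)
    rw [hc1, mul_comm]
    gcongr
  · intro q M hq x₀ hx₀ h x hx
    have hM : 0 ≤ M := (abs_nonneg _).trans (h x hx)
    have h1 := hgrad (T.cellChart hd1 x₀) q M hq (fun y hy => h y (T.mem_cellChart_disc.1 hy)) x
      (T.mem_cellChart_disc.2 hx)
    change _ ≤ C * M / T.size at h1
    rw [le_div_iff₀ hs, mul_comm] at h1
    exact h1.trans (mul_le_mul_of_nonneg_right hKC hM)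

end ConvexPolytope

end WeakGalerkin

namespace WeakGalerkin

namespace ConvexPolytope

variable {d : ℕ} {T : ConvexPolytope d}

/-! ### Estimates on a cell -/

/-- The quadratic polynomial t ↦ ∫ (f - t g)² is nonnegative, so its discriminant is not positive.
-/
theorem sq_integral_mul_le {X : Type*} [MeasurableSpace X] {μ : Measure X} {f g : X → ℝ}
    (hf : Integrable (fun x => f x ^ 2) μ) (hg : Integrable (fun x => g x ^ 2) μ)
    (hfg : Integrable (fun x => f x * g x) μ) :
    (∫ x, f x * g x ∂μ) ^ 2 ≤ (∫ x, f x ^ 2 ∂μ) * ∫ x, g x ^ 2 ∂μ := by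
  have key : ∀ t : ℝ, 0 ≤ (∫ x, g x ^ 2 ∂μ) * (t * t) + (-2 * ∫ x, f x * g x ∂μ) * t +
      ∫ x, f x ^ 2 ∂μ := by
    intro t
    have h1 : ∫ x, ((t * t) * g x ^ 2 + (-2 * t) * (f x * g x) + f x ^ 2) ∂μ =
        (t * t) * (∫ x, g x ^ 2 ∂μ) + (-2 * t) * (∫ x, f x * g x ∂μ) + ∫ x, f x ^ 2 ∂μ := by
      have i1 : Integrable (fun x => (t * t) * g x ^ 2 + (-2 * t) * (f x * g x)) μ :=
        (hg.const_mul _).add (hfg.const_mul _)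
      rw [integral_add i1 hf,
        integral_add (hg.const_mul _) (hfg.const_mul _), integral_const_mul, integral_const_mul]
    have h2 : 0 ≤ ∫ x, ((t * t) * g x ^ 2 + (-2 * t) * (f x * g x) + f x ^ 2) ∂μ := by
      refine integral_nonneg fun x => ?_
      have : (t * t) * g x ^ 2 + (-2 * t) * (f x * g x) + f x ^ 2 = (f x - t * g x) ^ 2 := by ring
      simp only [Pi.zero_apply, this]
      exact sq_nonneg _
    linarith
  have := discrim_le_zero key
  rw [discrim] at this
  linarith

theorem sq_cellIntegral_mul_le {f g : Space d → ℝ} (hf : Continuous f) (hg : Continuous g) :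
    T.integral (fun x => f x * g x) ^ 2 ≤
      T.integral (fun x => f x ^ 2) * T.integral (fun x => g x ^ 2) :=
  sq_integral_mul_le (T.integrableOn (hf.pow 2)) (T.integrableOn (hg.pow 2))
    (T.integrableOn (hf.mul hg))

theorem sq_facetIntegral_mul_le (i : Fin T.numFacets) {f g : Space d → ℝ} (hf : Continuous f)
    (hg : Continuous g) : T.facetIntegral i (fun x => f x * g x) ^ 2 ≤
      T.facetIntegral i (fun x => f x ^ 2) * T.facetIntegral i (fun x => g x ^ 2) :=
  sq_integral_mul_le (T.integrableOn_facet i (hf.pow 2)) (T.integrableOn_facet i (hg.pow 2))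
    (T.integrableOn_facet i (hf.mul hg))

theorem facetIntegral_congr {i : Fin T.numFacets} {f g : Space d → ℝ}
    (h : ∀ x ∈ T.facet i, f x = g x) : T.facetIntegral i f = T.facetIntegral i g :=
  setIntegral_congr_fun (T.isCompact_facet i).measurableSet h

theorem facetIntegral_eq_zero {i : Fin T.numFacets} {f : Space d → ℝ}
    (h : ∀ x ∈ T.facet i, f x = 0) : T.facetIntegral i f = 0 := by
  rw [facetIntegral_congr h]
  simp [facetIntegral]

theorem integral_sq_nonneg (f : Space d → ℝ) : 0 ≤ T.integral fun x => f x ^ 2 :=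
  integral_nonneg fun _ => sq_nonneg _

theorem facetIntegral_sq_nonneg (i : Fin T.numFacets) (f : Space d → ℝ) :
    0 ≤ T.facetIntegral i fun x => f x ^ 2 :=
  integral_nonneg fun _ => sq_nonneg _

/-- Testing yields bounds in which the quantity sought occurs squared on the left and once on the
right; this cancels one factor. -/
theorem le_of_sq_le_mul {X c : ℝ} (hX : 0 ≤ X) (hc : 0 ≤ c) (h : X ^ 2 ≤ c * X) : X ≤ c := by
  rcases hX.eq_or_lt with h0 | h0
  · rwa [← h0]
  · rw [pow_two] at h
    exact le_of_mul_le_mul_right h h0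

/-- The identity satisfied by a weak Laplacian after integration by parts: `w` is the weak
Laplacian, `L` the Laplacian of the interior component, `a` and `g` are the jumps of the values
and of the normal derivatives. -/
def WeakIdentity (T : ConvexPolytope d) (j : ℕ) (w L : MvPolynomial (Fin d) ℝ)
    (a g : Fin T.numFacets → MvPolynomial (Fin d) ℝ) : Prop :=
  ∀ φ : MvPolynomial (Fin d) ℝ, φ.totalDegree ≤ j →
    T.integral (fun x => ev w x * ev φ x) = T.integral (fun x => ev L x * ev φ x)
      + ∑ i, T.facetIntegral i (fun x => ev (a i) x * inner ℝ (grad φ x) (T.normal i))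
      - ∑ i, T.facetIntegral i (fun x => ev (g i) x * ev φ x)

variable {m n j : ℕ} {K : ℝ} {w L : MvPolynomial (Fin d) ℝ}
  {a g : Fin T.numFacets → MvPolynomial (Fin d) ℝ}

/-- The test function P² L, with P the full bubble, has zero value and gradient on the boundary, so
the weak identity reduces to (w, P² L) = ‖P L‖². As |P| is at most `T.size ^ T.numFacets` on the
cell, Cauchy-Schwarz bounds ‖P L‖, and `cell_bubble` removes the weight. -/
theorem Bounds.interior_le (B : T.Bounds m n K) (hid : T.WeakIdentity j w L a g)
    (hLm : L.totalDegree ≤ m) (hLj : 2 * T.numFacets + L.totalDegree ≤ j) :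
    T.integral (fun x => ev L x ^ 2) ≤ K ^ 2 * T.integral (fun x => ev w x ^ 2) := by
  have hs := B.size_pos
  have hK := B.one_le
  set W := T.integral (fun x => ev w x ^ 2) with hW
  have hW0 : 0 ≤ W := integral_sq_nonneg _
  let P := T.bubble Finset.univ
  let φ := P ^ 2 * L
  have hφj : φ.totalDegree ≤ j := by
    refine (T.totalDegree_bubble_sq_mul_le _ _).trans ?_
    simpa using hLj
  have hφev : ∀ x, ev φ x = ev P x ^ 2 * ev L x := fun x => by
    simp only [φ, pow_two, ev_mul]
  have h1 := hid φ hφj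
  have hz : ∀ i, ∀ x ∈ T.facet i, ev P x = 0 := fun i x hx =>
    T.ev_bubble_eq_zero (Finset.mem_univ i) hx
  rw [Finset.sum_eq_zero fun i _ => facetIntegral_eq_zero fun x hx => by
      rw [grad_sq_mul_eq_zero L (hz i x hx), inner_zero_left, mul_zero],
    Finset.sum_eq_zero fun i _ => facetIntegral_eq_zero fun x hx => by
      rw [hφev, hz i x hx]; ring, add_zero, sub_zero] at h1
  set X := T.integral (fun x => (ev P x * ev L x) ^ 2) with hX
  have hX0 : 0 ≤ X := integral_sq_nonneg _
  have h2 : T.integral (fun x => ev L x * ev φ x) = X := by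
    congr 1; funext x; rw [hφev]; ring
  rw [h2] at h1
  have h3 := sq_cellIntegral_mul_le (T := T) (continuous_ev w) (continuous_ev φ)
  rw [h1] at h3
  have h4 : T.integral (fun x => ev φ x ^ 2) ≤ (T.size ^ T.numFacets) ^ 2 * X := by
    rw [hX, integral, integral, ← integral_const_mul]
    refine setIntegral_mono_on (T.integrableOn ((continuous_ev φ).pow 2)) ?_
      T.isCompact_carrier.measurableSet fun x hx => ?_
    · exact (T.integrableOn (((continuous_ev P).mul (continuous_ev L)).pow 2)).const_mul _
    · have h5 : |ev P x| ≤ T.size ^ (Finset.univ : Finset (Fin T.numFacets)).card :=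
        T.abs_bubble_le _ fun l => by
          rw [abs_of_nonneg (T.mem_carrier_iff.1 hx l)]
          exact T.slack_le_size hx
      rw [Finset.card_univ, Fintype.card_fin] at h5
      have h6 : ev φ x ^ 2 = ev P x ^ 2 * (ev P x * ev L x) ^ 2 := by rw [hφev]; ring
      rw [h6]
      refine mul_le_mul_of_nonneg_right ?_ (sq_nonneg _)
      exact sq_le_sq' (by linarith [(abs_le.1 h5).1]) (abs_le.1 h5).2
  have h5 : X ≤ W * (T.size ^ T.numFacets) ^ 2 := by
    refine le_of_sq_le_mul hX0 (by positivity) ?_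
    calc X ^ 2 ≤ W * T.integral (fun x => ev φ x ^ 2) := h3
      _ ≤ W * ((T.size ^ T.numFacets) ^ 2 * X) := by gcongr
      _ = W * (T.size ^ T.numFacets) ^ 2 * X := by ring
  have h6 : ∀ x ∈ T.carrier, ev L x ^ 2 ≤ K * W / T.size ^ d := by
    intro x hx
    rw [le_div_iff₀ (by positivity)]
    have h7 := B.cell_bubble L hLm x hx
    have h8 : (T.size ^ T.numFacets) ^ 2 * (ev L x ^ 2 * T.size ^ d) ≤
        (T.size ^ T.numFacets) ^ 2 * (K * W) := by
      calc _ = T.size ^ d * (T.size ^ T.numFacets) ^ 2 * ev L x ^ 2 := by ring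
        _ ≤ K * X := h7
        _ ≤ K * (W * (T.size ^ T.numFacets) ^ 2) := by gcongr
        _ = _ := by ring
    exact le_of_mul_le_mul_left h8 (by positivity)
  refine (B.cell_le _ (K * W / T.size ^ d) ((continuous_ev L).pow 2) (by positivity) h6).trans
    (le_of_eq ?_)
  field_simp

/-- The pointwise size of the test functions concentrated at a facet. -/
theorem Bounds.testFunction_le (B : T.Bounds m n K) (i : Fin T.numFacets)
    {q : MvPolynomial (Fin d) ℝ} (hq : q.totalDegree ≤ m) {x₀ x : Space d} (hx₀ : x₀ ∈ T.facet i)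
    (hx : ‖x - x₀‖ ≤ T.size) :
    T.size ^ (d - 1) * ev (T.bubble (Finset.univ.erase i) ^ 2 * T.extend i q) x ^ 2 ≤
      16 ^ n * K * (T.size ^ (Finset.univ.erase i).card) ^ 2 *
        T.facetIntegral i fun z => (ev (T.bubble (Finset.univ.erase i)) z * ev q z) ^ 2 := by
  have hs := B.size_pos
  have hK := B.one_le
  set S := Finset.univ.erase i with hS
  set X := T.facetIntegral i fun z => (ev (T.bubble S) z * ev q z) ^ 2 with hX
  have hX0 : 0 ≤ X := facetIntegral_sq_nonneg _ _
  have h1 := B.facet_bubble i q hq x₀ hx₀ (x + T.slack i x • T.normal i)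
    (T.slack_projection i x)
    ((T.norm_projection_sub_le (T.mem_facet_iff.1 hx₀).2).trans hx)
  rw [← ev_extend] at h1
  have h2 : |ev (T.bubble S) x| ≤ (2 * T.size) ^ S.card :=
    T.abs_bubble_le S fun l => T.abs_slack_le hx₀.1 hx l
  have h3 : ev (T.bubble S) x ^ 4 ≤ 16 ^ n * (T.size ^ S.card) ^ 4 := by
    calc ev (T.bubble S) x ^ 4 = |ev (T.bubble S) x| ^ 4 := (Even.pow_abs (by decide) _).symm
      _ ≤ ((2 * T.size) ^ S.card) ^ 4 := by gcongr
      _ = 16 ^ S.card * (T.size ^ S.card) ^ 4 := by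
        rw [mul_pow, mul_pow, ← pow_mul 2, mul_comm S.card 4, pow_mul]; norm_num
      _ ≤ 16 ^ n * (T.size ^ S.card) ^ 4 := by
        have : S.card ≤ n := (Finset.card_le_univ S).trans (by simpa using B.numFacets_le)
        gcongr
        norm_num
  calc T.size ^ (d - 1) * ev (T.bubble S ^ 2 * T.extend i q) x ^ 2
      = ev (T.bubble S) x ^ 4 * (T.size ^ (d - 1) * ev (T.extend i q) x ^ 2) := by
        rw [pow_two (T.bubble S), ev_mul, ev_mul]; ring
    _ ≤ 16 ^ n * (T.size ^ S.card) ^ 4 * (T.size ^ (d - 1) * ev (T.extend i q) x ^ 2) := by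
        gcongr
    _ = 16 ^ n * (T.size ^ S.card) ^ 2 *
        (T.size ^ (d - 1) * (T.size ^ S.card) ^ 2 * ev (T.extend i q) x ^ 2) := by ring
    _ ≤ 16 ^ n * (T.size ^ S.card) ^ 2 * (K * X) := by gcongr
    _ = _ := by ring

/-- Passing from the weighted to the full norm on a facet. -/
theorem Bounds.facet_le_of_weighted (B : T.Bounds m n K) (i : Fin T.numFacets)
    {q : MvPolynomial (Fin d) ℝ} (hq : q.totalDegree ≤ m) {c : ℝ} (hc : 0 ≤ c)
    (h : T.facetIntegral i (fun z => (ev (T.bubble (Finset.univ.erase i)) z * ev q z) ^ 2) ≤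
      c * (T.size ^ (Finset.univ.erase i).card) ^ 2) :
    T.facetIntegral i (fun x => ev q x ^ 2) ≤ K ^ 2 * c := by
  have hs := B.size_pos
  have hK := B.one_le
  set r := (Finset.univ.erase i).card with hr
  have h6 : ∀ x ∈ T.facet i, ev q x ^ 2 ≤ K * c / T.size ^ (d - 1) := by
    intro x hx
    rw [le_div_iff₀ (by positivity)]
    have h7 := B.facet_bubble i q hq x hx x (T.mem_facet_iff.1 hx).2 (by simpa using hs.le)
    have h8 : (T.size ^ r) ^ 2 * (ev q x ^ 2 * T.size ^ (d - 1)) ≤ (T.size ^ r) ^ 2 * (K * c) := by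
      calc _ = T.size ^ (d - 1) * (T.size ^ r) ^ 2 * ev q x ^ 2 := by ring
        _ ≤ _ := h7
        _ ≤ K * (c * (T.size ^ r) ^ 2) := by gcongr
        _ = _ := by ring
    exact le_of_mul_le_mul_left h8 (by positivity)
  refine (B.facet_le i _ (K * c / T.size ^ (d - 1)) ((continuous_ev q).pow 2) (by positivity)
    h6).trans (le_of_eq ?_)
  field_simp

/-- Both jump estimates move the two cell integrals of the weak identity to one side, where `L - w`
is what remains. -/
theorem Bounds.residual_le (B : T.Bounds m n K) (hid : T.WeakIdentity j w L a g)
    (hLm : L.totalDegree ≤ m) (hLj : 2 * T.numFacets + L.totalDegree ≤ j) :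
    T.integral (fun x => (ev L x - ev w x) ^ 2) ≤
      4 * K ^ 2 * T.integral (fun x => ev w x ^ 2) := by
  have h1 := B.interior_le hid hLm hLj
  have hK := B.one_le
  set W := T.integral (fun x => ev w x ^ 2) with hW
  have hW0 : 0 ≤ W := integral_sq_nonneg _
  have i1 : IntegrableOn (fun x => 2 * ev L x ^ 2) T.carrier :=
    (T.integrableOn ((continuous_ev L).pow 2)).const_mul 2
  have i2 : IntegrableOn (fun x => 2 * ev w x ^ 2) T.carrier :=
    (T.integrableOn ((continuous_ev w).pow 2)).const_mul 2
  have h2 : T.integral (fun x => (ev L x - ev w x) ^ 2) ≤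
      2 * T.integral (fun x => ev L x ^ 2) + 2 * W := by
    rw [hW, integral, integral, integral, ← integral_const_mul, ← integral_const_mul,
      ← integral_add i1 i2]
    refine setIntegral_mono_on (T.integrableOn (((continuous_ev L).sub (continuous_ev w)).pow 2))
      (i1.add i2) T.isCompact_carrier.measurableSet fun x _ => ?_
    nlinarith [sq_nonneg (ev L x + ev w x)]
  have h3 : W ≤ K ^ 2 * W := le_mul_of_one_le_left hW0 (one_le_pow₀ hK)
  linarith

theorem integral_sub_mul (T : ConvexPolytope d) (L w φ : MvPolynomial (Fin d) ℝ) :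
    T.integral (fun x => (ev L x - ev w x) * ev φ x) =
      T.integral (fun x => ev L x * ev φ x) - T.integral (fun x => ev w x * ev φ x) := by
  have h : ∀ p : MvPolynomial (Fin d) ℝ, IntegrableOn (fun x => ev p x * ev φ x) T.carrier :=
    fun p => T.integrableOn ((continuous_ev p).mul (continuous_ev φ))
  simp only [integral, sub_mul]
  exact integral_sub (h L) (h w)

/-- The test function is λᵢ Bᵢ² E aᵢ. The factor λᵢ removes its values on the facet i, and Bᵢ²
removes values and gradients on the others, so of all boundary terms only the normal derivative on
the facet i survives. The degree is 2(N_T - 1) + 1 plus that of aᵢ, with N_T the number of facets.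
-/
theorem Bounds.value_jump_le (hd : 1 ≤ d) (B : T.Bounds m n K) (hid : T.WeakIdentity j w L a g)
    (hLm : L.totalDegree ≤ m) (hLj : 2 * T.numFacets + L.totalDegree ≤ j) (i : Fin T.numFacets)
    (ham : (a i).totalDegree ≤ m) (haj : 2 * T.numFacets - 1 + (a i).totalDegree ≤ j) :
    T.facetIntegral i (fun x => ev (a i) x ^ 2) ≤
      4 * K ^ 6 * 16 ^ n * T.size ^ 3 * T.integral (fun x => ev w x ^ 2) := by
  have hs := B.size_pos
  have hK := B.one_le
  have hres := B.residual_le hid hLm hLj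
  set W := T.integral (fun x => ev w x ^ 2) with hW
  have hW0 : 0 ≤ W := integral_sq_nonneg _
  set S := Finset.univ.erase i with hS
  have hcard : S.card + 1 = T.numFacets := by
    rw [hS, Finset.card_erase_add_one (Finset.mem_univ i)]; simp
  set q := T.extend i (a i) with hq
  set ψ := T.bubble S ^ 2 * q with hψ
  set φ := T.slackPoly i * ψ with hφ
  set X := T.facetIntegral i (fun z => (ev (T.bubble S) z * ev (a i) z) ^ 2) with hX
  have hX0 : 0 ≤ X := facetIntegral_sq_nonneg _ _
  have hφj : φ.totalDegree ≤ j := by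
    have h1 := MvPolynomial.totalDegree_mul (T.slackPoly i) ψ
    have h2 := T.totalDegree_slackPoly_le i
    have h3 := T.totalDegree_bubble_sq_mul_le S q
    have h4 := T.totalDegree_extend_le i (a i)
    rw [← hφ] at h1
    rw [← hψ] at h3
    rw [← hq] at h4
    omega
  have hφ' : φ = T.bubble S ^ 2 * (T.slackPoly i * q) := by rw [hφ, hψ]; ring
  have hbz : ∀ l, l ≠ i → ∀ x ∈ T.facet l, ev (T.bubble S) x = 0 := fun l hl x hx =>
    T.ev_bubble_eq_zero (Finset.mem_erase.2 ⟨hl, Finset.mem_univ l⟩) hx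
  have hsz : ∀ x ∈ T.facet i, ev (T.slackPoly i) x = 0 := fun x hx => by
    rw [ev_slackPoly]; exact (T.mem_facet_iff.1 hx).2
  have h1 := hid φ hφj
  rw [Finset.sum_eq_single i
      (fun l _ hl => facetIntegral_eq_zero fun x hx => by
        rw [hφ', grad_sq_mul_eq_zero _ (hbz l hl x hx), inner_zero_left, mul_zero])
      (fun h => absurd (Finset.mem_univ i) h),
    Finset.sum_eq_zero fun l _ => facetIntegral_eq_zero fun x hx => by
      by_cases hl : l = i
      · subst hl
        rw [hφ, ev_mul, hsz x hx]; ring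
      · rw [hφ', pow_two, mul_assoc, ev_mul, hbz l hl x hx]; ring, sub_zero] at h1
  have h2 : T.facetIntegral i (fun x => ev (a i) x * inner ℝ (grad φ x) (T.normal i)) = -X := by
    rw [hX, facetIntegral, facetIntegral, ← integral_neg]
    refine setIntegral_congr_fun (T.isCompact_facet i).measurableSet fun x hx => ?_
    -- On the facet `i` the product rule leaves only the gradient of the slack, the inward normal,
    -- times `ψ`.
    have h3 : grad φ x = -(ev ψ x • T.normal i) := by
      rw [hφ, grad_mul, hsz x hx, grad_slackPoly]; simp
    simp only [h3]
    rw [inner_neg_left, inner_smul_left, real_inner_self_eq_norm_sq, T.norm_normal, hψ,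
      pow_two (T.bubble S), ev_mul, ev_mul, hq, T.ev_extend_of_mem _ hx]
    simp
    ring
  have h3 : X = T.integral (fun x => (ev L x - ev w x) * ev φ x) := by
    rw [integral_sub_mul, h1, h2]; ring
  have h4 := sq_cellIntegral_mul_le (T := T) ((continuous_ev L).sub (continuous_ev w))
    (continuous_ev φ)
  have h4' : X ^ 2 ≤ T.integral (fun x => (ev L x - ev w x) ^ 2) *
      T.integral (fun x => ev φ x ^ 2) := by rw [h3]; exact h4
  obtain ⟨x₀, hx₀⟩ := T.facet_nonempty i
  have hpow : T.size ^ d = T.size * T.size ^ (d - 1) := by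
    rw [← pow_succ']; congr 1; omega
  have h5 : T.integral (fun x => ev φ x ^ 2) ≤
      K ^ 2 * 16 ^ n * T.size ^ 3 * (T.size ^ S.card) ^ 2 * X := by
    refine (B.cell_le (fun x => ev φ x ^ 2) (T.size ^ 2 * (16 ^ n * K * (T.size ^ S.card) ^ 2 * X) /
      T.size ^ (d - 1)) ((continuous_ev φ).pow 2) (by positivity) fun x hx => ?_).trans
      (le_of_eq ?_)
    · rw [le_div_iff₀ (by positivity), hφ, ev_mul, ev_slackPoly, mul_pow]
      have h6 := B.testFunction_le i ham hx₀ (T.norm_sub_le_size hx hx₀.1)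
      have h7 : T.slack i x ^ 2 ≤ T.size ^ 2 :=
        pow_le_pow_left₀ (T.mem_carrier_iff.1 hx i) (T.slack_le_size hx) 2
      calc T.slack i x ^ 2 * ev ψ x ^ 2 * T.size ^ (d - 1)
          = T.slack i x ^ 2 * (T.size ^ (d - 1) * ev ψ x ^ 2) := by ring
        _ ≤ T.size ^ 2 * (16 ^ n * K * (T.size ^ S.card) ^ 2 * X) :=
          mul_le_mul h7 h6 (by positivity) (by positivity)
    · rw [hpow]
      field_simp
  have h6 : X ≤ (4 * K ^ 4 * 16 ^ n * T.size ^ 3 * W) * (T.size ^ S.card) ^ 2 := by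
    refine le_of_sq_le_mul hX0 (by positivity) ?_
    calc X ^ 2 ≤ _ := h4'
      _ ≤ (4 * K ^ 2 * W) * (K ^ 2 * 16 ^ n * T.size ^ 3 * (T.size ^ S.card) ^ 2 * X) :=
        mul_le_mul hres h5 (integral_sq_nonneg _) (by positivity)
      _ = _ := by ring
  refine (B.facet_le_of_weighted i ham (by positivity) h6).trans (le_of_eq ?_)
  ring

/-- The test function Bᵢ² E gᵢ produces the weighted norm of gᵢ, but its normal derivative on the
facet i does not vanish. The resulting term is absorbed by the bound for aᵢ and an inverse estimate
for the gradient. -/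
theorem Bounds.derivative_jump_le (hd : 1 ≤ d) (B : T.Bounds m n K)
    (hid : T.WeakIdentity j w L a g) (hLm : L.totalDegree ≤ m)
    (hLj : 2 * T.numFacets + L.totalDegree ≤ j) (i : Fin T.numFacets)
    (ham : (a i).totalDegree ≤ m) (haj : 2 * T.numFacets - 1 + (a i).totalDegree ≤ j)
    (hjm : j ≤ m)
    (hgm : (g i).totalDegree ≤ m) (hgj : 2 * (T.numFacets - 1) + (g i).totalDegree ≤ j) :
    T.facetIntegral i (fun x => ev (g i) x ^ 2) ≤
      16 * K ^ 12 * (16 ^ n) ^ 2 * T.size * T.integral (fun x => ev w x ^ 2) := by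
  have hs := B.size_pos
  have hK := B.one_le
  have hres := B.residual_le hid hLm hLj
  have hval := B.value_jump_le hd hid hLm hLj i ham haj
  set W := T.integral (fun x => ev w x ^ 2) with hW
  have hW0 : 0 ≤ W := integral_sq_nonneg _
  set S := Finset.univ.erase i with hS
  have hcard : S.card + 1 = T.numFacets := by
    rw [hS, Finset.card_erase_add_one (Finset.mem_univ i)]; simp
  set q := T.extend i (g i) with hq
  set φ := T.bubble S ^ 2 * q with hφ
  set X := T.facetIntegral i (fun z => (ev (T.bubble S) z * ev (g i) z) ^ 2) with hX
  have hX0 : 0 ≤ X := facetIntegral_sq_nonneg _ _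
  have hφj : φ.totalDegree ≤ j := by
    have h3 := T.totalDegree_bubble_sq_mul_le S q
    have h4 := T.totalDegree_extend_le i (g i)
    rw [← hφ] at h3
    rw [← hq] at h4
    omega
  have hbz : ∀ l, l ≠ i → ∀ x ∈ T.facet l, ev (T.bubble S) x = 0 := fun l hl x hx =>
    T.ev_bubble_eq_zero (Finset.mem_erase.2 ⟨hl, Finset.mem_univ l⟩) hx
  have h1 := hid φ hφj
  rw [Finset.sum_eq_single i
      (fun l _ hl => facetIntegral_eq_zero fun x hx => by
        rw [hφ, grad_sq_mul_eq_zero _ (hbz l hl x hx), inner_zero_left, mul_zero])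
      (fun h => absurd (Finset.mem_univ i) h),
    Finset.sum_eq_single i
      (fun l _ hl => facetIntegral_eq_zero fun x hx => by
        rw [hφ, pow_two, mul_assoc, ev_mul, hbz l hl x hx]; ring)
      (fun h => absurd (Finset.mem_univ i) h)] at h1
  have h2 : T.facetIntegral i (fun x => ev (g i) x * ev φ x) = X := by
    refine facetIntegral_congr fun x hx => ?_
    rw [hφ, pow_two (T.bubble S), ev_mul, ev_mul, hq, T.ev_extend_of_mem _ hx]
    ring
  set Y := T.facetIntegral i (fun x => ev (a i) x * inner ℝ (grad φ x) (T.normal i)) with hY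
  set Z := T.integral (fun x => (ev L x - ev w x) * ev φ x) with hZ
  have h3 : X = Z + Y := by
    rw [hZ, integral_sub_mul, h1, h2]; ring
  have hcin : Continuous fun x => (inner ℝ (grad φ x) (T.normal i) : ℝ) :=
    (continuous_grad φ).inner continuous_const
  have h4 : Z ^ 2 ≤ _ := sq_cellIntegral_mul_le (T := T)
    ((continuous_ev L).sub (continuous_ev w)) (continuous_ev φ)
  have h5 : Y ^ 2 ≤ _ := sq_facetIntegral_mul_le (T := T) i (continuous_ev (a i)) hcin
  obtain ⟨x₀, hx₀⟩ := T.facet_nonempty i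
  have hpow : T.size ^ d = T.size * T.size ^ (d - 1) := by
    rw [← pow_succ']; congr 1; omega
  set M := 16 ^ n * K * (T.size ^ S.card) ^ 2 * X / T.size ^ (d - 1) with hM
  have hM0 : 0 ≤ M := by positivity
  have hφM : ∀ x, ‖x - x₀‖ ≤ T.size → ev φ x ^ 2 ≤ M := by
    intro x hx
    rw [hM, le_div_iff₀ (by positivity), mul_comm]
    exact B.testFunction_le i hgm hx₀ hx
  have h6 : T.integral (fun x => ev φ x ^ 2) ≤
      K ^ 2 * 16 ^ n * T.size * (T.size ^ S.card) ^ 2 * X := by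
    refine (B.cell_le (fun x => ev φ x ^ 2) M ((continuous_ev φ).pow 2) hM0
      fun x hx => hφM x (T.norm_sub_le_size hx hx₀.1)).trans (le_of_eq ?_)
    rw [hM, hpow]
    field_simp
  have h7 : T.facetIntegral i (fun x => (inner ℝ (grad φ x) (T.normal i) : ℝ) ^ 2) ≤
      K ^ 4 * 16 ^ n * (T.size ^ S.card) ^ 2 * X / T.size ^ 2 := by
    refine (B.facet_le i (fun x => (inner ℝ (grad φ x) (T.normal i) : ℝ) ^ 2)
      (K ^ 2 * M / T.size ^ 2) (hcin.pow 2) (by positivity)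
      fun x hx => ?_).trans (le_of_eq ?_)
    · have h8 := B.grad_le φ (Real.sqrt M) (hφj.trans hjm) x₀ hx₀.1
        (fun y hy => Real.abs_le_sqrt (hφM y hy)) x (T.norm_sub_le_size hx.1 hx₀.1)
      have h9 : |(inner ℝ (grad φ x) (T.normal i) : ℝ)| ≤ ‖grad φ x‖ := by
        refine (abs_real_inner_le_norm _ _).trans ?_
        rw [T.norm_normal, mul_one]
      rw [le_div_iff₀ (by positivity), ← sq_abs, ← mul_pow]
      calc (|(inner ℝ (grad φ x) (T.normal i) : ℝ)| * T.size) ^ 2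
          ≤ (K * Real.sqrt M) ^ 2 := by
            refine pow_le_pow_left₀ (by positivity) (le_trans ?_ h8) 2
            rw [mul_comm]
            exact mul_le_mul_of_nonneg_left h9 hs.le
        _ = K ^ 2 * M := by rw [mul_pow, Real.sq_sqrt hM0]
    · rw [hM]
      field_simp
  have h8 : X ≤ (16 * K ^ 10 * (16 ^ n) ^ 2 * T.size * W) * (T.size ^ S.card) ^ 2 := by
    refine le_of_sq_le_mul hX0 (by positivity) ?_
    have hZ2 : Z ^ 2 ≤ (4 * K ^ 2 * W) * (K ^ 2 * 16 ^ n * T.size * (T.size ^ S.card) ^ 2 * X) :=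
      h4.trans (mul_le_mul hres h6 (integral_sq_nonneg _) (by positivity))
    have hY2 : Y ^ 2 ≤ (4 * K ^ 6 * 16 ^ n * T.size ^ 3 * W) *
        (K ^ 4 * 16 ^ n * (T.size ^ S.card) ^ 2 * X / T.size ^ 2) :=
      h5.trans (mul_le_mul hval h7 (facetIntegral_sq_nonneg _ _) (by positivity))
    -- Both contributions scale alike: the cube of `T.size` in the bound for the value jump, divided
    -- by the square from the inverse estimate, matches the single power in the cell term.
    set A := T.size * W * (T.size ^ S.card) ^ 2 * X with hA
    have hA0 : 0 ≤ A := by positivity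
    have hZ3 : Z ^ 2 ≤ 4 * (K ^ 4 * 16 ^ n) * A := hZ2.trans (le_of_eq (by rw [hA]; ring))
    have hY3 : Y ^ 2 ≤ 4 * (K ^ 10 * (16 ^ n) ^ 2) * A :=
      hY2.trans (le_of_eq (by rw [hA]; field_simp))
    have hKQ : K ^ 4 * 16 ^ n ≤ K ^ 10 * (16 ^ n) ^ 2 := by
      have h16 : (1 : ℝ) ≤ 16 ^ n := one_le_pow₀ (by norm_num)
      have : K ^ 4 ≤ K ^ 10 := pow_le_pow_right₀ hK (by norm_num)
      have : (16 : ℝ) ^ n ≤ (16 ^ n) ^ 2 := le_self_pow₀ h16 (by norm_num)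
      gcongr
    have hKQA : K ^ 4 * 16 ^ n * A ≤ K ^ 10 * (16 ^ n) ^ 2 * A :=
      mul_le_mul_of_nonneg_right hKQ hA0
    calc X ^ 2 ≤ 2 * Z ^ 2 + 2 * Y ^ 2 := by rw [h3]; nlinarith [sq_nonneg (Z - Y)]
      _ ≤ 16 * (K ^ 10 * (16 ^ n) ^ 2) * A := by linarith
      _ = _ := by rw [hA]; ring
  refine (B.facet_le_of_weighted i hgm (by positivity) h8).trans (le_of_eq ?_)
  ring

end ConvexPolytope

end WeakGalerkin

/-! ### The two-sided estimate on a cell and Green's identity -/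

namespace WeakGalerkin

namespace ConvexPolytope

section

variable {d : ℕ} {T : ConvexPolytope d} {m n j : ℕ} {K : ℝ} {w L : MvPolynomial (Fin d) ℝ}
  {a g : Fin T.numFacets → MvPolynomial (Fin d) ℝ}

/-- The weak identity tested with `w` itself. The trace bounds for `w` and its normal derivative
lose `T.size⁻¹` and `T.size ^ (-3)`, exactly the weights of the jumps; 3 comes from squaring a sum
of three terms and `n` from summing over the facets. -/
theorem Bounds.weakLap_le (hd : 1 ≤ d) (B : T.Bounds m n K) (hid : T.WeakIdentity j w L a g)
    (hw : w.totalDegree ≤ j) (hjm : j ≤ m) :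
    T.integral (fun x => ev w x ^ 2) ≤ 3 * (n + 1) * K ^ 4 *
      (T.integral (fun x => ev L x ^ 2)
        + T.size ^ (-3 : ℤ) * ∑ i, T.facetIntegral i (fun x => ev (a i) x ^ 2)
        + T.size ^ (-1 : ℤ) * ∑ i, T.facetIntegral i (fun x => ev (g i) x ^ 2)) := by
  have hs := B.size_pos
  have hK := B.one_le
  set W := T.integral (fun x => ev w x ^ 2) with hW
  have hW0 : 0 ≤ W := integral_sq_nonneg _
  have hpow : T.size ^ d = T.size * T.size ^ (d - 1) := by
    rw [← pow_succ']; congr 1; omega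
  set M := K * W / T.size ^ d with hM
  have hM0 : 0 ≤ M := by positivity
  have hwM : ∀ x₀ ∈ T.carrier, ∀ x, ‖x - x₀‖ ≤ T.size → ev w x ^ 2 ≤ M := by
    intro x₀ hx₀ x hx
    rw [hM, le_div_iff₀ (by positivity), mul_comm]
    exact B.cell_sup w (hw.trans hjm) x₀ hx₀ x hx
  have hcin : ∀ i, Continuous fun x => (inner ℝ (grad w x) (T.normal i) : ℝ) := fun i =>
    (continuous_grad w).inner continuous_const
  have hfw : ∀ i, T.facetIntegral i (fun x => ev w x ^ 2) ≤ K ^ 2 * W / T.size := by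
    intro i
    refine (B.facet_le i (fun x => ev w x ^ 2) M ((continuous_ev w).pow 2) hM0
      fun x hx => hwM x hx.1 x (by simpa using hs.le)).trans (le_of_eq ?_)
    rw [hM, hpow]
    field_simp
  have hfg : ∀ i, T.facetIntegral i (fun x => (inner ℝ (grad w x) (T.normal i) : ℝ) ^ 2) ≤
      K ^ 4 * W / T.size ^ 3 := by
    intro i
    refine (B.facet_le i (fun x => (inner ℝ (grad w x) (T.normal i) : ℝ) ^ 2)
      (K ^ 2 * M / T.size ^ 2) ((hcin i).pow 2) (by positivity) fun x hx => ?_).trans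
      (le_of_eq ?_)
    · have h8 := B.grad_le w (Real.sqrt M) (hw.trans hjm) x hx.1
        (fun y hy => Real.abs_le_sqrt (hwM x hx.1 y hy)) x (by simpa using hs.le)
      have h9 : |(inner ℝ (grad w x) (T.normal i) : ℝ)| ≤ ‖grad w x‖ := by
        refine (abs_real_inner_le_norm _ _).trans ?_
        rw [T.norm_normal, mul_one]
      rw [le_div_iff₀ (by positivity), ← sq_abs, ← mul_pow]
      calc (|(inner ℝ (grad w x) (T.normal i) : ℝ)| * T.size) ^ 2
          ≤ (K * Real.sqrt M) ^ 2 := by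
            refine pow_le_pow_left₀ (by positivity) (le_trans ?_ h8) 2
            rw [mul_comm]
            exact mul_le_mul_of_nonneg_left h9 hs.le
        _ = K ^ 2 * M := by rw [mul_pow, Real.sq_sqrt hM0]
    · rw [hM, hpow]
      field_simp
  set A := T.integral (fun x => ev L x ^ 2) with hA
  set α := fun i => T.facetIntegral i (fun x => ev (a i) x ^ 2) with hα
  set γ := fun i => T.facetIntegral i (fun x => ev (g i) x ^ 2) with hγ
  have hA0 : 0 ≤ A := integral_sq_nonneg _
  have hα0 : ∀ i, 0 ≤ α i := fun i => facetIntegral_sq_nonneg _ _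
  have hγ0 : ∀ i, 0 ≤ γ i := fun i => facetIntegral_sq_nonneg _ _
  have hαs : 0 ≤ ∑ i, α i := Finset.sum_nonneg fun i _ => hα0 i
  have hγs : 0 ≤ ∑ i, γ i := Finset.sum_nonneg fun i _ => hγ0 i
  set X := T.integral (fun x => ev L x * ev w x) with hX
  set Y := fun i => T.facetIntegral i (fun x => ev (a i) x * inner ℝ (grad w x) (T.normal i))
    with hY
  set Z := fun i => T.facetIntegral i (fun x => ev (g i) x * ev w x) with hZ
  have h1 : W = X + ∑ i, Y i - ∑ i, Z i := by
    rw [← hid w hw, hW]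
    congr 1; funext x; ring
  have hX2 : X ^ 2 ≤ A * W := sq_cellIntegral_mul_le (continuous_ev L) (continuous_ev w)
  have hY2 : ∀ i, Y i ^ 2 ≤ α i * (K ^ 4 * W / T.size ^ 3) := fun i =>
    (sq_facetIntegral_mul_le i (continuous_ev (a i)) (hcin i)).trans
      (mul_le_mul_of_nonneg_left (hfg i) (hα0 i))
  have hZ2 : ∀ i, Z i ^ 2 ≤ γ i * (K ^ 2 * W / T.size) := fun i =>
    (sq_facetIntegral_mul_le i (continuous_ev (g i)) (continuous_ev w)).trans
      (mul_le_mul_of_nonneg_left (hfw i) (hγ0 i))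
  have hn : ((Finset.univ : Finset (Fin T.numFacets)).card : ℝ) ≤ n := by
    simpa using B.numFacets_le
  have hYs : (∑ i, Y i) ^ 2 ≤ n * ((∑ i, α i) * (K ^ 4 * W / T.size ^ 3)) := by
    refine sq_sum_le_card_mul_sum_sq.trans ?_
    rw [Finset.sum_mul]
    exact mul_le_mul hn (Finset.sum_le_sum fun i _ => hY2 i)
      (Finset.sum_nonneg fun i _ => sq_nonneg _) (by positivity)
  have hZs : (∑ i, Z i) ^ 2 ≤ n * ((∑ i, γ i) * (K ^ 2 * W / T.size)) := by
    refine sq_sum_le_card_mul_sum_sq.trans ?_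
    rw [Finset.sum_mul]
    exact mul_le_mul hn (Finset.sum_le_sum fun i _ => hZ2 i)
      (Finset.sum_nonneg fun i _ => sq_nonneg _) (by positivity)
  have hK4 : (1 : ℝ) ≤ K ^ 4 := one_le_pow₀ hK
  have hK24 : K ^ 2 ≤ K ^ 4 := pow_le_pow_right₀ hK (by norm_num)
  have e3 : T.size ^ (-3 : ℤ) = (T.size ^ 3)⁻¹ := by
    rw [zpow_neg]; norm_cast
  rw [e3, zpow_neg_one]
  set P := (T.size ^ 3)⁻¹ * ∑ i, α i with hP
  set Q := T.size⁻¹ * ∑ i, γ i with hQ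
  have hP0 : 0 ≤ P := by positivity
  have hQ0 : 0 ≤ Q := by positivity
  refine le_of_sq_le_mul hW0 (by positivity) ?_
  have hX3 : X ^ 2 ≤ (n + 1) * K ^ 4 * A * W := by
    refine hX2.trans (mul_le_mul_of_nonneg_right ?_ hW0)
    refine le_mul_of_one_le_left hA0 ?_
    have : (1 : ℝ) ≤ n + 1 := by linarith [(Nat.cast_nonneg n : (0 : ℝ) ≤ n)]
    exact one_le_mul_of_one_le_of_one_le this hK4
  have hY3 : (∑ i, Y i) ^ 2 ≤ (n + 1) * K ^ 4 * P * W := by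
    calc _ ≤ _ := hYs
      _ = n * K ^ 4 * P * W := by rw [hP]; field_simp
      _ ≤ (n + 1) * K ^ 4 * P * W := by gcongr; linarith
  have hZ3 : (∑ i, Z i) ^ 2 ≤ (n + 1) * K ^ 4 * Q * W := by
    calc _ ≤ _ := hZs
      _ = n * K ^ 2 * Q * W := by rw [hQ]; field_simp
      _ ≤ (n + 1) * K ^ 4 * Q * W := by gcongr; linarith
  calc W ^ 2 = (X + ∑ i, Y i - ∑ i, Z i) ^ 2 := by rw [← h1]
    _ ≤ 3 * (X ^ 2 + (∑ i, Y i) ^ 2 + (∑ i, Z i) ^ 2) := by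
      nlinarith [sq_nonneg (X - ∑ i, Y i), sq_nonneg (X + ∑ i, Z i),
        sq_nonneg (∑ i, Y i + ∑ i, Z i)]
    _ ≤ 3 * ((n + 1) * K ^ 4 * A * W + (n + 1) * K ^ 4 * P * W + (n + 1) * K ^ 4 * Q * W) := by
      linarith
    _ = _ := by ring

theorem Bounds.le_weakLap (hd : 1 ≤ d) (B : T.Bounds m n K) (hid : T.WeakIdentity j w L a g)
    (hjm : j ≤ m) (hLm : L.totalDegree ≤ m) (hLj : 2 * T.numFacets + L.totalDegree ≤ j)
    (ham : ∀ i, (a i).totalDegree ≤ m) (haj : ∀ i, 2 * T.numFacets - 1 + (a i).totalDegree ≤ j)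
    (hgm : ∀ i, (g i).totalDegree ≤ m)
    (hgj : ∀ i, 2 * (T.numFacets - 1) + (g i).totalDegree ≤ j) :
    T.integral (fun x => ev L x ^ 2)
        + T.size ^ (-3 : ℤ) * ∑ i, T.facetIntegral i (fun x => ev (a i) x ^ 2)
        + T.size ^ (-1 : ℤ) * ∑ i, T.facetIntegral i (fun x => ev (g i) x ^ 2) ≤
      (K ^ 2 + n * (4 * K ^ 6 * 16 ^ n) + n * (16 * K ^ 12 * (16 ^ n) ^ 2)) *
        T.integral (fun x => ev w x ^ 2) := by
  have hs := B.size_pos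
  have hK := B.one_le
  have h1 := B.interior_le hid hLm hLj
  have h2 := fun i => B.value_jump_le hd hid hLm hLj i (ham i) (haj i)
  have h3 := fun i => B.derivative_jump_le hd hid hLm hLj i (ham i) (haj i) hjm (hgm i) (hgj i)
  set W := T.integral (fun x => ev w x ^ 2) with hW
  have hW0 : 0 ≤ W := integral_sq_nonneg _
  have sum_le : ∀ (f : Fin T.numFacets → ℝ) (c : ℝ), 0 ≤ c → (∀ i, f i ≤ c) →
      ∑ i, f i ≤ n * c := by
    intro f c hc hf
    refine (Finset.sum_le_card_nsmul _ _ c fun i _ => hf i).trans ?_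
    rw [nsmul_eq_mul]
    refine mul_le_mul_of_nonneg_right ?_ hc
    simpa using B.numFacets_le
  have h2' := sum_le _ _ (by positivity) h2
  have h3' := sum_le _ _ (by positivity) h3
  have e3 : T.size ^ (-3 : ℤ) = (T.size ^ 3)⁻¹ := by
    rw [zpow_neg]; norm_cast
  rw [e3, zpow_neg_one]
  have h2'' := mul_le_mul_of_nonneg_left h2' (by positivity : 0 ≤ (T.size ^ 3)⁻¹)
  have h3'' := mul_le_mul_of_nonneg_left h3' (by positivity : 0 ≤ T.size⁻¹)
  have e1 : (T.size ^ 3)⁻¹ * (n * (4 * K ^ 6 * 16 ^ n * T.size ^ 3 * W)) =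
      n * (4 * K ^ 6 * 16 ^ n) * W := by field_simp
  have e2 : T.size⁻¹ * (n * (16 * K ^ 12 * (16 ^ n) ^ 2 * T.size * W)) =
      n * (16 * K ^ 12 * (16 ^ n) ^ 2) * W := by field_simp
  linarith

end

/-- Green's second identity on a polytope. -/
theorem integral_mul_lap {d : ℕ} (T : ConvexPolytope (d + 1)) (p φ : MvPolynomial (Fin (d + 1)) ℝ) :
    T.integral (fun x => ev p x * ev (lap φ) x) =
      T.integral (fun x => ev (lap p) x * ev φ x)
        + ∑ i, T.facetIntegral i (fun x => ev p x * inner ℝ (grad φ x) (T.normal i))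
        - ∑ i, T.facetIntegral i (fun x => inner ℝ (grad p x) (T.normal i) * ev φ x) := by
  -- The components of p∇φ - φ∇p; in the divergence the products of first derivatives cancel.
  let f : Fin (d + 1) → MvPolynomial (Fin (d + 1)) ℝ := fun b =>
    p * MvPolynomial.pderiv b φ - φ * MvPolynomial.pderiv b p
  have hlap : ∀ (q : MvPolynomial (Fin (d + 1)) ℝ) x,
      ev (lap q) x = ∑ b, ev (MvPolynomial.pderiv b (MvPolynomial.pderiv b q)) x := fun q x => by
    simp [ev, lap]
  have hin : ∀ (q : MvPolynomial (Fin (d + 1)) ℝ) x i,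
      (inner ℝ (grad q x) (T.normal i) : ℝ) = ∑ b, T.normal i b * ev (MvPolynomial.pderiv b q) x :=
    fun q x i => by simp [grad, PiLp.inner_apply]
  have hf : ∀ b x, ev (MvPolynomial.pderiv b (f b)) x =
      ev p x * ev (MvPolynomial.pderiv b (MvPolynomial.pderiv b φ)) x -
        ev (MvPolynomial.pderiv b (MvPolynomial.pderiv b p)) x * ev φ x := by
    intro b x
    simp only [f, ev, map_sub, Derivation.leibniz, smul_eq_mul, map_add, map_mul]
    ring
  have hint : ∀ q r : MvPolynomial (Fin (d + 1)) ℝ,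
      IntegrableOn (fun x => ev q x * ev r x) T.carrier := fun q r =>
    T.integrableOn ((continuous_ev q).mul (continuous_ev r))
  have hcin : ∀ (q : MvPolynomial (Fin (d + 1)) ℝ) i,
      Continuous fun x => (inner ℝ (grad q x) (T.normal i) : ℝ) := fun q i =>
    (continuous_grad q).inner continuous_const
  have h1 : ∑ b, T.integral (ev (MvPolynomial.pderiv b (f b))) =
      T.integral (fun x => ev p x * ev (lap φ) x) -
        T.integral (fun x => ev (lap p) x * ev φ x) := by
    simp only [integral]
    rw [← integral_finsetSum _ fun b _ => T.integrableOn (continuous_ev _),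
      ← integral_sub (hint _ _) (hint _ _)]
    congr 1; funext x
    simp only [hf, hlap, Finset.sum_sub_distrib, Finset.mul_sum, Finset.sum_mul]
  have h2 : ∑ b, ∑ i, T.normal i b * T.facetIntegral i (ev (f b)) =
      ∑ i, T.facetIntegral i (fun x => ev p x * inner ℝ (grad φ x) (T.normal i))
        - ∑ i, T.facetIntegral i (fun x => inner ℝ (grad p x) (T.normal i) * ev φ x) := by
    rw [Finset.sum_comm, ← Finset.sum_sub_distrib]
    refine Finset.sum_congr rfl fun i _ => ?_
    have i1 : IntegrableOn (fun x => ev p x * inner ℝ (grad φ x) (T.normal i)) (T.facet i)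
        μHE[d + 1 - 1] := T.integrableOn_facet i ((continuous_ev p).mul (hcin φ i))
    have i2 : IntegrableOn (fun x => inner ℝ (grad p x) (T.normal i) * ev φ x) (T.facet i)
        μHE[d + 1 - 1] := T.integrableOn_facet i ((hcin p i).mul (continuous_ev φ))
    simp only [facetIntegral]
    rw [← integral_sub i1 i2]
    simp only [← integral_const_mul]
    rw [← integral_finsetSum _ fun b _ =>
      (T.integrableOn_facet i (continuous_ev (f b))).const_mul _]
    congr 1; funext x
    simp only [hin, f, ev_sub, ev_mul, Finset.mul_sum, Finset.sum_mul,
      ← Finset.sum_sub_distrib]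
    exact Finset.sum_congr rfl fun b _ => by ring
  have h3 : ∑ b, T.integral (ev (MvPolynomial.pderiv b (f b))) =
      ∑ b, ∑ i, T.normal i b * T.facetIntegral i (ev (f b)) :=
    Finset.sum_congr rfl fun b _ => T.integral_pderiv b (f b)
  linarith

end ConvexPolytope

/-! ### Jumps of a weak function and the integrated form of the weak Laplacian -/

namespace Mesh

variable {d : ℕ} {Ω : Set (Space d)} {M : Mesh d Ω} {k : ℕ} (v : M.WGSpace k)

/-- The jump `v₀ - v_b` on the facet `i` of the cell `T`. -/
def WGSpace.valueJump (T : Fin M.numCells) (i : Fin (M.cell T).numFacets) :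
    MvPolynomial (Fin d) ℝ :=
  (v.v0 T).1 - (v.vb (M.facetOf T i)).1

/-- The jump `(∇v₀ - v_n n_e) · n` on the facet `i` of the cell `T`. -/
def WGSpace.derivativeJump (T : Fin M.numCells) (i : Fin (M.cell T).numFacets) :
    MvPolynomial (Fin d) ℝ :=
  ∑ b, MvPolynomial.C ((M.cell T).normal i b) * MvPolynomial.pderiv b (v.v0 T).1 -
    MvPolynomial.C (inner ℝ (M.normalDir (M.facetOf T i)) ((M.cell T).normal i)) *
      (v.vn (M.facetOf T i)).1

theorem WGSpace.ev_valueJump (T : Fin M.numCells) (i : Fin (M.cell T).numFacets) (x : Space d) :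
    ev (v.valueJump T i) x = ev (v.v0 T).1 x - ev (v.vb (M.facetOf T i)).1 x :=
  ev_sub _ _ _

theorem WGSpace.ev_derivativeJump (T : Fin M.numCells) (i : Fin (M.cell T).numFacets)
    (x : Space d) : ev (v.derivativeJump T i) x =
      inner ℝ (grad (v.v0 T).1 x
        - ev (v.vn (M.facetOf T i)).1 x • M.normalDir (M.facetOf T i)) ((M.cell T).normal i) := by
  rw [inner_sub_left, real_inner_smul_left, derivativeJump, ev_sub, ev_mul]
  congr 1
  · simp [ev, grad, PiLp.inner_apply]
  · simp [ev, mul_comm]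

theorem totalDegree_le_of_poly {d k : ℕ} (p : Poly d k) : p.1.totalDegree ≤ k :=
  (MvPolynomial.mem_restrictTotalDegree _ _ _).1 p.2

theorem WGSpace.totalDegree_valueJump_le (T : Fin M.numCells) (i : Fin (M.cell T).numFacets) :
    (v.valueJump T i).totalDegree ≤ k :=
  (MvPolynomial.totalDegree_sub _ _).trans
    (max_le (totalDegree_le_of_poly _) (totalDegree_le_of_poly _))

theorem WGSpace.totalDegree_derivativeJump_le (T : Fin M.numCells)
    (i : Fin (M.cell T).numFacets) : (v.derivativeJump T i).totalDegree ≤ k - 1 := by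
  have hC : ∀ (c : ℝ) (p : MvPolynomial (Fin d) ℝ), p.totalDegree ≤ k - 1 →
      (MvPolynomial.C c * p).totalDegree ≤ k - 1 := fun c p hp =>
    (MvPolynomial.totalDegree_mul _ _).trans (by simpa using hp)
  refine (MvPolynomial.totalDegree_sub _ _).trans
    (max_le ?_ (hC _ _ (totalDegree_le_of_poly _)))
  refine MvPolynomial.totalDegree_finsetSum_le fun b _ => hC _ _ ?_
  exact (totalDegree_pderiv_le _ _).trans
    (Nat.sub_le_sub_right (totalDegree_le_of_poly (v.v0 T)) 1)

/-- Green's identity for (v₀, Δφ) supplies the boundary terms of v₀, which combine with those of v_b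
and v_n into the two jumps. -/
theorem WGSpace.weakIdentity (hd : 1 ≤ d) (j : ℕ) (T : Fin M.numCells) :
    (M.cell T).WeakIdentity j (v.weakLap j T).1 (lap (v.v0 T).1) (v.valueJump T)
      (v.derivativeJump T) := by
  -- The divergence theorem splits off one coordinate, so the dimension is written as a successor.
  obtain ⟨d, rfl⟩ := Nat.exists_eq_add_of_le' hd
  intro φ hφ
  have h1 := v.weakLap_spec j T ⟨φ, (MvPolynomial.mem_restrictTotalDegree _ _ _).2 hφ⟩
  simp only [weakLapRHS, ConvexPolytope.integral_mul_lap] at h1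
  rw [h1]
  have hcin : ∀ (q : MvPolynomial (Fin (d + 1)) ℝ) i,
      Continuous fun x => (inner ℝ (grad q x) ((M.cell T).normal i) : ℝ) := fun q i =>
    (continuous_grad q).inner continuous_const
  have ha : ∀ i, (M.cell T).facetIntegral i
        (fun x => ev (v.valueJump T i) x * inner ℝ (grad φ x) ((M.cell T).normal i)) =
      (M.cell T).facetIntegral i
        (fun x => ev (v.v0 T).1 x * inner ℝ (grad φ x) ((M.cell T).normal i)) -
      (M.cell T).facetIntegral i
        (fun x => ev (v.vb (M.facetOf T i)).1 x *
          inner ℝ (grad φ x) ((M.cell T).normal i)) := by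
    intro i
    have h : ∀ p : MvPolynomial (Fin (d + 1)) ℝ, IntegrableOn
        (fun x => ev p x * inner ℝ (grad φ x) ((M.cell T).normal i)) ((M.cell T).facet i)
        μHE[d + 1 - 1] := fun p =>
      (M.cell T).integrableOn_facet i ((continuous_ev p).mul (hcin φ i))
    simp only [ConvexPolytope.facetIntegral, v.ev_valueJump, sub_mul]
    exact integral_sub (h _) (h _)
  have hg : ∀ i, (M.cell T).facetIntegral i (fun x => ev (v.derivativeJump T i) x * ev φ x) =
      (M.cell T).facetIntegral i
        (fun x => inner ℝ (grad (v.v0 T).1 x) ((M.cell T).normal i) * ev φ x) -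
      (M.cell T).facetIntegral i
        (fun x => inner ℝ (ev (v.vn (M.facetOf T i)).1 x • M.normalDir (M.facetOf T i))
          ((M.cell T).normal i) * ev φ x) := by
    intro i
    have h : ∀ f : Space (d + 1) → Space (d + 1), Continuous f → IntegrableOn
        (fun x => inner ℝ (f x) ((M.cell T).normal i) * ev φ x) ((M.cell T).facet i)
        μHE[d + 1 - 1] := fun f hf =>
      (M.cell T).integrableOn_facet i ((hf.inner continuous_const).mul (continuous_ev φ))
    simp only [ConvexPolytope.facetIntegral, v.ev_derivativeJump, inner_sub_left, sub_mul]
    exact integral_sub (h _ (continuous_grad _)) (h _ ((continuous_ev _).smul continuous_const))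
  simp only [ha, hg, Finset.sum_sub_distrib]
  ring

/-- The contribution of the cell `T` to the square of the discrete `H²` norm. -/
def WGSpace.cellNorm (T : Fin M.numCells) : ℝ :=
  (M.cell T).integral (fun x => ev (lap (v.v0 T).1) x ^ 2)
    + (M.cell T).size ^ (-3 : ℤ) *
      ∑ i, (M.cell T).facetIntegral i (fun x => ev (v.valueJump T i) x ^ 2)
    + (M.cell T).size ^ (-1 : ℤ) *
      ∑ i, (M.cell T).facetIntegral i (fun x => ev (v.derivativeJump T i) x ^ 2)

theorem WGSpace.norm2h_eq : v.norm2h = Real.sqrt (∑ T, v.cellNorm T) := by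
  simp only [norm2h, cellNorm, ev_valueJump, ev_derivativeJump]

end Mesh

end WeakGalerkin

/-! ### Summation over the cells -/

theorem mainTheorem3 (d k n j : ℕ) (hd : d = 2 ∨ d = 3) (hk : 2 ≤ k)
    (hj : k + 2 * n - 1 ≤ j) (ρ κ α₀ : ℝ) (hρ : 0 < ρ) (hκ : 0 < κ) (hα₀ : 0 < α₀) :
    ∃ C₁ C₂ : ℝ, 0 < C₁ ∧ 0 < C₂ ∧
      ∀ Ω : Set (WeakGalerkin.Space d), IsOpen Ω → IsConnected Ω →
      ∀ M : WeakGalerkin.Mesh d Ω, M.ShapeRegular n ρ κ α₀ →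
      ∀ v : M.WGSpace k,
        C₁ * v.norm2h ≤ v.tripleNorm j ∧ v.tripleNorm j ≤ C₂ * v.norm2h := by
  have hd2 : 2 ≤ d := by omega
  obtain ⟨K, hK, hB⟩ :=
    -- Degree `j + k` covers the test functions and `w` (at most `j`) as well as the Laplacian and
    -- the jumps (at most `k`).
    WeakGalerkin.ConvexPolytope.exists_bounds hd2 (j + k) n hρ hκ hα₀
  set A : ℝ := K ^ 2 + n * (4 * K ^ 6 * 16 ^ n) + n * (16 * K ^ 12 * (16 ^ n) ^ 2) with hA
  set D : ℝ := 3 * (n + 1) * K ^ 4 with hD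
  have hA0 : 0 < A := by positivity
  have hD0 : 0 < D := by positivity
  -- `A` and `D` are the constants of `le_weakLap` and `weakLap_le`; both squared norms are sums
  -- over cells, so they compare termwise.
  refine ⟨(Real.sqrt A)⁻¹, Real.sqrt D, by positivity, by positivity, ?_⟩
  intro Ω _ _ M hM v
  rw [v.norm2h_eq, WeakGalerkin.Mesh.WGSpace.tripleNorm]
  constructor
  · rw [inv_mul_le_iff₀ (by positivity), ← Real.sqrt_mul hA0.le, Finset.mul_sum]
    refine Real.sqrt_le_sqrt (Finset.sum_le_sum fun T _ => ?_)
    have hn := (hM T).numFacets_le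
    have hL := WeakGalerkin.totalDegree_lap_le (v.v0 T).1
    have h0 := WeakGalerkin.Mesh.totalDegree_le_of_poly (v.v0 T)
    have ha := v.totalDegree_valueJump_le T
    have hg := v.totalDegree_derivativeJump_le T
    -- The degree counts are `2N + (k - 2)`, `2N - 1 + k` and `2(N - 1) + (k - 1)`, the second being
    -- the largest. `i.pos` records that a cell with a facet has at least one, so the truncated
    -- subtractions are genuine.
    exact (hB _ (hM T)).le_weakLap (by omega) (v.weakIdentity (by omega) j T) (by omega)
      (by omega) (by omega) (fun i => by have := ha i; omega)
      (fun i => by have := ha i; have := i.pos; omega) (fun i => by have := hg i; omega)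
      (fun i => by have := hg i; have := i.pos; omega)
  · rw [← Real.sqrt_mul hD0.le, Finset.mul_sum]
    refine Real.sqrt_le_sqrt (Finset.sum_le_sum fun T _ => ?_)
    exact (hB _ (hM T)).weakLap_le (by omega) (v.weakIdentity (by omega) j T)
      (WeakGalerkin.Mesh.totalDegree_le_of_poly _) (by omega)

end
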